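/- Let $1\le d\le n$ and $R=\mathbb Q[x_1,\dots,x_d]$. **Soergel categories.** $\mathcal{SC}_1(d)$ is the $\mathbb Q$-linear monoidal category of Elias and Khovanov: objects are finite words in the colors $1,\dots,d-1$; morphisms are $\mathbb Q$-linear combinations of planar diagrams generated by StartDot $\emptyset\to i$, EndDot $i\to\emptyset$, Merge $ii\to i$, Split $i\to ii$, the 4-valent vertex $ij\to ji$ ($|i-j|>1$) and the 6-valent vertex $iji\to jij$ ($|i-j|=1$), modulo the Elias–Khovanov relations. $\mathcal{SC}_1'(d)$ has in addition boxes $\boxed{k}:\emptyset\to\emptyset$ ($1\le k\le d$) and the box relations (in particular the double dot of color $i$ equals $\boxed{i}-\boxed{i+1}$). **The functor $\mathcal F_{EK}$** (and $\mathcal F'_{EK}$ on $\mathcal{SC}_1'(d)$), with values in $(R,R)$-bimodules and bimodule maps of all degrees: a word $i_1\cdots i_m$ goes to $R\otimes_{i_1}R\otimes_{i_2}\cdots\otimes_{i_m}R$, where $\otimes_i$ is the tensor product over the polynomials symmetric in $x_i,x_{i+1}$; StartDot is $1\mapsto x_i\otimes1-1\otimes x_{i+1}$, EndDot is $f\otimes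 g\mapsto fg$, Merge is $f\otimes g\otimes h\mapsto f\,\partial_i(g)\otimes h$, Split is $f\otimes g\mapsto f\otimes1\otimes g$; the 4-valent vertex is the bimodule map $1\otimes1\otimes1\mapsto1\otimes1\otimes1$; the 6-valent vertex $iji\to jij$ is the bimodule map with $1\otimes1\otimes1\otimes1\mapsto1\otimes1\otimes1\otimes1$ and $1\otimes x_p\otimes1\otimes1\mapsto(x_p+x_q)\otimes1\otimes1\otimes1-1\otimes1\otimes1\otimes x_r$, where $(p,q,r)=(i,i+1,i+2)$ if $j=i+1$ and $(p,q,r)=(i+1,i,i-1)$ if $j=i-1$; the box $k$ acts by $x_k$. **The target of $\Sigma$.** $\mathcal S(n,d)^*((1^d),(1^d))$ is the category of 1-endomorphisms of the weight $(1^d)$ in the diagrammatic categorification $\mathcal S(n,d)$ of the $q$-Schur algebra (the quotient of Khovanov and Lauda's diagrammatic 2-category, with signs adapted to $\mathfrak{gl}_n$, by the diagrams with a region labelled outside $\Lambda(n,d)$), with 2-morphisms of all degrees. $\mathcal F_{Bim}$ is the functor to $(R,R)$-bimodules that sends a product of $\mathcal E_{\pm i}$ to the polynomial bimodule of the corresponding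 composite of elementary webs (one alphabet of variables for each edge, modulo the identification of symmetric functions at the vertices), dots to multiplication by the variable of the strand, crossings of equal color to divided differences, crossings of different colors to the relabelling of variables (times the difference of the variable of the higher and that of the lower color, for an upward crossing $\mathcal E_{+(i+1)}\mathcal E_{+i}\to\mathcal E_{+i}\mathcal E_{+(i+1)}$ or a downward crossing $\mathcal E_{-i}\mathcal E_{-(i+1)}\to\mathcal E_{-(i+1)}\mathcal E_{-i}$), cups to multiplication by the complete product of differences, and caps to the corresponding trace maps. **The functor $\Sigma_{n,d}$** is defined on $\mathcal{SC}_1(n)$ if $d=n$ and on $\mathcal{SC}_1'(d)$ if $d<n$. It sends the color $i$ to $\mathcal E_{-i}\mathcal E_{+i}1_{(1^d)}$; StartDot, EndDot, Merge, Split to the corresponding cups and caps; the 4- and 6-valent vertices to their doubled diagrams (for the 6-valent vertex: the crossings that exchange strands of different colors, one cap, one cup, and crossings of strands of the lower color); and, for $d<n$, the box $k$ to $\sum_{j=k}^{d-1}(\text{counterclockwise bubble of color } j)$ minus the fake counterclockwise bubble of color $d$ with label $-1$, all in the region $(1^d)$. **Statement.** Let $\tau$ be the automorphism $x_j\mapsto-x_j$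 of $R$, and let $\tau^*$ be the autoequivalence of the category of $(R,R)$-bimodules that twists both actions by $\tau$. Then the triangles commute up to canonical natural isomorphism: $$\mathcal F_{Bim}\circ\Sigma_{n,n}\;\cong\;\tau^*\circ\mathcal F_{EK}\quad\text{on }\mathcal{SC}_1(n),\qquad \mathcal F_{Bim}\circ\Sigma_{n,d}\;\cong\;\tau^*\circ\mathcal F'_{EK}\quad\text{on }\mathcal{SC}_1'(d)\ (d<n).$$ More precisely, for every word $w$ there is a ring isomorphism $\Phi_w:\mathcal F_{Bim}(\Sigma(w))\to\mathcal F_{EK}(w)$ which intertwines the left and right actions of $R$ up to $\tau$, is compatible with the monoidal structure ($\Phi_{iw}$ restricted to $\mathcal F_{Bim}(\Sigma(w))$ is $z\mapsto1\otimes\Phi_w(z)$), and satisfies $\Phi_v\circ\mathcal F_{Bim}(\Sigma(D))=\mathcal F_{EK}(D)\circ\Phi_u$ for every diagram $D:u\to v$. -/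

import Mathlib

open CategoryTheory Polynomial TensorProduct

/-!
Diagrammatic categories are presented by generators and relations.  A diagram is read from bottom
(source) to top (target); horizontally, words are read from left to right.
-/

/-- Letters (colored boundary points) and generating diagrams of a strict `ℚ`-linear monoidal
presentation. -/
structure MonSig where
  Letter : Type
  Gen : Type
  src : Gen → List Letter
  tgt : Gen → List Letter

/-- `ℚ`-linear combinations of vertical composites of diagrams
`(identity strands) ⊗ generator ⊗ (identity strands)`. -/
inductive Diag (S : MonSig) : List S.Letter → List S.Letter → Type
  | id (w : List S.Letter) : Diag S w w
  | comp {u v w : List S.Letter} : Diag S u v → Diag S v w → Diag S u w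
  | zero (u v : List S.Letter) : Diag S u v
  | add {u v : List S.Letter} : Diag S u v → Diag S u v → Diag S u v
  | smul {u v : List S.Letter} : ℚ → Diag S u v → Diag S u v
  /-- the generator `g` with identity strands `b` on its right -/
  | gen (g : S.Gen) (b : List S.Letter) : Diag S (S.src g ++ b) (S.tgt g ++ b)
  /-- an identity strand added on the left -/
  | cons {u v : List S.Letter} (l : S.Letter) : Diag S u v → Diag S (l :: u) (l :: v)

infixl:65 " ⋆ " => Diag.comp

namespace Diag

variable {S : MonSig}

def whiskerL {u v : List S.Letter} :
    (w : List S.Letter) → Diag S u v → Diag S (w ++ u) (w ++ v)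
  | [], f => f
  | l :: w, f => cons l (whiskerL w f)

def sub {u v : List S.Letter} (f g : Diag S u v) : Diag S u v := add f (smul (-1) g)

def sum {u v : List S.Letter} : (m : ℕ) → (Fin m → Diag S u v) → Diag S u v
  | 0, _ => zero u v
  | m + 1, f => add (sum m fun k => f k.castSucc) (f (Fin.last m))

/-- The equivalence of diagrams generated by the defining relations `base`, the axioms of a
`ℚ`-linear category, linearity and functoriality of horizontal composition, and the interchange
law. -/
inductive Rel (base : ∀ u v : List S.Letter, Diag S u v → Diag S u v → Prop) :
    ∀ {u v : List S.Letter}, Diag S u v → Diag S u v → Prop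
  | of {u v} {f g : Diag S u v} : base u v f g → Rel base f g
  | refl {u v} (f : Diag S u v) : Rel base f f
  | symm {u v} {f g : Diag S u v} : Rel base f g → Rel base g f
  | trans {u v} {f g h : Diag S u v} : Rel base f g → Rel base g h → Rel base f h
  | comp {u v w} {f f' : Diag S u v} {g g' : Diag S v w} :
      Rel base f f' → Rel base g g' → Rel base (f ⋆ g) (f' ⋆ g')
  | add {u v} {f f' g g' : Diag S u v} :
      Rel base f f' → Rel base g g' → Rel base (add f g) (add f' g')
  | smul {u v} (q : ℚ) {f f' : Diag S u v} : Rel base f f' → Rel base (smul q f) (smul q f')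
  | cons {u v} (l : S.Letter) {f f' : Diag S u v} : Rel base f f' → Rel base (cons l f) (cons l f')
  | id_comp {u v} (f : Diag S u v) : Rel base (id u ⋆ f) f
  | comp_id {u v} (f : Diag S u v) : Rel base (f ⋆ id v) f
  | assoc {u v w x} (f : Diag S u v) (g : Diag S v w) (h : Diag S w x) :
      Rel base ((f ⋆ g) ⋆ h) (f ⋆ (g ⋆ h))
  | add_comm {u v} (f g : Diag S u v) : Rel base (add f g) (add g f)
  | add_assoc {u v} (f g h : Diag S u v) : Rel base (add (add f g) h) (add f (add g h))
  | zero_add {u v} (f : Diag S u v) : Rel base (add (zero u v) f) f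
  | one_smul {u v} (f : Diag S u v) : Rel base (smul 1 f) f
  | zero_smul {u v} (f : Diag S u v) : Rel base (smul 0 f) (zero u v)
  | mul_smul {u v} (q r : ℚ) (f : Diag S u v) : Rel base (smul (q * r) f) (smul q (smul r f))
  | add_smul {u v} (q r : ℚ) (f : Diag S u v) :
      Rel base (smul (q + r) f) (add (smul q f) (smul r f))
  | smul_add {u v} (q : ℚ) (f g : Diag S u v) :
      Rel base (smul q (add f g)) (add (smul q f) (smul q g))
  | add_comp {u v w} (f f' : Diag S u v) (g : Diag S v w) :
      Rel base (add f f' ⋆ g) (add (f ⋆ g) (f' ⋆ g))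
  | comp_add {u v w} (f : Diag S u v) (g g' : Diag S v w) :
      Rel base (f ⋆ add g g') (add (f ⋆ g) (f ⋆ g'))
  | smul_comp {u v w} (q : ℚ) (f : Diag S u v) (g : Diag S v w) :
      Rel base (smul q f ⋆ g) (smul q (f ⋆ g))
  | comp_smul {u v w} (q : ℚ) (f : Diag S u v) (g : Diag S v w) :
      Rel base (f ⋆ smul q g) (smul q (f ⋆ g))
  | cons_id (l : S.Letter) (w) : Rel base (Diag.cons l (id w)) (id (l :: w))
  | cons_comp {u v w} (l : S.Letter) (f : Diag S u v) (g : Diag S v w) :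
      Rel base (Diag.cons l (f ⋆ g)) (Diag.cons l f ⋆ Diag.cons l g)
  | cons_add {u v} (l : S.Letter) (f g : Diag S u v) :
      Rel base (Diag.cons l (Diag.add f g)) (Diag.add (Diag.cons l f) (Diag.cons l g))
  | cons_smul {u v} (l : S.Letter) (q : ℚ) (f : Diag S u v) :
      Rel base (Diag.cons l (Diag.smul q f)) (Diag.smul q (Diag.cons l f))
  | interchange {u v} (g : S.Gen) (f : Diag S u v) :
      Rel base (gen g u ⋆ whiskerL (S.tgt g) f) (whiskerL (S.src g) f ⋆ gen g v)

end Diag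

/-- The presented category: the objects are the words satisfying `P`, the morphisms are classes of
diagrams. -/
structure PresCat (S : MonSig) (base : ∀ u v : List S.Letter, Diag S u v → Diag S u v → Prop)
    (P : List S.Letter → Prop) where
  word : List S.Letter
  prop : P word

namespace PresCat

variable {S : MonSig} {base : ∀ u v : List S.Letter, Diag S u v → Diag S u v → Prop}
  {P : List S.Letter → Prop}

def Hom (X Y : PresCat S base P) : Type := Quot (Diag.Rel base (u := X.word) (v := Y.word))

instance : Category (PresCat S base P) where
  Hom := Hom
  id X := Quot.mk _ (Diag.id X.word)
  comp f g := Quot.map₂ Diag.comp (fun _ _ _ h => .comp (.refl _) h)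
    (fun _ _ _ h => .comp h (.refl _)) f g
  id_comp := by rintro X Y ⟨f⟩; exact Quot.sound (.id_comp f)
  comp_id := by rintro X Y ⟨f⟩; exact Quot.sound (.comp_id f)
  assoc := by rintro W X Y Z ⟨f⟩ ⟨g⟩ ⟨h⟩; exact Quot.sound (.assoc f g h)

/-- The morphism represented by a diagram. -/
def ofDiag {X Y : PresCat S base P} (D : Diag S X.word Y.word) : X ⟶ Y := Quot.mk _ D

end PresCat

/-! ## The Soergel categories `𝒮𝒞₁(d)` and `𝒮𝒞₁'(d)` -/

/-- The generators.  Colors are `0, …, d - 2`, and the color `i` involves the variables numbered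
`i` and `i + 1`.  The boxes occur only if `boxed = true`. -/
inductive SCGen (d : ℕ) (boxed : Bool) : Type
  | endDot (i : Fin (d - 1))
  | startDot (i : Fin (d - 1))
  | merge (i : Fin (d - 1))
  | split (i : Fin (d - 1))
  | four (i j : Fin (d - 1)) (h : i.1 + 1 < j.1 ∨ j.1 + 1 < i.1)
  | six (i j : Fin (d - 1)) (h : i.1 + 1 = j.1 ∨ j.1 + 1 = i.1)
  | box (k : Fin d) (h : boxed = true)

abbrev SCSig (d : ℕ) (boxed : Bool) : MonSig where
  Letter := Fin (d - 1)
  Gen := SCGen d boxed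
  src
    | .endDot i => [i]
    | .startDot _ => []
    | .merge i => [i, i]
    | .split i => [i]
    | .four i j _ => [i, j]
    | .six i j _ => [i, j, i]
    | .box _ _ => []
  tgt
    | .endDot _ => []
    | .startDot i => [i]
    | .merge i => [i]
    | .split i => [i, i]
    | .four i j _ => [j, i]
    | .six i j _ => [j, i, j]
    | .box _ _ => []

namespace SC

variable {d : ℕ} {boxed : Bool}

/-- Two colors are distant. -/
def Dist (i j : Fin (d - 1)) : Prop := i.1 + 1 < j.1 ∨ j.1 + 1 < i.1

/-- Two colors are adjacent. -/
def Adj (i j : Fin (d - 1)) : Prop := i.1 + 1 = j.1 ∨ j.1 + 1 = i.1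

theorem Dist.symm {i j : Fin (d - 1)} (h : Dist i j) : Dist j i := Or.symm h

theorem Adj.symm {i j : Fin (d - 1)} (h : Adj i j) : Adj j i := Or.symm h

/-- The two variables belonging to a color. -/
def lo (i : Fin (d - 1)) : Fin d := ⟨i.1, by omega⟩

def hi (i : Fin (d - 1)) : Fin d := ⟨i.1 + 1, by omega⟩

def endDot (i : Fin (d - 1)) (b : List (Fin (d - 1))) : Diag (SCSig d boxed) (i :: b) b :=
  .gen (S := SCSig d boxed) (.endDot i) b

def startDot (i : Fin (d - 1)) (b : List (Fin (d - 1))) : Diag (SCSig d boxed) b (i :: b) :=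
  .gen (S := SCSig d boxed) (.startDot i) b

def merge (i : Fin (d - 1)) (b : List (Fin (d - 1))) :
    Diag (SCSig d boxed) (i :: i :: b) (i :: b) :=
  .gen (S := SCSig d boxed) (.merge i) b

def split (i : Fin (d - 1)) (b : List (Fin (d - 1))) :
    Diag (SCSig d boxed) (i :: b) (i :: i :: b) :=
  .gen (S := SCSig d boxed) (.split i) b

def four {i j : Fin (d - 1)} (h : Dist i j) (b : List (Fin (d - 1))) :
    Diag (SCSig d boxed) (i :: j :: b) (j :: i :: b) :=
  .gen (S := SCSig d boxed) (.four i j h) b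

def six {i j : Fin (d - 1)} (h : Adj i j) (b : List (Fin (d - 1))) :
    Diag (SCSig d boxed) (i :: j :: i :: b) (j :: i :: j :: b) :=
  .gen (S := SCSig d boxed) (.six i j h) b

def box (hx : boxed = true) (k : Fin d) (b : List (Fin (d - 1))) : Diag (SCSig d boxed) b b :=
  .gen (S := SCSig d boxed) (.box k hx) b

def cap (i : Fin (d - 1)) (b : List (Fin (d - 1))) : Diag (SCSig d boxed) (i :: i :: b) b :=
  merge i b ⋆ endDot i b

def cup (i : Fin (d - 1)) (b : List (Fin (d - 1))) : Diag (SCSig d boxed) b (i :: i :: b) :=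
  startDot i b ⋆ split i b

/-- A double dot of color `i`. -/
def dumbbell (i : Fin (d - 1)) (b : List (Fin (d - 1))) : Diag (SCSig d boxed) b b :=
  startDot i b ⋆ endDot i b

open Diag in
/-- The defining relations; identity strands `b` on the right are part of the diagrams. -/
inductive BaseRel (d : ℕ) (boxed : Bool) : ∀ u v : List (Fin (d - 1)),
    Diag (SCSig d boxed) u v → Diag (SCSig d boxed) u v → Prop
  | adj_left (i b) : BaseRel d boxed (i :: b) (i :: b) (cup i (i :: b) ⋆ cons i (cap i b)) (Diag.id _)
  | adj_right (i b) : BaseRel d boxed (i :: b) (i :: b) (cons i (cup i b) ⋆ cap i (i :: b)) (Diag.id _)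
  | curl_left (i b) : BaseRel d boxed (i :: b) b (startDot i (i :: b) ⋆ cap i b) (endDot i b)
  | curl_right (i b) : BaseRel d boxed (i :: b) b (cons i (startDot i b) ⋆ cap i b) (endDot i b)
  | v3rot_left (i b) : BaseRel d boxed (i :: i :: b) (i :: b)
      (split i (i :: b) ⋆ cons i (cap i b)) (merge i b)
  | v3rot_right (i b) : BaseRel d boxed (i :: i :: b) (i :: b)
      (cons i (split i b) ⋆ cap i (i :: b)) (merge i b)
  | v4rot_left (i j b) (h : Dist i j) : BaseRel d boxed (i :: j :: b) (j :: i :: b)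
      (cup j (i :: j :: b) ⋆ cons j (four h.symm (j :: b)) ⋆ cons j (cons i (cap j b))) (four h b)
  | v4rot_right (i j b) (h : Dist i j) : BaseRel d boxed (i :: j :: b) (j :: i :: b)
      (cons i (cons j (cup i b)) ⋆ cons i (four h.symm (i :: b)) ⋆ cap i (j :: i :: b)) (four h b)
  | v6rot_left (i j b) (h : Adj i j) : BaseRel d boxed (i :: j :: i :: b) (j :: i :: j :: b)
      (cup j (i :: j :: i :: b) ⋆ cons j (six h.symm (i :: b)) ⋆
        cons j (cons i (cons j (cap i b)))) (six h b)
  | v6rot_right (i j b) (h : Adj i j) : BaseRel d boxed (i :: j :: i :: b) (j :: i :: j :: b)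
      (cons i (cons j (cons i (cup j b))) ⋆ cons i (six h.symm (j :: b)) ⋆
        cap i (j :: i :: j :: b)) (six h b)
  | dumbrot_left (i b) : BaseRel d boxed (i :: i :: b) (i :: i :: b)
      (merge i b ⋆ split i b) (split i (i :: b) ⋆ cons i (merge i b))
  | dumbrot_right (i b) : BaseRel d boxed (i :: i :: b) (i :: i :: b)
      (merge i b ⋆ split i b) (cons i (split i b) ⋆ merge i (i :: b))
  | lollipop (i b) : BaseRel d boxed (i :: b) b (split i b ⋆ cap i b) (zero _ _)
  | deltam (i b) : BaseRel d boxed (i :: b) (i :: b)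
      (add (dumbbell i (i :: b)) (cons i (dumbbell i b))) (smul 2 (endDot i b ⋆ startDot i b))
  | reid2 (i j b) (h : Dist i j) : BaseRel d boxed (i :: j :: b) (i :: j :: b)
      (four h b ⋆ four h.symm b) (Diag.id _)
  | slidedot (i j b) (h : Dist i j) : BaseRel d boxed (i :: b) (j :: i :: b)
      (cons i (startDot j b) ⋆ four h b) (startDot j (i :: b))
  | slide3v (i j b) (h : Dist i j) : BaseRel d boxed (i :: j :: b) (j :: j :: i :: b)
      (four h b ⋆ split j (i :: b))
      (cons i (split j b) ⋆ four h (j :: b) ⋆ cons j (four h b))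
  | dot6v (i j b) (h : Adj i j) : BaseRel d boxed (i :: i :: b) (j :: i :: j :: b)
      (cons i (startDot j (i :: b)) ⋆ six h b)
      (add (merge i b ⋆ startDot j (i :: b) ⋆ cons j (cons i (startDot j b)))
        (cap i b ⋆ cup j b ⋆ cons j (startDot i (j :: b))))
  | reid3 (i j b) (h : Adj i j) : BaseRel d boxed (i :: j :: i :: b) (i :: j :: i :: b)
      (Diag.id _)
      (sub (six h b ⋆ six h.symm b)
        (cons i (endDot j (i :: b)) ⋆ merge i b ⋆ split i b ⋆ cons i (startDot j (i :: b))))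
  | dumbsq (i j b) (h : Adj i j) : BaseRel d boxed (i :: j :: i :: b) (j :: i :: j :: i :: j :: b)
      (six h b ⋆ split j (i :: j :: b) ⋆ cons j (cons j (cons i (split j b))) ⋆
        cons j (six h.symm (j :: b)))
      (cons i (split j (i :: b)) ⋆ cons i (cons j (cup i (j :: i :: b))) ⋆
        six h (i :: j :: i :: b) ⋆ cons j (cons i (cons j (six h b))) ⋆
        cons j (cons i (merge j (i :: j :: b))))
  | slidenext (i j b) (h : Adj i j) : BaseRel d boxed (i :: b) (i :: b)
      (sub (dumbbell j (i :: b)) (cons i (dumbbell j b)))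
      (smul (1 / 2) (sub (cons i (dumbbell i b)) (dumbbell i (i :: b))))
  | slide6v (i j k b) (h : Adj i j) (hik : Dist i k) (hjk : Dist j k) :
      BaseRel d boxed (i :: j :: i :: k :: b) (k :: j :: i :: j :: b)
      (six h (k :: b) ⋆ cons j (cons i (four hjk b)) ⋆ cons j (four hik (j :: b)) ⋆
        four hjk (i :: j :: b))
      (cons i (cons j (four hik b)) ⋆ cons i (four hjk (i :: b)) ⋆ four hik (j :: i :: b) ⋆
        cons k (six h b))
  | slide4v (i j k b) (hij : Dist i j) (hik : Dist i k) (hjk : Dist j k) :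
      BaseRel d boxed (i :: j :: k :: b) (k :: j :: i :: b)
      (four hij (k :: b) ⋆ cons j (four hik b) ⋆ four hjk (i :: b))
      (cons i (four hjk b) ⋆ four hik (j :: b) ⋆ cons k (four hij b))
  | dumbdumbsquare (i j k b) (hij : Adj i j) (hjk : Adj j k) (h : Dist i k) :
      BaseRel d boxed (i :: k :: j :: i :: k :: j :: b) (j :: k :: i :: j :: k :: i :: b)
      (cons i (cons k (cons j (four h (j :: b)))) ⋆ cons i (six hjk.symm (i :: j :: b)) ⋆
        cons i (cons j (cons k (six hij.symm b))) ⋆ cons i (cons j (four h.symm (j :: i :: b))) ⋆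
        six hij (k :: j :: i :: b) ⋆ cons j (cons i (six hjk (i :: b))) ⋆
        cons j (four h (j :: k :: i :: b)))
      (four h (j :: i :: k :: j :: b) ⋆ cons k (six hij (k :: j :: b)) ⋆
        cons k (cons j (cons i (six hjk b))) ⋆ cons k (cons j (four h (j :: k :: b))) ⋆
        six hjk.symm (i :: j :: k :: b) ⋆ cons j (cons k (six hij.symm (k :: b))) ⋆
        cons j (cons k (cons i (cons j (four h b)))))
  | box_dumbbell (hx : boxed = true) (i b) : BaseRel d boxed b b (dumbbell i b)
      (sub (box hx (lo i) b) (box hx (hi i) b))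
  | box_add (hx : boxed = true) (i b) : BaseRel d boxed (i :: b) (i :: b)
      (add (box hx (lo i) (i :: b)) (box hx (hi i) (i :: b)))
      (cons i (add (box hx (lo i) b) (box hx (hi i) b)))
  | box_mul (hx : boxed = true) (i b) : BaseRel d boxed (i :: b) (i :: b)
      (box hx (lo i) (i :: b) ⋆ box hx (hi i) (i :: b))
      (cons i (box hx (lo i) b ⋆ box hx (hi i) b))
  | box_slide (hx : boxed = true) (k : Fin d) (i b) (hk : k ≠ lo i) (hk' : k ≠ hi i) :
      BaseRel d boxed (i :: b) (i :: b) (box hx k (i :: b)) (cons i (box hx k b))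

end SC

/-- `𝒮𝒞₁(d)` (for `boxed = false`) and its extension by boxes `𝒮𝒞₁'(d)` (for `boxed = true`). -/
abbrev SoergelCat (d : ℕ) (boxed : Bool) :=
  PresCat (SCSig d boxed) (SC.BaseRel d boxed) (fun _ => True)

/-! ## The 2-category `𝒮(n,d)`

The 1-morphisms `ℰ_{i₁} ⋯ ℰ_{iₘ} 1_{(1^d)}` are words in signed colors; the region on the far right
is labelled `(1^d)`.  Colors are `0, …, n - 2`. -/

/-- `up i` is `ℰ_{+i}`, `dn i` is `ℰ_{-i}`. -/
inductive SLetter (n : ℕ) : Type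
  | up (i : Fin (n - 1))
  | dn (i : Fin (n - 1))

inductive SGen (n : ℕ) : Type
  | dotUp (i : Fin (n - 1))
  | dotDn (i : Fin (n - 1))
  | crossUp (i j : Fin (n - 1))
  | crossDn (i j : Fin (n - 1))
  | cupDU (i : Fin (n - 1))
  | cupUD (i : Fin (n - 1))
  | capDU (i : Fin (n - 1))
  | capUD (i : Fin (n - 1))

abbrev SSig (n : ℕ) : MonSig where
  Letter := SLetter n
  Gen := SGen n
  src
    | .dotUp i => [.up i]
    | .dotDn i => [.dn i]
    | .crossUp i j => [.up i, .up j]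
    | .crossDn i j => [.dn i, .dn j]
    | .cupDU _ => []
    | .cupUD _ => []
    | .capDU i => [.dn i, .up i]
    | .capUD i => [.up i, .dn i]
  tgt
    | .dotUp i => [.up i]
    | .dotDn i => [.dn i]
    | .crossUp i j => [.up j, .up i]
    | .crossDn i j => [.dn j, .dn i]
    | .cupDU i => [.dn i, .up i]
    | .cupUD i => [.up i, .dn i]
    | .capDU _ => []
    | .capUD _ => []

namespace Schur

open SLetter
open SC (lo hi)

variable {n : ℕ}

/-- The label of the region on the left of the word `w`: `ℰ_{+i}` adds `1` to the `i`-th entry and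
subtracts `1` from the next one. -/
def wt (d : ℕ) : List (SLetter n) → Fin n → ℤ
  | [] => fun j => if j.1 < d then 1 else 0
  | up i :: w => wt d w + Pi.single (lo i) 1 - Pi.single (hi i) 1
  | dn i :: w => wt d w - Pi.single (lo i) 1 + Pi.single (hi i) 1

/-- `λ̄_i = λ_i - λ_{i+1}` for the label `λ` of the region on the left of `w`. -/
def wbar (d : ℕ) (w : List (SLetter n)) (i : Fin (n - 1)) : ℤ := wt d w (lo i) - wt d w (hi i)

def dotUp (i : Fin (n - 1)) (b : List (SLetter n)) : Diag (SSig n) (up i :: b) (up i :: b) :=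
  .gen (S := SSig n) (.dotUp i) b

def dotDn (i : Fin (n - 1)) (b : List (SLetter n)) : Diag (SSig n) (dn i :: b) (dn i :: b) :=
  .gen (S := SSig n) (.dotDn i) b

def crossUp (i j : Fin (n - 1)) (b : List (SLetter n)) :
    Diag (SSig n) (up i :: up j :: b) (up j :: up i :: b) :=
  .gen (S := SSig n) (.crossUp i j) b

def crossDn (i j : Fin (n - 1)) (b : List (SLetter n)) :
    Diag (SSig n) (dn i :: dn j :: b) (dn j :: dn i :: b) :=
  .gen (S := SSig n) (.crossDn i j) b

def cupDU (i : Fin (n - 1)) (b : List (SLetter n)) : Diag (SSig n) b (dn i :: up i :: b) :=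
  .gen (S := SSig n) (.cupDU i) b

def cupUD (i : Fin (n - 1)) (b : List (SLetter n)) : Diag (SSig n) b (up i :: dn i :: b) :=
  .gen (S := SSig n) (.cupUD i) b

def capDU (i : Fin (n - 1)) (b : List (SLetter n)) : Diag (SSig n) (dn i :: up i :: b) b :=
  .gen (S := SSig n) (.capDU i) b

def capUD (i : Fin (n - 1)) (b : List (SLetter n)) : Diag (SSig n) (up i :: dn i :: b) b :=
  .gen (S := SSig n) (.capUD i) b

/-- The sideways crossing `ℰ_{+j} ℰ_{-i} → ℰ_{-i} ℰ_{+j}`. -/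
def crossL (j i : Fin (n - 1)) (b : List (SLetter n)) :
    Diag (SSig n) (up j :: dn i :: b) (dn i :: up j :: b) :=
  cupDU i (up j :: dn i :: b) ⋆ .cons (dn i) (crossUp i j (dn i :: b)) ⋆
    .cons (dn i) (.cons (up j) (capUD i b))

/-- The sideways crossing `ℰ_{-j} ℰ_{+i} → ℰ_{+i} ℰ_{-j}`. -/
def crossR (j i : Fin (n - 1)) (b : List (SLetter n)) :
    Diag (SSig n) (dn j :: up i :: b) (up i :: dn j :: b) :=
  .cons (dn j) (.cons (up i) (cupUD j b)) ⋆ .cons (dn j) (crossUp i j (dn j :: b)) ⋆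
    capDU j (up i :: dn j :: b)

/-- `m` dots on an upward strand. -/
def dots (i : Fin (n - 1)) (b : List (SLetter n)) : ℕ → Diag (SSig n) (up i :: b) (up i :: b)
  | 0 => .id _
  | m + 1 => dots i b m ⋆ dotUp i b

/-- The clockwise bubble with `m ≥ 0` dots. -/
def cwReal (i : Fin (n - 1)) (b : List (SLetter n)) (m : ℕ) : Diag (SSig n) b b :=
  cupUD i b ⋆ dots i (dn i :: b) m ⋆ capUD i b

/-- The counterclockwise bubble with `m ≥ 0` dots. -/
def ccwReal (i : Fin (n - 1)) (b : List (SLetter n)) (m : ℕ) : Diag (SSig n) b b :=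
  cupDU i b ⋆ .cons (dn i) (dots i b m) ⋆ capDU i b

/-- The fake clockwise bubble whose label is `λ̄_i - 1 + r < 0`, as determined recursively by the
infinite Grassmannian relation. -/
def cwFake (d : ℕ) (i : Fin (n - 1)) (b : List (SLetter n)) : ℕ → Diag (SSig n) b b
  | 0 => .smul ((-1) ^ wt d b (hi i)) (.id _)
  | r + 1 => .smul ((-1) ^ wt d b (hi i)) (.sum (r + 1) fun s =>
      cwFake d i b s.1 ⋆ ccwReal i b (-wbar d b i - 1 + (r + 1 - s.1)).toNat)
  termination_by r => r
  decreasing_by exact s.2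

/-- The fake counterclockwise bubble whose label is `-λ̄_i - 1 + r < 0`. -/
def ccwFake (d : ℕ) (i : Fin (n - 1)) (b : List (SLetter n)) : ℕ → Diag (SSig n) b b
  | 0 => .smul ((-1) ^ (wt d b (hi i) - 1)) (.id _)
  | r + 1 => .smul ((-1) ^ (wt d b (hi i) - 1)) (.sum (r + 1) fun s =>
      ccwFake d i b s.1 ⋆ cwReal i b (wbar d b i - 1 + (r + 1 - s.1)).toNat)
  termination_by r => r
  decreasing_by exact s.2

/-- The (real or fake) clockwise bubble of degree `2r`: its label is `λ̄_i - 1 + r`. -/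
def cw (d : ℕ) (i : Fin (n - 1)) (b : List (SLetter n)) (r : ℕ) : Diag (SSig n) b b :=
  if 0 ≤ wbar d b i - 1 + r then cwReal i b (wbar d b i - 1 + r).toNat else cwFake d i b r

/-- The (real or fake) counterclockwise bubble of degree `2r`: its label is `-λ̄_i - 1 + r`. -/
def ccw (d : ℕ) (i : Fin (n - 1)) (b : List (SLetter n)) (r : ℕ) : Diag (SSig n) b b :=
  if 0 ≤ -wbar d b i - 1 + r then ccwReal i b (-wbar d b i - 1 + r).toNat else ccwFake d i b r

open Diag in
/-- The defining relations; identity strands `b` on the right are part of the diagrams, and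
`λ = wt d b`. -/
inductive BaseRel (n d : ℕ) : ∀ u v : List (SLetter n),
    Diag (SSig n) u v → Diag (SSig n) u v → Prop
  /-- A diagram with a region whose label is not in `Λ(n,d)` is zero. -/
  | region (a b) (j : Fin n) (h : wt d b j < 0) :
      BaseRel n d (a ++ b) (a ++ b) (Diag.id _) (zero _ _)
  | zigzag₁ (i b) : BaseRel n d (up i :: b) (up i :: b)
      (cupUD i (up i :: b) ⋆ cons (up i) (capDU i b)) (Diag.id _)
  | zigzag₂ (i b) : BaseRel n d (up i :: b) (up i :: b)
      (cons (up i) (cupDU i b) ⋆ capUD i (up i :: b)) (Diag.id _)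
  | zigzag₃ (i b) : BaseRel n d (dn i :: b) (dn i :: b)
      (cupDU i (dn i :: b) ⋆ cons (dn i) (capUD i b)) (Diag.id _)
  | zigzag₄ (i b) : BaseRel n d (dn i :: b) (dn i :: b)
      (cons (dn i) (cupUD i b) ⋆ capDU i (dn i :: b)) (Diag.id _)
  | dot_cyclic_left (i b) : BaseRel n d (dn i :: b) (dn i :: b)
      (cupDU i (dn i :: b) ⋆ cons (dn i) (dotUp i (dn i :: b)) ⋆ cons (dn i) (capUD i b))
      (dotDn i b)
  | dot_cyclic_right (i b) : BaseRel n d (dn i :: b) (dn i :: b)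
      (cons (dn i) (cupUD i b) ⋆ cons (dn i) (dotUp i (dn i :: b)) ⋆ capDU i (dn i :: b))
      (dotDn i b)
  | cross_cyclic_left (i j b) : BaseRel n d (dn j :: dn i :: b) (dn i :: dn j :: b)
      (cupDU i (dn j :: dn i :: b) ⋆ cons (dn i) (cupDU j (up i :: dn j :: dn i :: b)) ⋆
        cons (dn i) (cons (dn j) (crossUp j i (dn j :: dn i :: b))) ⋆
        cons (dn i) (cons (dn j) (cons (up i) (capUD j (dn i :: b)))) ⋆
        cons (dn i) (cons (dn j) (capUD i b)))
      (crossDn j i b)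
  | cross_cyclic_right (i j b) : BaseRel n d (dn j :: dn i :: b) (dn i :: dn j :: b)
      (cons (dn j) (cons (dn i) (cupUD j b)) ⋆
        cons (dn j) (cons (dn i) (cons (up j) (cupUD i (dn j :: b)))) ⋆
        cons (dn j) (cons (dn i) (crossUp j i (dn i :: dn j :: b))) ⋆
        cons (dn j) (capDU i (up j :: dn i :: dn j :: b)) ⋆
        capDU j (dn i :: dn j :: b))
      (crossDn j i b)
  | cw_neg (i b) (m : ℕ) (h : (m : ℤ) < wbar d b i - 1) :
      BaseRel n d b b (cwReal i b m) (zero _ _)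
  | cw_zero (i b) (m : ℕ) (h : (m : ℤ) = wbar d b i - 1) :
      BaseRel n d b b (cwReal i b m) (smul ((-1) ^ wt d b (hi i)) (Diag.id _))
  | ccw_neg (i b) (m : ℕ) (h : (m : ℤ) < -wbar d b i - 1) :
      BaseRel n d b b (ccwReal i b m) (zero _ _)
  | ccw_zero (i b) (m : ℕ) (h : (m : ℤ) = -wbar d b i - 1) :
      BaseRel n d b b (ccwReal i b m) (smul ((-1) ^ (wt d b (hi i) - 1)) (Diag.id _))
  /-- The infinite Grassmannian relation. -/
  | grassmannian (i b) (r : ℕ) (h : 0 < r) :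
      BaseRel n d b b (Diag.sum (r + 1) fun s => cw d i b s.1 ⋆ ccw d i b (r - s.1)) (zero _ _)
  | curl_right (i b) : BaseRel n d (up i :: b) (up i :: b)
      (cons (up i) (cupUD i b) ⋆ crossUp i i (dn i :: b) ⋆ cons (up i) (capUD i b))
      (smul (-1) (Diag.sum (1 - wbar d b i).toNat fun f =>
        cons (up i) (cw d i b f.1) ⋆ dots i b (-wbar d b i - f.1).toNat))
  | curl_left (i b) : BaseRel n d (up i :: b) (up i :: b)
      (cupDU i (up i :: b) ⋆ cons (dn i) (crossUp i i b) ⋆ capDU i (up i :: b))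
      (Diag.sum (wbar d (up i :: b) i + 1).toNat fun g =>
        ccw d i (up i :: b) g.1 ⋆ dots i b (wbar d (up i :: b) i - g.1).toNat)
  | decomp_UD (i b) : BaseRel n d (up i :: dn i :: b) (up i :: dn i :: b)
      (Diag.id _)
      (sub (crossL i i b ⋆ crossR i i b)
        (Diag.sum (wbar d b i).toNat fun f => Diag.sum (f.1 + 1) fun g =>
          dots i (dn i :: b) (f.1 - g.1) ⋆ capUD i b ⋆ ccw d i b g.1 ⋆ cupUD i b ⋆
            dots i (dn i :: b) (wbar d b i - 1 - f.1).toNat))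
  | decomp_DU (i b) : BaseRel n d (dn i :: up i :: b) (dn i :: up i :: b)
      (Diag.id _)
      (sub (crossR i i b ⋆ crossL i i b)
        (Diag.sum (-wbar d b i).toNat fun f => Diag.sum (f.1 + 1) fun g =>
          cons (dn i) (dots i b (f.1 - g.1)) ⋆ capDU i b ⋆ cw d i b g.1 ⋆ cupDU i b ⋆
            cons (dn i) (dots i b (-wbar d b i - 1 - f.1).toNat)))
  | nil_sq (i b) : BaseRel n d (up i :: up i :: b) (up i :: up i :: b)
      (crossUp i i b ⋆ crossUp i i b) (zero _ _)
  | nil_dot_left (i b) : BaseRel n d (up i :: up i :: b) (up i :: up i :: b) (Diag.id _)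
      (sub (dotUp i (up i :: b) ⋆ crossUp i i b) (crossUp i i b ⋆ cons (up i) (dotUp i b)))
  | nil_dot_right (i b) : BaseRel n d (up i :: up i :: b) (up i :: up i :: b) (Diag.id _)
      (sub (crossUp i i b ⋆ dotUp i (up i :: b)) (cons (up i) (dotUp i b) ⋆ crossUp i i b))
  | side_LR (i j b) (h : i ≠ j) : BaseRel n d (up j :: dn i :: b) (up j :: dn i :: b)
      (crossL j i b ⋆ crossR i j b) (Diag.id _)
  | side_RL (i j b) (h : i ≠ j) : BaseRel n d (dn j :: up i :: b) (dn j :: up i :: b)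
      (crossR j i b ⋆ crossL i j b) (Diag.id _)
  | r2_dist (i j b) (h : SC.Dist i j) : BaseRel n d (up i :: up j :: b) (up i :: up j :: b)
      (crossUp i j b ⋆ crossUp j i b) (Diag.id _)
  | r2_adj (i j b) (h : SC.Adj i j) : BaseRel n d (up i :: up j :: b) (up i :: up j :: b)
      (crossUp i j b ⋆ crossUp j i b)
      (smul ((i.1 : ℚ) - j.1) (sub (dotUp i (up j :: b)) (cons (up i) (dotUp j b))))
  | dot_slide_left (i j b) (h : i ≠ j) : BaseRel n d (up i :: up j :: b) (up j :: up i :: b)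
      (dotUp i (up j :: b) ⋆ crossUp i j b) (crossUp i j b ⋆ cons (up j) (dotUp i b))
  | dot_slide_right (i j b) (h : i ≠ j) : BaseRel n d (up i :: up j :: b) (up j :: up i :: b)
      (cons (up i) (dotUp j b) ⋆ crossUp i j b) (crossUp i j b ⋆ dotUp j (up i :: b))
  | r3 (i j k b) (h : ¬(i = k ∧ SC.Adj i j)) :
      BaseRel n d (up i :: up j :: up k :: b) (up k :: up j :: up i :: b)
      (crossUp i j (up k :: b) ⋆ cons (up j) (crossUp i k b) ⋆ crossUp j k (up i :: b))
      (cons (up i) (crossUp j k b) ⋆ crossUp i k (up j :: b) ⋆ cons (up k) (crossUp i j b))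
  | r3_adj (i j b) (h : SC.Adj i j) :
      BaseRel n d (up i :: up j :: up i :: b) (up i :: up j :: up i :: b)
      (sub
        (crossUp i j (up i :: b) ⋆ cons (up j) (crossUp i i b) ⋆ crossUp j i (up i :: b))
        (cons (up i) (crossUp j i b) ⋆ crossUp i i (up j :: b) ⋆ cons (up i) (crossUp i j b)))
      (smul ((i.1 : ℚ) - j.1) (Diag.id _))

end Schur

/-- `𝒮(n,d)*((1^d),(1^d))`. -/
abbrev SchurCat (n d : ℕ) :=
  PresCat (SSig n) (Schur.BaseRel n d) (fun w => Schur.wt d w = Schur.wt d [])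

/-! ## The functors `Σ_{n,n}` and `Σ_{n,d}` -/

namespace SoergelToSchur

open SLetter Schur

variable {n d : ℕ}

def color (hdn : d ≤ n) (i : Fin (d - 1)) : Fin (n - 1) := ⟨i.1, by omega⟩

/-- The color `i` is sent to `ℰ_{-i} ℰ_{+i}`. -/
def word (hdn : d ≤ n) : List (Fin (d - 1)) → List (SLetter n)
  | [] => []
  | i :: w => dn (color hdn i) :: up (color hdn i) :: word hdn w

theorem wt_word (hdn : d ≤ n) : ∀ w : List (Fin (d - 1)), wt d (word hdn w) = wt d []
  | [] => rfl
  | i :: w => by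
    funext j
    have := congrFun (wt_word hdn w) j
    simp only [word, wt, Pi.add_apply, Pi.sub_apply] at this ⊢
    linarith

def merge (i : Fin (n - 1)) (b : List (SLetter n)) :
    Diag (SSig n) (dn i :: up i :: dn i :: up i :: b) (dn i :: up i :: b) :=
  .cons (dn i) (capUD i (up i :: b))

def split (i : Fin (n - 1)) (b : List (SLetter n)) :
    Diag (SSig n) (dn i :: up i :: b) (dn i :: up i :: dn i :: up i :: b) :=
  .cons (dn i) (cupUD i (up i :: b))

def strand (i : Fin (n - 1)) {b c : List (SLetter n)} (f : Diag (SSig n) b c) :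
    Diag (SSig n) (dn i :: up i :: b) (dn i :: up i :: c) :=
  .cons (dn i) (.cons (up i) f)

open Diag in
/-- The 4-valent vertex. -/
def four (i j : Fin (n - 1)) (b : List (SLetter n)) :
    Diag (SSig n) (dn i :: up i :: dn j :: up j :: b) (dn j :: up j :: dn i :: up i :: b) :=
  cons (dn i) (crossL i j (up j :: b)) ⋆ crossDn i j (up i :: up j :: b) ⋆
    cons (dn j) (cons (dn i) (crossUp i j b)) ⋆ cons (dn j) (crossR i j (up i :: b))

open Diag in
/-- The 6-valent vertex with bottom colors `(r, l, r)`, where `r = l + 1`. -/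
def sixDown (r l : Fin (n - 1)) (b : List (SLetter n)) :
    Diag (SSig n) (dn r :: up r :: dn l :: up l :: dn r :: up r :: b)
      (dn l :: up l :: dn r :: up r :: dn l :: up l :: b) :=
  cons (dn r) (crossL r l (up l :: dn r :: up r :: b)) ⋆
    cons (dn r) (cons (dn l) (cons (up r) (crossL l r (up r :: b)))) ⋆
    cons (dn r) (cons (dn l) (capUD r (up l :: up r :: b))) ⋆
    cons (dn r) (cons (dn l) (cupDU l (up l :: up r :: b))) ⋆
    cons (dn r) (crossDn l l (up l :: up l :: up r :: b)) ⋆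
    cons (dn r) (cons (dn l) (cons (dn l) (crossUp l l (up r :: b)))) ⋆
    cons (dn r) (cons (dn l) (crossR l l (up l :: up r :: b))) ⋆
    crossDn r l (up l :: dn l :: up l :: up r :: b) ⋆
    cons (dn l) (cons (dn r) (cons (up l) (cons (dn l) (crossUp l r b)))) ⋆
    cons (dn l) (crossR r l (dn l :: up r :: up l :: b)) ⋆
    cons (dn l) (cons (up l) (cons (dn r) (crossR l r (up l :: b))))

open Diag in
/-- The 6-valent vertex with bottom colors `(l, r, l)`, where `r = l + 1`. -/
def sixUp (l r : Fin (n - 1)) (b : List (SLetter n)) :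
    Diag (SSig n) (dn l :: up l :: dn r :: up r :: dn l :: up l :: b)
      (dn r :: up r :: dn l :: up l :: dn r :: up r :: b) :=
  cons (dn l) (crossL l r (up r :: dn l :: up l :: b)) ⋆
    cons (dn l) (cons (dn r) (cons (up l) (crossL r l (up l :: b)))) ⋆
    crossDn l r (up l :: dn l :: up r :: up l :: b) ⋆
    cons (dn r) (cons (dn l) (cons (up l) (cons (dn l) (crossUp r l b)))) ⋆
    cons (dn r) (cons (dn l) (crossL l l (up l :: up r :: b))) ⋆
    cons (dn r) (crossDn l l (up l :: up l :: up r :: b)) ⋆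
    cons (dn r) (cons (dn l) (cons (dn l) (crossUp l l (up r :: b)))) ⋆
    cons (dn r) (cons (dn l) (capDU l (up l :: up r :: b))) ⋆
    cons (dn r) (cons (dn l) (cupUD r (up l :: up r :: b))) ⋆
    cons (dn r) (cons (dn l) (cons (up r) (crossR r l (up r :: b)))) ⋆
    cons (dn r) (crossR l r (up l :: dn r :: up r :: b))

/-- The box `k` (numbered from `0`) is sent to the sum of the counterclockwise bubbles without dots
of the colors `j` with `k ≤ j ≤ d - 2`, minus the fake counterclockwise bubble of color `d - 1` and
label `-1` (whose degree is `2`). -/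
def box (hdn : d < n) (k : Fin d) (w : List (Fin (d - 1))) :
    Diag (SSig n) (word hdn.le w) (word hdn.le w) :=
  .sub (.sum (d - 1) fun j =>
      if k.1 ≤ j.1 then ccwReal (color hdn.le j) (word hdn.le w) 0 else .zero _ _)
    (ccw d ⟨d - 1, by have := k.2; omega⟩ (word hdn.le w) 1)

/-- The images of the generators. -/
def gen {boxed : Bool} (hdn : d ≤ n) (hb : boxed = true → d < n) (w : List (Fin (d - 1))) :
    (g : SCGen d boxed) → Diag (SSig n) (word hdn ((SCSig d boxed).src g ++ w))
      (word hdn ((SCSig d boxed).tgt g ++ w))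
  | .endDot i => capDU (color hdn i) (word hdn w)
  | .startDot i => cupDU (color hdn i) (word hdn w)
  | .merge i => merge (color hdn i) (word hdn w)
  | .split i => split (color hdn i) (word hdn w)
  | .four i j _ => four (color hdn i) (color hdn j) (word hdn w)
  | .six i j _ =>
      if j.1 < i.1 then sixDown (color hdn i) (color hdn j) (word hdn w)
      else sixUp (color hdn i) (color hdn j) (word hdn w)
  | .box k h => box (hb h) k w

/-- `Σ` on diagrams. -/
def map {boxed : Bool} (hdn : d ≤ n) (hb : boxed = true → d < n) :
    {u v : List (Fin (d - 1))} → Diag (SCSig d boxed) u v →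
      Diag (SSig n) (word hdn u) (word hdn v)
  | _, _, .id _ => .id _
  | _, _, .comp f g => .comp (map hdn hb f) (map hdn hb g)
  | _, _, .zero _ _ => .zero _ _
  | _, _, .add f g => .add (map hdn hb f) (map hdn hb g)
  | _, _, .smul q f => .smul q (map hdn hb f)
  | _, _, .gen g w => gen hdn hb w g
  | _, _, .cons i f => strand (color hdn i) (map hdn hb f)

end SoergelToSchur

/-- The functor `Σ : 𝒮𝒞₁(n) → 𝒮(n,n)*((1^n),(1^n))`, respectively
`Σ : 𝒮𝒞₁'(d) → 𝒮(n,d)*((1^d),(1^d))`: the functor on classes of diagrams that has the prescribed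
values. -/
structure SigmaFunctor {n d : ℕ} {boxed : Bool} (hdn : d ≤ n) (hb : boxed = true → d < n) where
  map : ∀ {X Y : SoergelCat d boxed}, (X ⟶ Y) →
    ((⟨SoergelToSchur.word hdn X.word, SoergelToSchur.wt_word hdn X.word⟩ : SchurCat n d) ⟶
      ⟨SoergelToSchur.word hdn Y.word, SoergelToSchur.wt_word hdn Y.word⟩)
  map_ofDiag : ∀ {X Y : SoergelCat d boxed} (D : Diag (SCSig d boxed) X.word Y.word),
    map (PresCat.ofDiag D : X ⟶ Y) = PresCat.ofDiag (SoergelToSchur.map hdn hb D)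

def SigmaFunctor.toFunctor {n d : ℕ} {boxed : Bool} {hdn : d ≤ n} {hb : boxed = true → d < n}
    (F : SigmaFunctor hdn hb) : SoergelCat d boxed ⥤ SchurCat n d where
  obj X := ⟨SoergelToSchur.word hdn X.word, SoergelToSchur.wt_word hdn X.word⟩
  map := F.map
  map_id X := F.map_ofDiag (.id X.word)
  map_comp := by
    rintro X Y Z ⟨f⟩ ⟨g⟩
    exact (F.map_ofDiag (f ⋆ g)).trans
      (congrArg₂ (· ≫ ·) (F.map_ofDiag f) (F.map_ofDiag g)).symm

/-! ## The functor `ℱ_Bim`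

The polynomial ring attached to a composite of elementary webs is built by adjoining roots.  At a
region labelled `λ` the `j`-th strand carries an alphabet of `λ_j` variables, recorded by the monic
polynomial `P j` (of degree `λ_j`) whose roots are these variables.  Passing a ladder rung moves one
variable `x` from the alphabet of one strand to that of a neighbouring strand: the ring is extended
by adjoining a root `x` of the polynomial of the first strand.  -/

/-- A commutative `ℚ`-algebra with `n` finite alphabets. -/
structure WebState (n : ℕ) where
  A : Type
  [commRing : CommRing A]
  [algebra : Algebra ℚ A]
  P : Fin n → A[X]
  monic : ∀ j, (P j).Monic

attribute [instance] WebState.commRing WebState.algebra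

noncomputable section

namespace WebState

open SLetter
open SC (lo hi)

variable {n : ℕ}

theorem monic_divX {B : Type} [CommRing B] {p : B[X]} (hp : p.Monic) {x : B} (hx : p.IsRoot x) :
    (p /ₘ (X - C x)).Monic := by
  have h := mul_divByMonic_eq_iff_isRoot.2 hx
  exact Monic.of_mul_monic_left (monic_X_sub_C x) (by rw [h]; exact hp)

/-- Move one variable from the alphabet `a` to the alphabet `b`. -/
def move (s : WebState n) (a b : Fin n) : WebState n where
  A := AdjoinRoot (s.P a)
  P j :=
    if j = a then (s.P a).map (AdjoinRoot.of (s.P a)) /ₘ (X - C (AdjoinRoot.root (s.P a)))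
    else if j = b then (s.P b).map (AdjoinRoot.of (s.P a)) * (X - C (AdjoinRoot.root (s.P a)))
    else (s.P j).map (AdjoinRoot.of (s.P a))
  monic j := by
    split_ifs
    · refine monic_divX ((s.monic a).map _) ?_
      rw [IsRoot, Polynomial.eval_map]
      exact AdjoinRoot.eval₂_root _
    · exact ((s.monic b).map _).mul (monic_X_sub_C _)
    · exact (s.monic j).map _

/-- The alphabet that loses a variable, and the one that gains it. -/
def loses : SLetter n → Fin n
  | up i => hi i
  | dn i => lo i

def gains : SLetter n → Fin n
  | up i => lo i
  | dn i => hi i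

def step (s : WebState n) (l : SLetter n) : WebState n := s.move (loses l) (gains l)

/-- The new variable. -/
def var (s : WebState n) (l : SLetter n) : (s.step l).A := AdjoinRoot.root (s.P (loses l))

/-- The inclusion of the old ring. -/
def incl (s : WebState n) (l : SLetter n) : s.A →ₐ[ℚ] (s.step l).A :=
  { AdjoinRoot.of (s.P (loses l)) with
    commutes' := fun _ => rfl }

/-- The coefficient of `x ^ k` in the unique expression of an element of `s.A[x]` as a polynomial
in the new variable `x` of degree less than that of `P`. -/
def coeff (s : WebState n) (l : SLetter n) (k : ℕ) : (s.step l).A →ₗ[ℚ] s.A :=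
  ((lcoeff s.A k).restrictScalars ℚ) ∘ₗ
    ((AdjoinRoot.modByMonicHom (s.monic (loses l))).restrictScalars ℚ)

/-- The size of the alphabet that loses a variable. -/
def size (s : WebState n) (l : SLetter n) : ℕ := (s.P (loses l)).natDegree

/-- The `A`-linear extension of a map which is the identity on the new variable. -/
def whisker {s t : WebState n} (l : SLetter n) (f : s.A →ₗ[ℚ] t.A) :
    (s.step l).A →ₗ[ℚ] (t.step l).A :=
  ∑ k ∈ Finset.range (s.size l),
    LinearMap.mulRight ℚ (t.var l ^ k) ∘ₗ (t.incl l).toLinearMap ∘ₗ f ∘ₗ s.coeff l k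

/-- Substitution of `x` for the new variable. -/
def subst (s : WebState n) (l : SLetter n) (x : s.A) : (s.step l).A →ₗ[ℚ] s.A :=
  ∑ k ∈ Finset.range (s.size l), LinearMap.mulRight ℚ (x ^ k) ∘ₗ s.coeff l k

/-- The trace: the coefficient of the highest power of the new variable. -/
def trace (s : WebState n) (l : SLetter n) : (s.step l).A →ₗ[ℚ] s.A := s.coeff l (s.size l - 1)

def cupDU (s : WebState n) (i : Fin (n - 1)) : s.A →ₗ[ℚ] ((s.step (up i)).step (dn i)).A :=
  LinearMap.mulRight ℚ
      ((((s.step (up i)).step (dn i)).P (lo i)).eval ((s.step (up i)).incl (dn i) (s.var (up i)))) ∘ₗ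
    ((s.step (up i)).incl (dn i)).toLinearMap ∘ₗ (s.incl (up i)).toLinearMap

def cupUD (s : WebState n) (i : Fin (n - 1)) : s.A →ₗ[ℚ] ((s.step (dn i)).step (up i)).A :=
  LinearMap.mulRight ℚ
      ((-1) ^ (s.P (hi i)).natDegree *
        ((s.P (hi i)).map (((s.step (dn i)).incl (up i)).comp (s.incl (dn i))).toRingHom).eval
          ((s.step (dn i)).var (up i))) ∘ₗ
    ((s.step (dn i)).incl (up i)).toLinearMap ∘ₗ (s.incl (dn i)).toLinearMap

def capDU (s : WebState n) (i : Fin (n - 1)) : ((s.step (up i)).step (dn i)).A →ₗ[ℚ] s.A :=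
  ((-1 : ℚ) ^ (s.size (up i) - 1)) •
    (s.trace (up i) ∘ₗ (s.step (up i)).subst (dn i) (s.var (up i)))

def capUD (s : WebState n) (i : Fin (n - 1)) : ((s.step (dn i)).step (up i)).A →ₗ[ℚ] s.A :=
  s.trace (dn i) ∘ₗ (s.step (dn i)).subst (up i) (s.var (dn i))

/-- The map which sends `c * x ^ k * y ^ k'` to `c * g k k'`, where `x` is the variable of the left
letter `l` and `y` that of the right letter `m`. -/
def cross (s : WebState n) (l m : SLetter n) (g : ℕ → ℕ → ((s.step l).step m).A) :
    ((s.step m).step l).A →ₗ[ℚ] ((s.step l).step m).A :=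
  ∑ k ∈ Finset.range ((s.step m).size l), ∑ k' ∈ Finset.range (s.size m),
    LinearMap.mulRight ℚ (g k k') ∘ₗ ((s.step l).incl m).toLinearMap ∘ₗ (s.incl l).toLinearMap ∘ₗ
      s.coeff m k' ∘ₗ (s.step m).coeff l k

/-- The divided difference `(x ^ k * y ^ k' - y ^ k * x ^ k') / (x - y)`. -/
def divDiff {B : Type} [CommRing B] (x y : B) (k k' : ℕ) : B :=
  y ^ k' * (∑ a ∈ Finset.range k, x ^ a * y ^ (k - 1 - a)) -
    y ^ k * (∑ a ∈ Finset.range k', x ^ a * y ^ (k' - 1 - a))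

/-- In the target, the left variable belongs to the color `j`, the right one to `i`. -/
def crossUp (s : WebState n) (i j : Fin (n - 1)) :
    ((s.step (up j)).step (up i)).A →ₗ[ℚ] ((s.step (up i)).step (up j)).A :=
  let xL := (s.step (up i)).var (up j)
  let xR := (s.step (up i)).incl (up j) (s.var (up i))
  s.cross (up i) (up j) fun k k' =>
    if i = j then divDiff xL xR k k'
    else if i.1 = j.1 + 1 then (xR - xL) * (xL ^ k' * xR ^ k)
    else xL ^ k' * xR ^ k

def crossDn (s : WebState n) (i j : Fin (n - 1)) :
    ((s.step (dn j)).step (dn i)).A →ₗ[ℚ] ((s.step (dn i)).step (dn j)).A :=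
  let xL := (s.step (dn i)).var (dn j)
  let xR := (s.step (dn i)).incl (dn j) (s.var (dn i))
  s.cross (dn i) (dn j) fun k k' =>
    if i = j then -divDiff xL xR k k'
    else if j.1 = i.1 + 1 then (xL - xR) * (xL ^ k' * xR ^ k)
    else xL ^ k' * xR ^ k

/-- The state reached from `s` on the left of the word `w`. -/
def run (s : WebState n) : List (SLetter n) → WebState n
  | [] => s
  | l :: w => (s.run w).step l

/-- The image of a generator. -/
def gen (s : WebState n) (w : List (SLetter n)) : (g : SGen n) →
    (s.run ((SSig n).src g ++ w)).A →ₗ[ℚ] (s.run ((SSig n).tgt g ++ w)).A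
  | .dotUp i => LinearMap.mulRight ℚ ((s.run w).var (up i))
  | .dotDn i => LinearMap.mulRight ℚ ((s.run w).var (dn i))
  | .crossUp i j => (s.run w).crossUp i j
  | .crossDn i j => (s.run w).crossDn i j
  | .cupDU i => (s.run w).cupDU i
  | .cupUD i => (s.run w).cupUD i
  | .capDU i => (s.run w).capDU i
  | .capUD i => (s.run w).capUD i

/-- The image of a diagram. -/
def map (s : WebState n) : {u v : List (SLetter n)} → Diag (SSig n) u v →
    (s.run u).A →ₗ[ℚ] (s.run v).A
  | _, _, .id _ => LinearMap.id
  | _, _, .comp f g => s.map g ∘ₗ s.map f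
  | _, _, .zero _ _ => 0
  | _, _, .add f g => s.map f + s.map g
  | _, _, .smul q f => q • s.map f
  | _, _, .gen g w => s.gen w g
  | _, _, .cons l f => whisker l (s.map f)

/-- The inclusion of the ring of `s`. -/
def inclRun (s : WebState n) : (w : List (SLetter n)) → s.A →ₐ[ℚ] (s.run w).A
  | [] => AlgHom.id ℚ s.A
  | l :: w => ((s.run w).incl l).comp (inclRun s w)

end WebState

/-- The polynomial ring `ℚ[x_1, …, x_d]`. -/
abbrev PolyRing (d : ℕ) := MvPolynomial (Fin d) ℚ

/-- The identity web on `(1^d)`: for `j < d` the `j`-th strand carries the variable `x_j`. -/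
def baseState (n d : ℕ) : WebState n where
  A := PolyRing d
  P j := if h : j.1 < d then X - C (MvPolynomial.X ⟨j.1, h⟩) else 1
  monic j := by
    split_ifs
    · exact monic_X_sub_C _
    · exact monic_one

/-- The ring `ℱ_Bim(w)` of the word `w` (ending at the region `(1^d)` on the right). -/
abbrev WebRing (n d : ℕ) (w : List (SLetter n)) : Type := ((baseState n d).run w).A

/-- `ℱ_Bim` on diagrams. -/
def fBim {n d : ℕ} {u v : List (SLetter n)} (D : Diag (SSig n) u v) :
    WebRing n d u →ₗ[ℚ] WebRing n d v :=
  (baseState n d).map D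

/-- The right action of `ℚ[x_1, …, x_d]`. -/
def webRight (n d : ℕ) (w : List (SLetter n)) : PolyRing d →ₐ[ℚ] WebRing n d w :=
  (baseState n d).inclRun w

/-- The left action of `ℚ[x_1, …, x_d]`: the variable `x_j` acts by the unique variable of the
`j`-th strand on the far left, `P j = X - x_j`. -/
def webLeft {n d : ℕ} (hdn : d ≤ n) (w : List (SLetter n)) : PolyRing d →ₐ[ℚ] WebRing n d w :=
  MvPolynomial.aeval fun j => -(((baseState n d).run w).P (Fin.castLE hdn j)).coeff 0

/-- The category `Bim(d)*` of bimodules over `ℚ[x_1, …, x_d]` (with bimodule maps of all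
degrees). -/
abbrev BimCat (d : ℕ) := ModuleCat.{0} (PolyRing d ⊗[ℚ] PolyRing d)

/-- The bimodule given by a ring with a left and a right action. -/
def bimodule {d : ℕ} (A : Type) [CommRing A] [Algebra ℚ A] (l r : PolyRing d →ₐ[ℚ] A) :
    BimCat d :=
  letI : Module (PolyRing d ⊗[ℚ] PolyRing d) A :=
    Module.compHom A (Algebra.TensorProduct.productMap l r).toRingHom
  ModuleCat.of _ A

/-- The underlying set of `bimodule A l r` is `A`. -/
def toBimodule {d : ℕ} {A : Type} [CommRing A] [Algebra ℚ A] (l r : PolyRing d →ₐ[ℚ] A) (a : A) :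
    bimodule A l r := a

def ofBimodule {d : ℕ} {A : Type} [CommRing A] [Algebra ℚ A] {l r : PolyRing d →ₐ[ℚ] A}
    (a : bimodule A l r) : A := a

def webBimodule {n d : ℕ} (hdn : d ≤ n) (w : List (SLetter n)) : BimCat d :=
  bimodule (WebRing n d w) (webLeft hdn w) (webRight n d w)

/-- The functor `ℱ_Bim : 𝒮(n,d)*((1^d),(1^d)) → Bim(d)*`: the functor on classes of diagrams that
has the prescribed values. -/
structure BimFunctor {n d : ℕ} (hdn : d ≤ n) where
  map : ∀ {X Y : SchurCat n d}, (X ⟶ Y) → (webBimodule hdn X.word ⟶ webBimodule hdn Y.word)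
  map_ofDiag : ∀ {X Y : SchurCat n d} (D : Diag (SSig n) X.word Y.word) (z : WebRing n d X.word),
    ofBimodule ((map (PresCat.ofDiag D : X ⟶ Y)).hom (toBimodule _ _ z)) = fBim D z

def BimFunctor.toFunctor {n d : ℕ} {hdn : d ≤ n} (F : BimFunctor hdn) :
    SchurCat n d ⥤ BimCat d where
  obj X := webBimodule hdn X.word
  map := F.map
  map_id X := by
    ext z
    exact F.map_ofDiag (.id X.word) z
  map_comp := by
    rintro X Y Z ⟨f⟩ ⟨g⟩
    ext z
    exact (F.map_ofDiag (f ⋆ g) z).trans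
      ((F.map_ofDiag g _).trans (congrArg (fBim g) (F.map_ofDiag f z))).symm

/-! ## The Elias–Khovanov functor -/

namespace EK

open SC (lo hi)

variable {d : ℕ}

/-- Polynomials symmetric in `x_p` and `x_q`. -/
def inv (p q : Fin d) : Subalgebra ℚ (PolyRing d) :=
  AlgHom.equalizer (MvPolynomial.rename (Equiv.swap p q)) (AlgHom.id ℚ (PolyRing d))

/-- `ℚ[x_1, …, x_d]^{s_i}`. -/
abbrev invColor (i : Fin (d - 1)) : Subalgebra ℚ (PolyRing d) := inv (lo i) (hi i)

theorem mem_inv {p q : Fin d} {f : PolyRing d} :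
    f ∈ inv p q ↔ MvPolynomial.rename (Equiv.swap p q) f = f := Iff.rfl

theorem inv_comm (p q : Fin d) : inv p q = inv q p := by
  ext f; rw [mem_inv, mem_inv, Equiv.swap_comm]

theorem X_mem_inv {p q k : Fin d} (hp : k ≠ p) (hq : k ≠ q) : MvPolynomial.X k ∈ inv p q := by
  rw [mem_inv, MvPolynomial.rename_X, Equiv.swap_apply_of_ne_of_ne hp hq]

theorem add_mem_inv (p q : Fin d) : MvPolynomial.X p + MvPolynomial.X q ∈ inv p q := by
  simp [mem_inv, add_comm]

theorem mul_mem_inv (p q : Fin d) : MvPolynomial.X p * MvPolynomial.X q ∈ inv p q := by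
  simp [mem_inv, mul_comm]

theorem sub_dvd (p q : Fin d) (f : PolyRing d) :
    (MvPolynomial.X p - MvPolynomial.X q) ∣ f - MvPolynomial.rename (Equiv.swap p q) f := by
  induction f using MvPolynomial.induction_on with
  | C a => simp
  | add f g hf hg =>
    rw [map_add, add_sub_add_comm]
    exact dvd_add hf hg
  | mul_X f k hf =>
    have hk : (MvPolynomial.X p - MvPolynomial.X q : PolyRing d) ∣
        MvPolynomial.X k - MvPolynomial.X (Equiv.swap p q k) := by
      by_cases h1 : k = p
      · subst h1; simp
      · by_cases h2 : k = q
        · subst h2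
          rw [Equiv.swap_apply_right]
          exact ⟨-1, by ring⟩
        · rw [Equiv.swap_apply_of_ne_of_ne h1 h2]; simp
    rw [map_mul, MvPolynomial.rename_X]
    have : f * MvPolynomial.X k - MvPolynomial.rename (Equiv.swap p q) f *
        MvPolynomial.X (Equiv.swap p q k) =
        (f - MvPolynomial.rename (Equiv.swap p q) f) * MvPolynomial.X k +
        MvPolynomial.rename (Equiv.swap p q) f *
          (MvPolynomial.X k - MvPolynomial.X (Equiv.swap p q k)) := by ring
    rw [this]
    exact dvd_add (hf.mul_right _) (hk.mul_left _)

/-- The divided difference operator `∂_{x_p x_q} f = (f - s f) / (x_p - x_q)`. -/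
def dd (p q : Fin d) (f : PolyRing d) : PolyRing d := (sub_dvd p q f).choose

theorem dd_spec (p q : Fin d) (f : PolyRing d) :
    f - MvPolynomial.rename (Equiv.swap p q) f =
      (MvPolynomial.X p - MvPolynomial.X q) * dd p q f := (sub_dvd p q f).choose_spec

theorem X_sub_X_ne {p q : Fin d} (h : p ≠ q) :
    (MvPolynomial.X p - MvPolynomial.X q : PolyRing d) ≠ 0 :=
  sub_ne_zero.2 fun e => h (MvPolynomial.X_injective e)

theorem dd_add {p q : Fin d} (h : p ≠ q) (f g : PolyRing d) :
    dd p q (f + g) = dd p q f + dd p q g := by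
  apply mul_left_cancel₀ (X_sub_X_ne h)
  rw [mul_add, ← dd_spec, ← dd_spec, ← dd_spec, map_add]; ring

theorem dd_mul {p q : Fin d} (h : p ≠ q) (f : PolyRing d) {c : PolyRing d} (hc : c ∈ inv p q) :
    dd p q (f * c) = dd p q f * c := by
  apply mul_left_cancel₀ (X_sub_X_ne h)
  rw [← mul_assoc, ← dd_spec, ← dd_spec, map_mul, mem_inv.1 hc]; ring

theorem lo_ne_hi (i : Fin (d - 1)) : lo i ≠ hi i := by
  simp [lo, hi, Fin.ext_iff]

/-- The symmetric polynomials in `x_p`, `x_q` are generated by the other variables and the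
elementary symmetric polynomials. -/
theorem inv_le_adjoin {p q : Fin d} (h : p ≠ q) : inv p q ≤ Algebra.adjoin ℚ
    ({f | ∃ k, k ≠ p ∧ k ≠ q ∧ f = MvPolynomial.X k} ∪
      {MvPolynomial.X p + MvPolynomial.X q, MvPolynomial.X p * MvPolynomial.X q}) := by
  set U := Algebra.adjoin ℚ ({f : PolyRing d | ∃ k, k ≠ p ∧ k ≠ q ∧ f = MvPolynomial.X k} ∪
      {MvPolynomial.X p + MvPolynomial.X q, MvPolynomial.X p * MvPolynomial.X q}) with hU
  have e1 : (MvPolynomial.X p + MvPolynomial.X q : PolyRing d) ∈ U :=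
    Algebra.subset_adjoin (by simp)
  have e2 : (MvPolynomial.X p * MvPolynomial.X q : PolyRing d) ∈ U :=
    Algebra.subset_adjoin (by simp)
  have hinv : U ≤ inv p q := by
    refine Algebra.adjoin_le ?_
    rintro f (⟨k, hp, hq, rfl⟩ | rfl | rfl)
    · exact X_mem_inv hp hq
    · exact add_mem_inv p q
    · exact mul_mem_inv p q
  have key : ∀ f : PolyRing d, ∃ a ∈ U, ∃ b ∈ U, f = a + MvPolynomial.X p * b := by
    intro f
    induction f using MvPolynomial.induction_on with
    | C a => exact ⟨_, U.algebraMap_mem a, 0, U.zero_mem, by simp [MvPolynomial.algebraMap_eq]⟩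
    | add f g hf hg =>
      obtain ⟨a, ha, b, hb, rfl⟩ := hf
      obtain ⟨a', ha', b', hb', rfl⟩ := hg
      exact ⟨_, U.add_mem ha ha', _, U.add_mem hb hb', by ring⟩
    | mul_X f k hf =>
      obtain ⟨a, ha, b, hb, rfl⟩ := hf
      by_cases hp : k = p
      · subst hp
        exact ⟨-(MvPolynomial.X k * MvPolynomial.X q) * b, U.mul_mem (U.neg_mem e2) hb,
          a + (MvPolynomial.X k + MvPolynomial.X q) * b, U.add_mem ha (U.mul_mem e1 hb), by ring⟩
      · by_cases hq : k = q
        · subst hq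
          exact ⟨(MvPolynomial.X p + MvPolynomial.X k) * a + (MvPolynomial.X p * MvPolynomial.X k) * b,
            U.add_mem (U.mul_mem e1 ha) (U.mul_mem e2 hb), -a, U.neg_mem ha, by ring⟩
        · have hk : (MvPolynomial.X k : PolyRing d) ∈ U :=
            Algebra.subset_adjoin (Or.inl ⟨k, hp, hq, rfl⟩)
          exact ⟨_, U.mul_mem ha hk, _, U.mul_mem hb hk, by ring⟩
  intro f hf
  obtain ⟨a, ha, b, hb, rfl⟩ := key f
  have h1 := mem_inv.1 (hinv ha)
  have h2 := mem_inv.1 (hinv hb)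
  have h3 := mem_inv.1 hf
  rw [map_add, map_mul, h1, h2, MvPolynomial.rename_X, Equiv.swap_apply_left] at h3
  have h4 : (MvPolynomial.X p - MvPolynomial.X q) * b = 0 := by linear_combination -h3
  rcases mul_eq_zero.1 h4 with h5 | rfl
  · exact absurd h5 (X_sub_X_ne h)
  · simpa using ha

/-- Two ring homomorphisms that agree, after multiplication by `t`, on the generators of the ring
of symmetric polynomials. -/
theorem eqOn_inv {B : Type} [CommRing B] (φ ψ : PolyRing d →+* B) (t : B) {p q : Fin d}
    (h : p ≠ q)
    (hk : ∀ k, k ≠ p → k ≠ q → φ (MvPolynomial.X k) * t = ψ (MvPolynomial.X k) * t)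
    (h1 : φ (MvPolynomial.X p + MvPolynomial.X q) * t = ψ (MvPolynomial.X p + MvPolynomial.X q) * t)
    (h2 : φ (MvPolynomial.X p * MvPolynomial.X q) * t = ψ (MvPolynomial.X p * MvPolynomial.X q) * t)
    {f : PolyRing d} (hf : f ∈ inv p q) : φ f * t = ψ f * t := by
  refine Algebra.adjoin_induction (p := fun f _ => φ f * t = ψ f * t) ?_ ?_ ?_ ?_
    (inv_le_adjoin h hf)
  · rintro f (⟨k, hp, hq, rfl⟩ | rfl | rfl)
    exacts [hk k hp hq, h1, h2]
  · intro r
    have : φ.comp (algebraMap ℚ (PolyRing d)) = ψ.comp (algebraMap ℚ (PolyRing d)) :=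
      Subsingleton.elim _ _
    exact congrArg (· * t) (RingHom.congr_fun this r)
  · intro f g _ _ hf hg
    rw [map_add, map_add, add_mul, add_mul, hf, hg]
  · intro f g _ _ hf hg
    rw [map_mul, map_mul]
    linear_combination φ f * hg + ψ g * hf

/-- The same on all polynomials. -/
theorem eqOn_all {B : Type} [CommRing B] (φ ψ : PolyRing d →+* B) (t : B)
    (hk : ∀ k, φ (MvPolynomial.X k) * t = ψ (MvPolynomial.X k) * t) (f : PolyRing d) :
    φ f * t = ψ f * t := by
  induction f using MvPolynomial.induction_on with
  | C a =>
    have : φ.comp (algebraMap ℚ (PolyRing d)) = ψ.comp (algebraMap ℚ (PolyRing d)) :=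
      Subsingleton.elim _ _
    exact congrArg (· * t) (RingHom.congr_fun this a)
  | add f g hf hg => rw [map_add, map_add, add_mul, add_mul, hf, hg]
  | mul_X f k hf =>
    rw [map_mul, map_mul]
    linear_combination φ f * hk k + ψ (MvPolynomial.X k) * hf

end EK

/-- A commutative algebra over `ℚ[x_1, …, x_d]`, which acts from the left. -/
structure LeftAlg (d : ℕ) where
  A : Type
  [commRing : CommRing A]
  [algebra : Algebra (PolyRing d) A]

attribute [instance] LeftAlg.commRing LeftAlg.algebra

namespace LeftAlg

open SC (lo hi)
open EK

variable {d : ℕ}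

/-- `ℚ[x] ⊗_S M`, where `S` is a subring of `ℚ[x]`. -/
def ext (M : LeftAlg d) (S : Subalgebra ℚ (PolyRing d)) : LeftAlg d where
  A := PolyRing d ⊗[S] M.A

/-- The left action as a ring homomorphism. -/
abbrev left (M : LeftAlg d) : PolyRing d →+* M.A := algebraMap (PolyRing d) M.A

/-- The map `m ↦ 1 ⊗ m`. -/
def inr (M : LeftAlg d) (S : Subalgebra ℚ (PolyRing d)) : M.A →+* (M.ext S).A :=
  (Algebra.TensorProduct.includeRight : M.A →ₐ[S] PolyRing d ⊗[S] M.A).toRingHom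

theorem inr_left (M : LeftAlg d) {S : Subalgebra ℚ (PolyRing d)} {c : PolyRing d} (hc : c ∈ S) :
    M.inr S (M.left c) = (M.ext S).left c := by
  have h := (Algebra.TensorProduct.includeRight : M.A →ₐ[S] PolyRing d ⊗[S] M.A).commutes ⟨c, hc⟩
  exact h

/-- The additive map `f ⊗ m ↦ β f m`. -/
def lift {M : LeftAlg d} {S : Subalgebra ℚ (PolyRing d)} {N : Type} [AddCommGroup N]
    (β : PolyRing d →+ M.A →+ N)
    (hβ : ∀ c ∈ S, ∀ f m, β (f * c) m = β f (M.left c * m)) : (M.ext S).A →+ N :=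
  TensorProduct.liftAddHom β fun c f m => by
    have h := hβ c c.2 f m
    rw [mul_comm f] at h
    rw [Algebra.smul_def, Algebra.smul_def]
    exact h

/-- Every element is a sum of elements `f ⊗ m = left f * inr m`. -/
theorem ext_induction {M : LeftAlg d} {S : Subalgebra ℚ (PolyRing d)} {P : (M.ext S).A → Prop}
    (h : ∀ f m, P ((M.ext S).left f * M.inr S m)) (hadd : ∀ x y, P x → P y → P (x + y))
    (z : (M.ext S).A) : P z := by
  refine TensorProduct.induction_on (R := S) (M := PolyRing d) (N := M.A) (motive := P) z ?_ ?_ hadd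
  · have := h 0 0
    rwa [map_zero, zero_mul] at this
  · intro f m
    have e : (M.ext S).left f * M.inr S m = (f ⊗ₜ[S] m : PolyRing d ⊗[S] M.A) := by
      change (f ⊗ₜ[S] (1 : M.A)) * ((1 : PolyRing d) ⊗ₜ[S] m) = _
      rw [Algebra.TensorProduct.tmul_mul_tmul, mul_one, one_mul]
    rw [← e]
    exact h f m

theorem lift_apply {M : LeftAlg d} {S : Subalgebra ℚ (PolyRing d)} {N : Type} [AddCommGroup N]
    (β : PolyRing d →+ M.A →+ N)
    (hβ : ∀ c ∈ S, ∀ f m, β (f * c) m = β f (M.left c * m)) (f : PolyRing d) (m : M.A) :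
    lift β hβ ((M.ext S).left f * M.inr S m) = β f m := by
  have e : (M.ext S).left f * M.inr S m = (f ⊗ₜ[S] m : PolyRing d ⊗[S] M.A) := by
    change (f ⊗ₜ[S] (1 : M.A)) * ((1 : PolyRing d) ⊗ₜ[S] m) = _
    rw [Algebra.TensorProduct.tmul_mul_tmul, mul_one, one_mul]
  rw [e]
  rfl

/-- The pairing `(f, m) ↦ φ f * ψ m`. -/
def pairing {M : LeftAlg d} {N : Type} [CommRing N] (φ : PolyRing d →+ N) (ψ : M.A →+ N) :
    PolyRing d →+ M.A →+ N :=
  (AddMonoidHom.mul.comp φ).compl₂ ψ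

theorem pairing_apply {M : LeftAlg d} {N : Type} [CommRing N] (φ : PolyRing d →+ N)
    (ψ : M.A →+ N) (f : PolyRing d) (m : M.A) : pairing φ ψ f m = φ f * ψ m := rfl

/-- The linear map `f ⊗ m ↦ f • ψ m`. -/
def liftLin {M N : LeftAlg d} {S : Subalgebra ℚ (PolyRing d)} (ψ : M.A →+ N.A)
    (hψ : ∀ c ∈ S, ∀ m, ψ (M.left c * m) = N.left c * ψ m) :
    (M.ext S).A →ₗ[PolyRing d] N.A :=
  let F : (M.ext S).A →+ N.A := lift (pairing N.left.toAddMonoidHom ψ) fun c hc f m => by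
    simp [pairing_apply, hψ c hc, mul_assoc]
  { F with
    map_smul' := fun r z => by
      change F (r • z) = r • F z
      induction z using ext_induction with
      | h f m =>
        rw [Algebra.smul_def, ← mul_assoc, ← map_mul, lift_apply, lift_apply, Algebra.smul_def]
        simp [pairing_apply, mul_assoc]
      | hadd x y hx hy => rw [smul_add, map_add, map_add, smul_add, hx, hy] }

theorem liftLin_apply {M N : LeftAlg d} {S : Subalgebra ℚ (PolyRing d)} (ψ : M.A →+ N.A)
    (hψ : ∀ c ∈ S, ∀ m, ψ (M.left c * m) = N.left c * ψ m) (f : PolyRing d) (m : M.A) :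
    liftLin ψ hψ ((M.ext S).left f * M.inr S m) = N.left f * ψ m :=
  lift_apply (pairing N.left.toAddMonoidHom ψ)
    (fun c hc f m => by simp [pairing_apply, hψ c hc, mul_assoc]) f m

theorem map_left {M N : LeftAlg d} (F : M.A →ₗ[PolyRing d] N.A) (c : PolyRing d) (m : M.A) :
    F (M.left c * m) = N.left c * F m := by
  rw [← Algebra.smul_def, ← Algebra.smul_def, map_smul]

/-- `M ↦ ℚ[x] ⊗_{ℚ[x]^{s_i}} M`. -/
abbrev step (M : LeftAlg d) (i : Fin (d - 1)) : LeftAlg d := M.ext (invColor i)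

/-- `id ⊗ F`. -/
def whisker {M N : LeftAlg d} (i : Fin (d - 1)) (F : M.A →ₗ[PolyRing d] N.A) :
    (M.step i).A →ₗ[PolyRing d] (N.step i).A :=
  liftLin ((N.inr _).toAddMonoidHom.comp F.toAddMonoidHom) fun c hc m => by
    simp only [AddMonoidHom.comp_apply]
    change N.inr _ (F (M.left c * m)) = (N.step i).left c * N.inr _ (F m)
    rw [map_left, map_mul, inr_left _ hc]

/-- EndDot: `f ⊗ m ↦ f m`. -/
def endDot (M : LeftAlg d) (i : Fin (d - 1)) : (M.step i).A →ₗ[PolyRing d] M.A :=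
  liftLin (AddMonoidHom.id _) fun _ _ _ => rfl

/-- StartDot: `m ↦ x_i ⊗ m - 1 ⊗ x_{i+1} m`. -/
def startDot (M : LeftAlg d) (i : Fin (d - 1)) : M.A →ₗ[PolyRing d] (M.step i).A where
  toFun m := (M.step i).left (MvPolynomial.X (lo i)) * M.inr _ m -
    M.inr _ (M.left (MvPolynomial.X (hi i)) * m)
  map_add' a b := by simp only [map_add, mul_add]; ring
  map_smul' r m := by
    have h1 := M.inr_left (S := invColor i) (add_mem_inv (lo i) (hi i))
    have h2 := M.inr_left (S := invColor i) (mul_mem_inv (lo i) (hi i))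
    simp only [map_add, map_mul] at h1 h2
    have key := eqOn_all ((M.inr (invColor i)).comp M.left) (M.step i).left
      ((M.step i).left (MvPolynomial.X (lo i)) - M.inr _ (M.left (MvPolynomial.X (hi i)))) (by
        intro k
        simp only [RingHom.comp_apply]
        by_cases hp : k = lo i
        · subst hp
          linear_combination (M.step i).left (MvPolynomial.X (lo i)) * h1 - h2
        · by_cases hq : k = hi i
          · subst hq
            linear_combination (-M.inr _ (M.left (MvPolynomial.X (hi i)))) * h1 + h2
          · rw [M.inr_left (X_mem_inv hp hq)]) r
    simp only [RingHom.comp_apply] at key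
    simp only [Algebra.smul_def, map_mul, RingHom.id_apply]
    linear_combination M.inr _ m * key

/-- The map `f ⊗ m ↦ ∂_{x_p x_q}(f) m`, where `x_p` and `x_q` are the variables of the color `i`
in some order. -/
def demazure (M : LeftAlg d) (i : Fin (d - 1)) (p q : Fin d) (hpq : p ≠ q)
    (h : inv p q = invColor i) : (M.step i).A →+ M.A :=
  lift (pairing (M.left.toAddMonoidHom.comp
      { toFun := dd p q
        map_zero' := by simpa using dd_add hpq 0 0
        map_add' := dd_add hpq }) (AddMonoidHom.id _)) fun c hc f m => by
    have := dd_mul hpq f (h ▸ hc)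
    simp [pairing_apply, this, mul_assoc]

theorem demazure_apply (M : LeftAlg d) (i : Fin (d - 1)) (p q : Fin d) (hpq : p ≠ q)
    (h : inv p q = invColor i) (f : PolyRing d) (m : M.A) :
    M.demazure i p q hpq h ((M.step i).left f * M.inr _ m) = M.left (dd p q f) * m :=
  lift_apply _ _ f m

theorem demazure_left (M : LeftAlg d) (i : Fin (d - 1)) (p q : Fin d) (hpq : p ≠ q)
    (h : inv p q = invColor i) {c : PolyRing d} (hc : c ∈ invColor i) (z : (M.step i).A) :
    M.demazure i p q hpq h ((M.step i).left c * z) = M.left c * M.demazure i p q hpq h z := by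
  induction z using ext_induction with
  | h f m =>
    rw [← mul_assoc, ← map_mul, demazure_apply, demazure_apply, mul_comm c,
      dd_mul hpq f (h ▸ hc), map_mul]
    ring
  | hadd x y hx hy => rw [mul_add, map_add, map_add, mul_add, hx, hy]

/-- Merge: `f ⊗ g ⊗ m ↦ f ∂_i(g) ⊗ m`. -/
def merge (M : LeftAlg d) (i : Fin (d - 1)) :
    ((M.step i).step i).A →ₗ[PolyRing d] (M.step i).A :=
  liftLin ((M.inr _).toAddMonoidHom.comp (M.demazure i (lo i) (hi i) (lo_ne_hi i) rfl))
    fun c hc z => by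
      change M.inr _ (M.demazure i _ _ _ _ ((M.step i).left c * z)) = _
      rw [demazure_left _ _ _ _ _ _ hc, map_mul, inr_left _ hc]
      rfl

/-- Split: `f ⊗ m ↦ f ⊗ 1 ⊗ m`. -/
def split (M : LeftAlg d) (i : Fin (d - 1)) :
    (M.step i).A →ₗ[PolyRing d] ((M.step i).step i).A :=
  liftLin (((M.step i).inr _).comp (M.inr _)).toAddMonoidHom fun c hc m => by
    change (M.step i).inr _ (M.inr _ (M.left c * m)) = _
    rw [map_mul, inr_left _ hc, map_mul, inr_left _ hc]
    rfl

/-- The evaluation `x_k ↦ a k` of polynomials in an algebra. -/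
def evalAt (M : LeftAlg d) (a : Fin d → M.A) : PolyRing d →+* M.A :=
  MvPolynomial.eval₂Hom (M.left.comp MvPolynomial.C) a

theorem evalAt_X (M : LeftAlg d) (a : Fin d → M.A) (k : Fin d) :
    M.evalAt a (MvPolynomial.X k) = a k := MvPolynomial.eval₂_X _ _ _

/-- The ring homomorphism `ℚ[x] → ℚ[x] ⊗_j ℚ[x] ⊗_i M` which sends the variables `x_i`, `x_{i+1}`
to `1 ⊗ 1 ⊗ x_i`, `1 ⊗ 1 ⊗ x_{i+1}` and every other variable `x_k` to `x_k ⊗ 1 ⊗ 1`. -/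
def fourEval (M : LeftAlg d) (i j : Fin (d - 1)) : PolyRing d →+* ((M.step i).step j).A :=
  LeftAlg.evalAt _ fun k =>
    if k = lo i ∨ k = hi i then (M.step i).inr _ (M.inr _ (M.left (MvPolynomial.X k)))
    else ((M.step i).step j).left (MvPolynomial.X k)

theorem fourEval_i (M : LeftAlg d) {i j : Fin (d - 1)} (h : SC.Dist i j) {c : PolyRing d}
    (hc : c ∈ invColor i) : M.fourEval i j c = ((M.step i).step j).left c := by
  have n1 : lo i ≠ lo j := by simp only [ne_eq, lo, Fin.ext_iff]; rcases h with h | h <;> omega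
  have n2 : lo i ≠ hi j := by simp only [ne_eq, lo, hi, Fin.ext_iff]; rcases h with h | h <;> omega
  have n3 : hi i ≠ lo j := by simp only [ne_eq, lo, hi, Fin.ext_iff]; rcases h with h | h <;> omega
  have n4 : hi i ≠ hi j := by simp only [ne_eq, hi, Fin.ext_iff]; rcases h with h | h <;> omega
  have key := eqOn_inv (M.fourEval i j) ((M.step i).step j).left 1 (lo_ne_hi i) ?_ ?_ ?_ hc
  · simpa using key
  · intro k hp hq
    rw [fourEval, evalAt_X, if_neg (by tauto)]
  · rw [← LeftAlg.inr_left _ ((invColor j).add_mem (X_mem_inv n1 n2) (X_mem_inv n3 n4)),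
      ← LeftAlg.inr_left _ (add_mem_inv (lo i) (hi i))]
    simp [fourEval, evalAt_X]
  · rw [← LeftAlg.inr_left _ ((invColor j).mul_mem (X_mem_inv n1 n2) (X_mem_inv n3 n4)),
      ← LeftAlg.inr_left _ (mul_mem_inv (lo i) (hi i))]
    simp [fourEval, evalAt_X]

theorem fourEval_j (M : LeftAlg d) {i j : Fin (d - 1)} (h : SC.Dist i j) {c : PolyRing d}
    (hc : c ∈ invColor j) :
    M.fourEval i j c = (M.step i).inr (invColor j) (M.inr (invColor i) (M.left c)) := by
  have n1 : lo i ≠ lo j := by simp only [ne_eq, lo, Fin.ext_iff]; rcases h with h | h <;> omega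
  have n2 : lo i ≠ hi j := by simp only [ne_eq, lo, hi, Fin.ext_iff]; rcases h with h | h <;> omega
  have n3 : hi i ≠ lo j := by simp only [ne_eq, lo, hi, Fin.ext_iff]; rcases h with h | h <;> omega
  have n4 : hi i ≠ hi j := by simp only [ne_eq, hi, Fin.ext_iff]; rcases h with h | h <;> omega
  have key := eqOn_inv (M.fourEval i j) (((M.step i).inr (invColor j)).comp
    ((M.inr (invColor i)).comp M.left)) 1 (lo_ne_hi j) ?_ ?_ ?_ hc
  · simpa using key
  · intro k hp hq
    rw [fourEval, evalAt_X]
    split_ifs with hk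
    · rfl
    · simp only [RingHom.comp_apply]
      rw [inr_left _ (X_mem_inv (by tauto) (by tauto)), inr_left _ (X_mem_inv hp hq)]
  · simp only [RingHom.comp_apply]
    rw [inr_left M ((invColor i).add_mem (X_mem_inv n1.symm n3.symm) (X_mem_inv n2.symm n4.symm)),
      inr_left _ (add_mem_inv (lo j) (hi j))]
    simp [fourEval, evalAt_X, n1.symm, n2.symm, n3.symm, n4.symm]
  · simp only [RingHom.comp_apply]
    rw [inr_left M ((invColor i).mul_mem (X_mem_inv n1.symm n3.symm) (X_mem_inv n2.symm n4.symm)),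
      inr_left _ (mul_mem_inv (lo j) (hi j))]
    simp [fourEval, evalAt_X, n1.symm, n2.symm, n3.symm, n4.symm]

/-- The map `g ⊗ m ↦ fourEval g * (1 ⊗ 1 ⊗ m)`. -/
def fourAux (M : LeftAlg d) {i j : Fin (d - 1)} (h : SC.Dist i j) :
    (M.step j).A →+ ((M.step i).step j).A :=
  lift (pairing (M.fourEval i j).toAddMonoidHom
    (((M.step i).inr (invColor j)).comp (M.inr (invColor i))).toAddMonoidHom) fun c hc f m => by
    simp [pairing_apply, M.fourEval_j h hc, mul_assoc]

/-- The 4-valent vertex: the algebra homomorphism `f ⊗ g ⊗ m ↦ f * fourEval g * (1 ⊗ 1 ⊗ m)`; it is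
the bimodule map with `1 ⊗ 1 ⊗ m ↦ 1 ⊗ 1 ⊗ m`. -/
def four (M : LeftAlg d) {i j : Fin (d - 1)} (h : SC.Dist i j) :
    ((M.step j).step i).A →ₗ[PolyRing d] ((M.step i).step j).A :=
  liftLin (M.fourAux h) fun c hc z => by
    induction z using ext_induction with
    | h f m =>
      rw [← mul_assoc, ← map_mul, fourAux, lift_apply, lift_apply, pairing_apply, pairing_apply]
      change M.fourEval i j (c * f) * _ = _ * (M.fourEval i j f * _)
      rw [map_mul, M.fourEval_i h hc, mul_assoc]
    | hadd x y hx hy => rw [mul_add, map_add, map_add, mul_add, hx, hy]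

/-- The variables of two adjacent colors `i` and `j`: `x_p`, `x_q` belong to `i` and `x_q`, `x_r`
to `j`. -/
structure Triple (i j : Fin (d - 1)) where
  p : Fin d
  q : Fin d
  r : Fin d
  hpq : p ≠ q
  hqr : q ≠ r
  hpr : p ≠ r
  inv_i : inv p q = invColor i
  inv_j : inv q r = invColor j

def Triple.ofAdj {i j : Fin (d - 1)} (h : SC.Adj i j) : Triple i j :=
  if hij : i.1 + 1 = j.1 then
    { p := lo i, q := hi i, r := hi j
      hpq := lo_ne_hi i
      hqr := by simp only [ne_eq, hi, Fin.ext_iff]; omega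
      hpr := by simp only [ne_eq, lo, hi, Fin.ext_iff]; omega
      inv_i := rfl
      inv_j := by
        have : hi i = lo j := Fin.ext hij
        rw [this] }
  else
    { p := hi i, q := lo i, r := lo j
      hpq := (lo_ne_hi i).symm
      hqr := by
        have := h.resolve_left hij
        simp only [ne_eq, lo, Fin.ext_iff]; omega
      hpr := by
        have := h.resolve_left hij
        simp only [ne_eq, lo, hi, Fin.ext_iff]; omega
      inv_i := inv_comm _ _
      inv_j := by
        have : lo i = hi j := Fin.ext (h.resolve_left hij).symm
        rw [this, inv_comm] }

/-- Polynomials invariant under `s_i` and `s_j`. -/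
abbrev inv₂ (i j : Fin (d - 1)) : Subalgebra ℚ (PolyRing d) := invColor i ⊓ invColor j

/-- `ℚ[x] ⊗_{ij} ℚ[x] ⊗_i M`. -/
abbrev sixMid (M : LeftAlg d) (i j : Fin (d - 1)) : LeftAlg d := (M.step i).ext (inv₂ i j)

/-- `1 ⊗ x_k ⊗ 1`. -/
def inner (M : LeftAlg d) (i j : Fin (d - 1)) : PolyRing d →+* (M.sixMid i j).A :=
  ((M.step i).inr (inv₂ i j)).comp (M.step i).left

theorem inner_left (M : LeftAlg d) {i j : Fin (d - 1)} {c : PolyRing d} (hc : c ∈ inv₂ i j) :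
    M.inner i j c = (M.sixMid i j).left c := inr_left _ hc

/-- The ring homomorphism `ℚ[x] → ℚ[x] ⊗_{ij} ℚ[x] ⊗_i M` which sends `x_p` to `1 ⊗ x_p ⊗ 1`, `x_q`
to `(x_p + x_q) ⊗ 1 ⊗ 1 - 1 ⊗ x_p ⊗ 1`, and every other variable `x_k` to `x_k ⊗ 1 ⊗ 1`. -/
def sixEval (M : LeftAlg d) {i j : Fin (d - 1)} (t : Triple i j) :
    PolyRing d →+* (M.sixMid i j).A :=
  LeftAlg.evalAt _ fun k =>
    if k = t.p then M.inner i j (MvPolynomial.X t.p)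
    else if k = t.q then
      (M.sixMid i j).left (MvPolynomial.X t.p + MvPolynomial.X t.q) -
        M.inner i j (MvPolynomial.X t.p)
    else (M.sixMid i j).left (MvPolynomial.X k)

/-- `1 ⊗ x_p ⊗ 1 - x_r ⊗ 1 ⊗ 1`. -/
def sixDelta (M : LeftAlg d) {i j : Fin (d - 1)} (t : Triple i j) : (M.sixMid i j).A :=
  M.inner i j (MvPolynomial.X t.p) - (M.sixMid i j).left (MvPolynomial.X t.r)

theorem mem_inv₂ {i j : Fin (d - 1)} (t : Triple i j) {f : PolyRing d} (h1 : f ∈ inv t.p t.q)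
    (h2 : f ∈ inv t.q t.r) : f ∈ inv₂ i j := ⟨t.inv_i ▸ h1, t.inv_j ▸ h2⟩

theorem inner_e1 (M : LeftAlg d) {i j : Fin (d - 1)} (t : Triple i j) :
    M.inner i j (MvPolynomial.X t.p + MvPolynomial.X t.q + MvPolynomial.X t.r) =
      (M.sixMid i j).left (MvPolynomial.X t.p + MvPolynomial.X t.q + MvPolynomial.X t.r) := by
  refine inner_left _ (mem_inv₂ t ?_ ?_)
  · exact (inv _ _).add_mem (add_mem_inv _ _) (X_mem_inv t.hpr.symm t.hqr.symm)
  · rw [add_assoc]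
    exact (inv _ _).add_mem (X_mem_inv t.hpq t.hpr) (add_mem_inv _ _)

theorem inner_e2 (M : LeftAlg d) {i j : Fin (d - 1)} (t : Triple i j) :
    M.inner i j (MvPolynomial.X t.p * MvPolynomial.X t.q +
        (MvPolynomial.X t.p + MvPolynomial.X t.q) * MvPolynomial.X t.r) =
      (M.sixMid i j).left (MvPolynomial.X t.p * MvPolynomial.X t.q +
        (MvPolynomial.X t.p + MvPolynomial.X t.q) * MvPolynomial.X t.r) := by
  refine inner_left _ (mem_inv₂ t ?_ ?_)
  · exact (inv _ _).add_mem (mul_mem_inv _ _)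
      ((inv _ _).mul_mem (add_mem_inv _ _) (X_mem_inv t.hpr.symm t.hqr.symm))
  · have : (MvPolynomial.X t.p * MvPolynomial.X t.q +
        (MvPolynomial.X t.p + MvPolynomial.X t.q) * MvPolynomial.X t.r : PolyRing d) =
        MvPolynomial.X t.p * (MvPolynomial.X t.q + MvPolynomial.X t.r) +
          MvPolynomial.X t.q * MvPolynomial.X t.r := by ring
    rw [this]
    exact (inv _ _).add_mem ((inv _ _).mul_mem (X_mem_inv t.hpq t.hpr) (add_mem_inv _ _))
      (mul_mem_inv _ _)

theorem inner_e3 (M : LeftAlg d) {i j : Fin (d - 1)} (t : Triple i j) :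
    M.inner i j (MvPolynomial.X t.p * MvPolynomial.X t.q * MvPolynomial.X t.r) =
      (M.sixMid i j).left (MvPolynomial.X t.p * MvPolynomial.X t.q * MvPolynomial.X t.r) := by
  refine inner_left _ (mem_inv₂ t ?_ ?_)
  · exact (inv _ _).mul_mem (mul_mem_inv _ _) (X_mem_inv t.hpr.symm t.hqr.symm)
  · rw [mul_assoc]
    exact (inv _ _).mul_mem (X_mem_inv t.hpq t.hpr) (mul_mem_inv _ _)

theorem sixEval_i (M : LeftAlg d) {i j : Fin (d - 1)} (t : Triple i j) {c : PolyRing d}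
    (hc : c ∈ invColor i) :
    M.sixEval t c * M.sixDelta t = (M.sixMid i j).left c * M.sixDelta t := by
  have E1 := M.inner_e1 t
  have E2 := M.inner_e2 t
  have E3 := M.inner_e3 t
  simp only [map_add, map_mul] at E1 E2 E3
  rw [← t.inv_i] at hc
  refine eqOn_inv _ _ _ t.hpq ?_ ?_ ?_ hc
  · intro k h1 h2
    rw [sixEval, evalAt_X, if_neg h1, if_neg h2]
  · simp only [sixEval, map_add, evalAt_X, if_true, if_neg t.hpq.symm]
    ring
  · simp only [sixEval, map_mul, map_add, evalAt_X, if_true, if_neg t.hpq.symm, sixDelta]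
    linear_combination (-(M.inner i j (MvPolynomial.X t.p)) ^ 2) * E1 +
      M.inner i j (MvPolynomial.X t.p) * E2 - E3

theorem sixEval_j (M : LeftAlg d) {i j : Fin (d - 1)} (t : Triple i j) {c : PolyRing d}
    (hc : c ∈ invColor j) :
    M.sixEval t c * M.sixDelta t = M.inner i j c * M.sixDelta t := by
  have E1 := M.inner_e1 t
  have E2 := M.inner_e2 t
  have E3 := M.inner_e3 t
  simp only [map_add, map_mul] at E1 E2 E3
  rw [← t.inv_j] at hc
  refine eqOn_inv _ _ _ t.hqr ?_ ?_ ?_ hc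
  · intro k h1 h2
    rw [sixEval, evalAt_X, if_neg h1]
    split_ifs with h3
    · rw [h3]
    · rw [← inner_left M (mem_inv₂ t (X_mem_inv h3 h1) (X_mem_inv h1 h2))]
  · simp only [sixEval, map_add, evalAt_X, if_true, if_neg t.hpq.symm, if_neg t.hpr.symm,
      if_neg t.hqr.symm]
    linear_combination (-M.sixDelta t) * E1
  · simp only [sixEval, map_mul, map_add, evalAt_X, if_true, if_neg t.hpq.symm,
      if_neg t.hpr.symm, if_neg t.hqr.symm, sixDelta]
    linear_combination
      (-(M.sixMid i j).left (MvPolynomial.X t.r) * M.inner i j (MvPolynomial.X t.p)) * E1 +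
        (M.sixMid i j).left (MvPolynomial.X t.r) * E2 - E3

/-- The map `f ⊗ g ⊗ m ↦ f ⊗ 1 ⊗ 1 ⊗ ∂_{x_p x_q}(g) m`. -/
def sixOut (M : LeftAlg d) {i j : Fin (d - 1)} (t : Triple i j) :
    (M.sixMid i j).A →ₗ[PolyRing d] (((M.step j).step i).step j).A :=
  liftLin ((((((M.step j).step i).inr (invColor j)).comp ((M.step j).inr (invColor i))).comp
      (M.inr (invColor j))).toAddMonoidHom.comp (M.demazure i t.p t.q t.hpq t.inv_i))
    fun c hc z => by
      change ((M.step j).step i).inr _ ((M.step j).inr _ (M.inr _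
        (M.demazure i t.p t.q t.hpq t.inv_i ((M.step i).left c * z)))) = _
      rw [demazure_left _ _ _ _ _ _ hc.1, map_mul, inr_left _ hc.2, map_mul, inr_left _ hc.1,
        map_mul, inr_left _ hc.2]
      rfl

/-- The map `g ⊗ z ↦ sixEval g * sixDelta * (1 ⊗ z)`. -/
def sixIn (M : LeftAlg d) {i j : Fin (d - 1)} (t : Triple i j) :
    ((M.step i).step j).A →+ (M.sixMid i j).A :=
  lift (pairing ((AddMonoidHom.mulRight (M.sixDelta t)).comp (M.sixEval t).toAddMonoidHom)
    ((M.step i).inr (inv₂ i j)).toAddMonoidHom) fun c hc f m => by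
    have := M.sixEval_j t hc
    change M.sixEval t (f * c) * M.sixDelta t * (M.step i).inr _ m =
      M.sixEval t f * M.sixDelta t * (M.step i).inr _ ((M.step i).left c * m)
    rw [map_mul, map_mul]
    change _ = M.sixEval t f * M.sixDelta t * (M.inner i j c * _)
    linear_combination M.sixEval t f * (M.step i).inr _ m * this

/-- The 6-valent vertex: the bimodule map `f ⊗ g ⊗ z ↦ f * sixOut (sixIn (g ⊗ z))`.  It sends
`1 ⊗ 1 ⊗ 1 ⊗ 1` to `1 ⊗ 1 ⊗ 1 ⊗ 1`, and `1 ⊗ x_p ⊗ 1 ⊗ 1` to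
`1 ⊗ 1 ⊗ 1 ⊗ (x_p + x_q) - x_r ⊗ 1 ⊗ 1 ⊗ 1 = (x_p + x_q) ⊗ 1 ⊗ 1 ⊗ 1 - 1 ⊗ 1 ⊗ 1 ⊗ x_r`. -/
def six (M : LeftAlg d) {i j : Fin (d - 1)} (h : SC.Adj i j) :
    (((M.step i).step j).step i).A →ₗ[PolyRing d] (((M.step j).step i).step j).A :=
  let t := Triple.ofAdj h
  liftLin ((M.sixOut t).toAddMonoidHom.comp (M.sixIn t)) fun c hc z => by
    have key : M.sixIn t (((M.step i).step j).left c * z) =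
        (M.sixMid i j).left c * M.sixIn t z := by
      induction z using ext_induction with
      | h f m =>
        rw [← mul_assoc, ← map_mul, sixIn, lift_apply, lift_apply, pairing_apply, pairing_apply]
        change M.sixEval t (c * f) * M.sixDelta t * _ =
          _ * (M.sixEval t f * M.sixDelta t * _)
        have := M.sixEval_i t hc
        rw [map_mul]
        linear_combination M.sixEval t f *
          ((M.step i).inr (inv₂ i j)).toAddMonoidHom m * this
      | hadd x y hx hy => rw [mul_add, map_add, map_add, mul_add, hx, hy]
    change M.sixOut t (M.sixIn t _) = _ * M.sixOut t (M.sixIn t z)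
    rw [key, map_left]

end LeftAlg

namespace LeftAlg

variable {d : ℕ}

instance (M : LeftAlg d) : Algebra ℚ M.A := Algebra.compHom M.A (algebraMap ℚ (PolyRing d))

/-- The ring `ℚ[x_1, …, x_d]`. -/
def base (d : ℕ) : LeftAlg d where
  A := PolyRing d

/-- `ℚ[x] ⊗_{i₁} ℚ[x] ⊗_{i₂} ⋯ ⊗_{iₘ} M`. -/
def run (M : LeftAlg d) : List (Fin (d - 1)) → LeftAlg d
  | [] => M
  | i :: w => (M.run w).step i

/-- The map `m ↦ 1 ⊗ ⋯ ⊗ 1 ⊗ m`. -/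
def inrRun (M : LeftAlg d) : (w : List (Fin (d - 1))) → M.A →+* (M.run w).A
  | [] => RingHom.id _
  | _ :: w => ((M.run w).inr _).comp (M.inrRun w)

/-- The image of a generator. -/
def gen {boxed : Bool} (M : LeftAlg d) (w : List (Fin (d - 1))) : (g : SCGen d boxed) →
    (M.run ((SCSig d boxed).src g ++ w)).A →ₗ[PolyRing d] (M.run ((SCSig d boxed).tgt g ++ w)).A
  | .endDot i => (M.run w).endDot i
  | .startDot i => (M.run w).startDot i
  | .merge i => (M.run w).merge i
  | .split i => (M.run w).split i
  | .four _ _ h => (M.run w).four h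
  | .six _ _ h => (M.run w).six h
  | .box k _ => LinearMap.mulLeft (PolyRing d) ((M.run w).left (MvPolynomial.X k))

/-- The image of a diagram. -/
def map {boxed : Bool} (M : LeftAlg d) : {u v : List (Fin (d - 1))} → Diag (SCSig d boxed) u v →
    (M.run u).A →ₗ[PolyRing d] (M.run v).A
  | _, _, .id _ => LinearMap.id
  | _, _, .comp f g => M.map g ∘ₗ M.map f
  | _, _, .zero _ _ => 0
  | _, _, .add f g => M.map f + M.map g
  | _, _, .smul q f => (MvPolynomial.C q : PolyRing d) • M.map f
  | _, _, .gen g w => M.gen w g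
  | _, _, .cons i f => whisker i (M.map f)

end LeftAlg

/-- The ring `ℱ_EK(w) = ℚ[x] ⊗_{i₁} ℚ[x] ⊗_{i₂} ⋯ ⊗_{iₘ} ℚ[x]`, where `⊗_i` is the tensor product over
the polynomials that are symmetric in `x_i` and `x_{i+1}`. -/
abbrev EKRing (d : ℕ) (w : List (Fin (d - 1))) : Type := ((LeftAlg.base d).run w).A

/-- The Elias–Khovanov functor on diagrams. -/
def fEK {d : ℕ} {boxed : Bool} {u v : List (Fin (d - 1))} (D : Diag (SCSig d boxed) u v) :
    EKRing d u →ₗ[PolyRing d] EKRing d v :=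
  (LeftAlg.base d).map D

/-- The left action of `ℚ[x_1, …, x_d]`. -/
def ekLeft {d : ℕ} (w : List (Fin (d - 1))) : PolyRing d →ₐ[ℚ] EKRing d w :=
  RingHom.toRatAlgHom ((LeftAlg.base d).run w).left

/-- The right action of `ℚ[x_1, …, x_d]`. -/
def ekRight {d : ℕ} (w : List (Fin (d - 1))) : PolyRing d →ₐ[ℚ] EKRing d w :=
  RingHom.toRatAlgHom ((LeftAlg.base d).inrRun w)

def ekBimodule {d : ℕ} (w : List (Fin (d - 1))) : BimCat d :=
  bimodule (EKRing d w) (ekLeft w) (ekRight w)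

/-- The functor `ℱ_EK : 𝒮𝒞₁(d) → Bim(d)*`, respectively `ℱ_EK' : 𝒮𝒞₁'(d) → Bim(d)*`: the functor on
classes of diagrams that has the prescribed values. -/
structure EKFunctor (d : ℕ) (boxed : Bool) where
  map : ∀ {X Y : SoergelCat d boxed}, (X ⟶ Y) → (ekBimodule X.word ⟶ ekBimodule Y.word)
  map_ofDiag : ∀ {X Y : SoergelCat d boxed} (D : Diag (SCSig d boxed) X.word Y.word)
    (z : EKRing d X.word),
    ofBimodule ((map (PresCat.ofDiag D : X ⟶ Y)).hom (toBimodule _ _ z)) = fEK D z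

def EKFunctor.toFunctor {d : ℕ} {boxed : Bool} (F : EKFunctor d boxed) :
    SoergelCat d boxed ⥤ BimCat d where
  obj X := ekBimodule X.word
  map := F.map
  map_id X := by
    ext z
    exact F.map_ofDiag (.id X.word) z
  map_comp := by
    rintro X Y Z ⟨f⟩ ⟨g⟩
    ext z
    exact (F.map_ofDiag (f ⋆ g) z).trans
      ((F.map_ofDiag g _).trans (congrArg (fEK g) (F.map_ofDiag f z))).symm

/-- `z ↦ 1 ⊗ z`, from `ℱ_EK(w)` to `ℱ_EK(i w) = ℚ[x] ⊗_i ℱ_EK(w)`. -/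
def ekIncl {d : ℕ} (i : Fin (d - 1)) (w : List (Fin (d - 1))) : EKRing d w →+* EKRing d (i :: w) :=
  ((LeftAlg.base d).run w).inr (EK.invColor i)

/-- The inclusion `ℱ_Bim(Σ(w)) → ℱ_Bim(Σ(i w)) = ℱ_Bim(ℰ_{-i} ℰ_{+i} Σ(w))`. -/
def webIncl {n d : ℕ} (hdn : d ≤ n) (i : Fin (d - 1)) (w : List (Fin (d - 1))) :
    WebRing n d (SoergelToSchur.word hdn w) →ₐ[ℚ] WebRing n d (SoergelToSchur.word hdn (i :: w)) :=
  ((((baseState n d).run (SoergelToSchur.word hdn w)).step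
      (.up (SoergelToSchur.color hdn i))).incl (.dn (SoergelToSchur.color hdn i))).comp
    (((baseState n d).run (SoergelToSchur.word hdn w)).incl (.up (SoergelToSchur.color hdn i)))

/-! ## The sign normalization -/

/-- The automorphism `x_j ↦ -x_j` of `ℚ[x_1, …, x_d]`. -/
def signTwist (d : ℕ) : PolyRing d →ₐ[ℚ] PolyRing d := MvPolynomial.aeval fun j => -MvPolynomial.X j

/-- The autoequivalence of `Bim(d)*` which twists both actions by `x_j ↦ -x_j`. -/
def twist (d : ℕ) : BimCat d ⥤ BimCat d :=
  ModuleCat.restrictScalars (Algebra.TensorProduct.map (signTwist d) (signTwist d)).toRingHom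

end

/-! The isomorphism is built one color at a time. Suppose that every strand of a web carries at most
one variable and that these variables are identified with the elements `-x_j` of a left algebra `M`
(`Matches`). Then `ℰ_{+i}` adjoins a root of a linear polynomial, which adds nothing, and strand `i`
now carries `-x_i` and `-x_{i+1}`. Next, `ℰ_{-i}` adjoins a root `y` of `(Y + x_i)(Y + x_{i+1})`.
The resulting ring is `ℚ[x] ⊗_i M` through `y ↦ -x_{i+1} ⊗ 1` (`Matches.stepHom_bijective`), and
again every strand carries at most one variable (`Matches.step`), so the construction iterates over
words. The sign is forced by StartDot: the cup is `y` minus the variable of strand `i`, which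
becomes `1 ⊗ x_i - x_{i+1} ⊗ 1 = x_i ⊗ 1 - 1 ⊗ x_{i+1}`; without the twist the negative of this
element would appear.

The maps of webs are defined by coordinates, namely by remainders modulo the polynomial of an
alphabet. Adding a strand on the left is compatible with the ring structure only for maps that
intertwine the coefficients of all alphabets (`Bal`). This holds for cups and caps, where the gained
and the lost variable become equal, for crossings of different colors, which relabel variables, and
for crossings of equal color, which are linear over the symmetric functions of the two variables;
hence it holds for all diagrams (`bal_map`). On alphabets of size one, `Bal` is linearity for the
left action; `base_map` is linearity for the right action. The technical device is that the pairs of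
multiplications intertwined by a map form a ring, over which products and divisions of polynomials
can be carried out (`PolySlides.exists_lift`).

It remains to compare bimodule maps on generators. For EndDot, StartDot, Split and the 4-valent
vertex the source is generated by `1` (`map_eq_of_one`). For Merge and the 6-valent vertices it is
generated by `1` and one inner variable, quadratic over the ring generated by the two actions
(`map_eq_of_generated`). The values on these generators are computed from small alphabets
(`four_one`, `sixDown_apply`, `sixUp_apply`). The box is a telescoping sum of double dots corrected
by a fake bubble (`Matches.box`). Induction over diagrams then gives the triangle on every diagram
(`comparison_map`) without using any defining relation, and the triangle of functors follows by
choosing representatives. -/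

/-! ## Additive maps between rings that intertwine multiplications -/

section Slides

variable {S T U : Type} [CommRing S] [CommRing T] [CommRing U]
  [Algebra ℚ S] [Algebra ℚ T] [Algebra ℚ U]

/-- The map `F` intertwines multiplication by `a` and by `a'`. -/
def Slides (F : S →ₗ[ℚ] T) (a : S) (a' : T) : Prop := ∀ z, F (a * z) = a' * F z

theorem Slides.apply {F : S →ₗ[ℚ] T} {a : S} {a' : T} (h : Slides F a a') : F a = a' * F 1 := by
  simpa using h 1

theorem Slides.comp {F : S →ₗ[ℚ] T} {G : T →ₗ[ℚ] U} {a : S} {b : T} {c : U} (hF : Slides F a b)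
    (hG : Slides G b c) : Slides (G ∘ₗ F) a c := fun z => by
  rw [LinearMap.comp_apply, hF, hG, LinearMap.comp_apply]

theorem Slides.zero (F : S →ₗ[ℚ] T) : Slides F 0 0 := fun z => by simp

theorem Slides.one (F : S →ₗ[ℚ] T) : Slides F 1 1 := fun z => by simp

theorem Slides.add {F : S →ₗ[ℚ] T} {a b : S} {a' b' : T} (h : Slides F a a') (h' : Slides F b b') :
    Slides F (a + b) (a' + b') := fun z => by rw [add_mul, map_add, h, h', add_mul]

theorem Slides.neg {F : S →ₗ[ℚ] T} {a : S} {a' : T} (h : Slides F a a') :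
    Slides F (-a) (-a') := fun z => by rw [neg_mul, map_neg, h, neg_mul]

theorem Slides.sub {F : S →ₗ[ℚ] T} {a b : S} {a' b' : T} (h : Slides F a a') (h' : Slides F b b') :
    Slides F (a - b) (a' - b') := fun z => by rw [sub_mul, map_sub, h, h', sub_mul]

theorem Slides.mul {F : S →ₗ[ℚ] T} {a b : S} {a' b' : T} (h : Slides F a a') (h' : Slides F b b') :
    Slides F (a * b) (a' * b') := fun z => by rw [mul_assoc, h, h', mul_assoc]

/-- The ring of all pairs of multiplications that `F` intertwines. -/
def slideRing (F : S →ₗ[ℚ] T) : Subring (S × T) where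
  carrier := {p | Slides F p.1 p.2}
  zero_mem' := Slides.zero F
  one_mem' := Slides.one F
  add_mem' := Slides.add
  mul_mem' := Slides.mul
  neg_mem' := Slides.neg

/-- `F` intertwines the coefficients of two polynomials. -/
def PolySlides (F : S →ₗ[ℚ] T) (N : S[X]) (N' : T[X]) : Prop :=
  ∀ k, Slides F (N.coeff k) (N'.coeff k)

/-- Each pair of corresponding coefficients is one element of `slideRing F`, so the pair of
polynomials is one polynomial over that ring. Operations that commute with base change therefore
preserve `PolySlides`. -/
theorem PolySlides.exists_lift {F : S →ₗ[ℚ] T} {N : S[X]} {N' : T[X]} (h : PolySlides F N N') :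
    ∃ Q : (slideRing F)[X], Q.map ((RingHom.fst S T).comp (slideRing F).subtype) = N ∧
      Q.map ((RingHom.snd S T).comp (slideRing F).subtype) = N' := by
  -- The two degrees may differ, so the range covers the larger one; the surplus coefficients
  -- vanish.
  refine ⟨∑ k ∈ Finset.range (max N.natDegree N'.natDegree + 1),
    monomial k ⟨(N.coeff k, N'.coeff k), h k⟩, ?_, ?_⟩
  · ext m
    rw [coeff_map, finsetSum_coeff]
    simp only [coeff_monomial, Finset.sum_ite_eq', Finset.mem_range]
    split_ifs with hm
    · rfl
    · rw [map_zero, coeff_eq_zero_of_natDegree_lt (by omega)]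
  · ext m
    rw [coeff_map, finsetSum_coeff]
    simp only [coeff_monomial, Finset.sum_ite_eq', Finset.mem_range]
    split_ifs with hm
    · rfl
    · rw [map_zero, coeff_eq_zero_of_natDegree_lt (by omega)]

theorem PolySlides.of_lift {F : S →ₗ[ℚ] T} (Q : (slideRing F)[X]) :
    PolySlides F (Q.map ((RingHom.fst S T).comp (slideRing F).subtype))
      (Q.map ((RingHom.snd S T).comp (slideRing F).subtype)) := fun k => by
  rw [coeff_map, coeff_map]
  exact (Q.coeff k).2

theorem PolySlides.mul {F : S →ₗ[ℚ] T} {N M : S[X]} {N' M' : T[X]} (h : PolySlides F N N')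
    (h' : PolySlides F M M') : PolySlides F (N * M) (N' * M') := by
  obtain ⟨Q, rfl, rfl⟩ := h.exists_lift
  obtain ⟨R, rfl, rfl⟩ := h'.exists_lift
  rw [← Polynomial.map_mul, ← Polynomial.map_mul]
  exact of_lift _

theorem PolySlides.mul_X_sub_C {F : S →ₗ[ℚ] T} {N : S[X]} {N' : T[X]} (h : PolySlides F N N')
    {a : S} {a' : T} (ha : Slides F a a') : PolySlides F (N * (X - C a)) (N' * (X - C a')) := by
  refine h.mul fun k => ?_
  simp only [coeff_sub, coeff_X, coeff_C]
  refine Slides.sub ?_ ?_ <;> split_ifs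
  exacts [.one F, .zero F, ha, .zero F]

/-- Division by a monic polynomial commutes with ring homomorphisms: it is carried out over
`slideRing F` and projected to both factors. -/
theorem PolySlides.div_X_sub_C {F : S →ₗ[ℚ] T} {N : S[X]} {N' : T[X]} (h : PolySlides F N N')
    {a : S} {a' : T} (ha : Slides F a a') : PolySlides F (N /ₘ (X - C a)) (N' /ₘ (X - C a')) := by
  obtain ⟨Q, rfl, rfl⟩ := h.exists_lift
  have h1 := Polynomial.map_divByMonic ((RingHom.fst S T).comp (slideRing F).subtype)
    (p := Q) (monic_X_sub_C (⟨(a, a'), ha⟩ : slideRing F))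
  have h2 := Polynomial.map_divByMonic ((RingHom.snd S T).comp (slideRing F).subtype)
    (p := Q) (monic_X_sub_C (⟨(a, a'), ha⟩ : slideRing F))
  rw [Polynomial.map_sub, map_X, map_C] at h1 h2
  have h3 := of_lift (Q /ₘ (X - C (⟨(a, a'), ha⟩ : slideRing F)))
  rw [h1, h2] at h3
  exact h3

end Slides

namespace WebState

open SLetter
open SC (lo hi)

variable {n : ℕ} (s : WebState n) (l : SLetter n)

/-! ## One step of a web -/

theorem loses_ne_gains : loses l ≠ gains l := by
  cases l <;> simp [loses, gains, lo, hi, Fin.ext_iff]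

noncomputable section

/-- The ring homomorphism given by a root of the polynomial of the alphabet. -/
def stepLift {B : Type} [CommRing B] (f : s.A →+* B) (b : B)
    (h : (s.P (loses l)).eval₂ f b = 0) : (s.step l).A →+* B := AdjoinRoot.lift f b h

theorem stepLift_incl {B : Type} [CommRing B] (f : s.A →+* B) (b : B)
    (h : (s.P (loses l)).eval₂ f b = 0) (c : s.A) : s.stepLift l f b h (s.incl l c) = f c :=
  AdjoinRoot.lift_of h

theorem stepLift_var {B : Type} [CommRing B] (f : s.A →+* B) (b : B)
    (h : (s.P (loses l)).eval₂ f b = 0) : s.stepLift l f b h (s.var l) = b :=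
  AdjoinRoot.lift_root h

theorem eval_var : ((s.P (loses l)).map (s.incl l).toRingHom).eval (s.var l) = 0 := by
  rw [Polynomial.eval_map]
  exact AdjoinRoot.eval₂_root _

theorem P_loses_eq : (s.step l).P (loses l) =
    (s.P (loses l)).map (s.incl l).toRingHom /ₘ (X - C (s.var l)) := if_pos rfl

theorem P_loses_mul : (s.step l).P (loses l) * (X - C (s.var l)) =
    (s.P (loses l)).map (s.incl l).toRingHom := by
  rw [P_loses_eq, mul_comm]
  exact mul_divByMonic_eq_iff_isRoot.2 (s.eval_var l)

theorem P_gains : (s.step l).P (gains l) =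
    (s.P (gains l)).map (s.incl l).toRingHom * (X - C (s.var l)) :=
  (if_neg (loses_ne_gains l).symm).trans (if_pos rfl)

theorem P_of_ne {j : Fin n} (h : j ≠ loses l) (h' : j ≠ gains l) :
    (s.step l).P j = (s.P j).map (s.incl l).toRingHom :=
  (if_neg h).trans (if_neg h')

/-- A polynomial in the new variable. -/
def ofPoly (f : s.A[X]) : (s.step l).A := AdjoinRoot.mk (s.P (loses l)) f

theorem ofPoly_surjective : Function.Surjective (s.ofPoly l) :=
  AdjoinRoot.mk_surjective (g := s.P (loses l))

theorem ofPoly_eq_sum (f : s.A[X]) :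
    s.ofPoly l f =
      f.sum fun k c => s.incl l c * s.var l ^ k := by
  conv_lhs => rw [f.as_sum_support_C_mul_X_pow, ofPoly, map_sum]
  refine Finset.sum_congr rfl fun k _ => ?_
  rw [map_mul, map_pow]
  rfl

theorem step_induction {p : (s.step l).A → Prop} (h : ∀ c k, p (s.incl l c * s.var l ^ k))
    (hadd : ∀ x y, p x → p y → p (x + y)) (z : (s.step l).A) : p z := by
  obtain ⟨f, rfl⟩ := s.ofPoly_surjective l z
  rw [ofPoly_eq_sum]
  refine Finset.sum_induction _ p hadd ?_ fun k _ => h _ k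
  simpa using h 0 0

/-- The map with `c * x ^ k ↦ φ c * b ^ k`, where `x` is the new variable. -/
def extend {B : Type} [CommRing B] [Algebra ℚ B] (φ : s.A →ₗ[ℚ] B) (b : B) :
    (s.step l).A →ₗ[ℚ] B :=
  ∑ k ∈ Finset.range (s.size l), LinearMap.mulRight ℚ (b ^ k) ∘ₗ φ ∘ₗ s.coeff l k

theorem coeff_ofPoly (f : s.A[X]) (k : ℕ) :
    s.coeff l k (s.ofPoly l f) =
      (f %ₘ s.P (loses l)).coeff k := rfl

theorem incl_mul_pow (c : s.A) (m : ℕ) : s.incl l c * s.var l ^ m =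
    s.ofPoly l (C c * X ^ m) := by
  rw [ofPoly, map_mul, map_pow]
  rfl

theorem coeff_pow (c : s.A) {m : ℕ} (hm : m < s.size l) (k : ℕ) :
    s.coeff l k (s.incl l c * s.var l ^ m) = if k = m then c else 0 := by
  nontriviality s.A
  rw [incl_mul_pow, coeff_ofPoly, (modByMonic_eq_self_iff (s.monic _)).2, coeff_C_mul_X_pow]
  refine (degree_C_mul_X_pow_le _ _).trans_lt ?_
  rw [degree_eq_natDegree (s.monic _).ne_zero]
  exact_mod_cast hm

theorem step_subsingleton [Subsingleton s.A] : Subsingleton (s.step l).A := by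
  refine subsingleton_of_zero_eq_one ?_
  rw [← map_zero (s.incl l), ← map_one (s.incl l), Subsingleton.elim (0 : s.A) 1]

/-- Remainders modulo a monic polynomial are a normal form for the ring with an adjoined root. -/
theorem eq_sum_coeff (z : (s.step l).A) :
    z = ∑ k ∈ Finset.range (s.size l), s.incl l (s.coeff l k z) * s.var l ^ k := by
  rcases subsingleton_or_nontrivial s.A with _ | _
  · have := s.step_subsingleton l
    exact Subsingleton.elim _ _
  -- An empty alphabet has polynomial `1`, and adjoining a root of it gives the zero ring. The bound
  -- on the degree of the remainder needs this case to be excluded.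
  by_cases h1 : s.P (loses l) = 1
  · have : Subsingleton (s.step l).A := by
      refine subsingleton_of_zero_eq_one ?_
      have := s.eval_var l
      rw [h1, Polynomial.map_one, eval_one] at this
      exact this.symm
    exact Subsingleton.elim _ _
  obtain ⟨f, rfl⟩ := s.ofPoly_surjective l z
  have h : s.ofPoly l (f %ₘ s.P (loses l)) = s.ofPoly l f :=
    AdjoinRoot.mk_leftInverse (s.monic (loses l)) (AdjoinRoot.mk (s.P (loses l)) f)
  conv_lhs => rw [← h]
  rw [ofPoly_eq_sum, sum_over_range' _ _ (s.size l)]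
  · rfl
  · exact natDegree_modByMonic_lt _ (s.monic _) h1
  · intro k; simp

variable {l} in
theorem extend_eq {B : Type} [CommRing B] [Algebra ℚ B] (φ : s.A →ₗ[ℚ] B) (b : B)
    (z : (s.step l).A) :
    s.extend l φ b z = ∑ k ∈ Finset.range (s.size l), φ (s.coeff l k z) * b ^ k := by
  rw [extend, LinearMap.sum_apply]
  rfl

/-- By definition `extend` reads only the coefficients of a remainder, so the formula is immediate
only for small exponents. The hypothesis says that `c * x ^ k ↦ φ c * b ^ k` kills the multiples of
the defining polynomial; then polynomial and remainder have the same image. -/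
theorem extend_apply {B : Type} [CommRing B] [Algebra ℚ B] (φ : s.A →ₗ[ℚ] B) (b : B)
    (h : ∀ z, ((s.P (loses l)).sum fun k c => φ (c * z) * b ^ k) = 0) (c : s.A) (m : ℕ) :
    s.extend l φ b (s.incl l c * s.var l ^ m) = φ c * b ^ m := by
  rcases subsingleton_or_nontrivial s.A with _ | _
  · have := s.step_subsingleton l
    rw [Subsingleton.elim (s.incl l c * s.var l ^ m) 0, Subsingleton.elim c 0]
    simp
  let G : s.A[X] → B := fun f => f.sum fun k c => φ c * b ^ k
  have G_zero : ∀ k, φ 0 * b ^ k = 0 := by simp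
  have G_range : ∀ (f : s.A[X]) (N : ℕ), f.natDegree < N →
      G f = ∑ k ∈ Finset.range N, φ (f.coeff k) * b ^ k := fun f N hN =>
    sum_over_range' f G_zero N hN
  have G_add : ∀ f g, G (f + g) = G f + G g := fun f g =>
    sum_add_index f g _ (by simp) (by intros; simp [add_mul])
  -- By additivity a multiple of `P` by a monomial `a * X ^ k` suffices: shifting exponents by `k`
  -- pulls out `b ^ k` and leaves the hypothesis for `a`.
  have G_mul : ∀ f, G (s.P (loses l) * f) = 0 := by
    intro f
    induction f using Polynomial.induction_on' with
    | add p q hp hq => rw [mul_add, G_add, hp, hq, add_zero]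
    | monomial k a =>
      set N := (s.P (loses l)).natDegree + 1 with hN
      have e := h a
      rw [sum_over_range' _ (by simp) N (by omega)] at e
      rw [G_range _ (N + k) (by
        refine lt_of_le_of_lt natDegree_mul_le ?_
        have := natDegree_monomial_le (m := k) a
        omega), add_comm, Finset.sum_range_add]
      have z1 : ∀ x ∈ Finset.range k,
          φ ((s.P (loses l) * monomial k a).coeff x) * b ^ x = 0 := by
        intro x hx
        rw [← C_mul_X_pow_eq_monomial, ← mul_assoc, coeff_mul_X_pow', if_neg (by
          have := Finset.mem_range.1 hx; omega)]
        simp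
      rw [Finset.sum_eq_zero z1, zero_add]
      have z2 : ∀ x ∈ Finset.range N,
          φ ((s.P (loses l) * monomial k a).coeff (k + x)) * b ^ (k + x) =
            b ^ k * (φ ((s.P (loses l)).coeff x * a) * b ^ x) := by
        intro x _
        rw [← C_mul_X_pow_eq_monomial, ← mul_assoc, coeff_mul_X_pow', if_pos (by omega),
          Nat.add_sub_cancel_left, coeff_mul_C]
        ring
      rw [Finset.sum_congr rfl z2, ← Finset.mul_sum, e, mul_zero]
  have E : ∀ f : s.A[X], s.extend l φ b (s.ofPoly l f) = G f := by
    intro f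
    by_cases h1 : s.P (loses l) = 1
    · have hG : ∀ f, G f = 0 := by
        intro f
        have := G_mul f
        rwa [h1, one_mul] at this
      rw [hG]
      rw [extend_eq, size, h1, natDegree_one, Finset.sum_range_zero]
    have e : G f = G (f %ₘ s.P (loses l)) := by
      conv_lhs => rw [← modByMonic_add_div f (s.P (loses l))]
      rw [G_add, G_mul, add_zero]
    rw [e, G_range _ _ (natDegree_modByMonic_lt _ (s.monic _) h1), extend_eq]
    rfl
  rw [incl_mul_pow, E, C_mul_X_pow_eq_monomial]
  exact sum_monomial_index _ _ (by simp)

section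

variable {s l} {B : Type} [CommRing B] [Algebra ℚ B] {F : (s.step l).A →ₗ[ℚ] B}

theorem slides_incl {φ : s.A →ₗ[ℚ] B} {b : B}
    (hF : ∀ c m, F (s.incl l c * s.var l ^ m) = φ c * b ^ m) {a : s.A} {a' : B}
    (h : Slides φ a a') : Slides F (s.incl l a) a' := by
  intro z
  induction z using step_induction with
  | h c k => rw [← mul_assoc, ← map_mul, hF, hF, h, mul_assoc]
  | hadd x y hx hy => rw [mul_add, map_add, map_add, mul_add, hx, hy]

theorem slides_var {φ : s.A →ₗ[ℚ] B} {b : B}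
    (hF : ∀ c m, F (s.incl l c * s.var l ^ m) = φ c * b ^ m) : Slides F (s.var l) b := by
  intro z
  induction z using step_induction with
  | h c k => rw [mul_left_comm, ← pow_succ', hF, hF, pow_succ]; ring
  | hadd x y hx hy => rw [mul_add, map_add, map_add, mul_add, hx, hy]

end

/-- The map `f` intertwines the alphabets of the two webs. -/
def Bal {s t : WebState n} (f : s.A →ₗ[ℚ] t.A) : Prop := ∀ j, PolySlides f (s.P j) (t.P j)

section

variable {s} {t : WebState n} {f : s.A →ₗ[ℚ] t.A}

/-- Moving the coefficients through `f` turns the condition required by `extend_apply` into the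
vanishing of `N'` at `b`. -/
theorem PolySlides.sum_eq {S T : Type} [CommRing S] [CommRing T]
    [Algebra ℚ S] [Algebra ℚ T] {f : S →ₗ[ℚ] T} {N : S[X]} {N' : T[X]} (h : PolySlides f N N')
    {B : Type} [CommRing B] (g : T →+* B) (b : B) (z : S) :
    (N.sum fun k c => g (f (c * z)) * b ^ k) = N'.eval₂ g b * g (f z) := by
  rw [sum_over_range' N (by simp) (max N.natDegree N'.natDegree + 1) (by omega),
    eval₂_eq_sum_range' g (n := max N.natDegree N'.natDegree + 1) (by omega), Finset.sum_mul]
  refine Finset.sum_congr rfl fun k _ => ?_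
  rw [h k, map_mul]
  ring

/-- The new variable of `t` is a root of the polynomial of its alphabet, and `f` carries the
coefficients of the polynomial of `s` to those of `t`. This is the point where `Bal` is
indispensable. -/
theorem whisker_apply (hf : Bal f) (c : s.A) (m : ℕ) :
    whisker l f (s.incl l c * s.var l ^ m) = t.incl l (f c) * t.var l ^ m := by
  refine s.extend_apply l ((t.incl l).toLinearMap ∘ₗ f) (t.var l) (fun z => ?_) c m
  have := PolySlides.sum_eq (hf (loses l)) (t.incl l).toRingHom (t.var l) z
  rw [← Polynomial.eval_map, eval_var, zero_mul] at this
  exact this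

theorem whisker_incl (hf : Bal f) (c : s.A) : whisker l f (s.incl l c) = t.incl l (f c) := by
  simpa using whisker_apply l hf c 0

theorem whisker_one (hf : Bal f) (h : f 1 = 1) : whisker l f 1 = 1 := by
  rw [← map_one (s.incl l), whisker_incl l hf, h, map_one]

theorem whisker_slides_var (hf : Bal f) : Slides (whisker l f) (s.var l) (t.var l) :=
  slides_var (φ := (t.incl l).toLinearMap ∘ₗ f) (whisker_apply l hf)

theorem whisker_slides_incl (hf : Bal f) {a : s.A} {a' : t.A} (h : Slides f a a') :
    Slides (whisker l f) (s.incl l a) (t.incl l a') := by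
  refine slides_incl (φ := (t.incl l).toLinearMap ∘ₗ f) (whisker_apply l hf) fun z => ?_
  change t.incl l (f (a * z)) = t.incl l a' * t.incl l (f z)
  rw [h, map_mul]

/-- The alphabets after a step arise from the old ones by dividing or multiplying by `X - x`, with
`x` the new variable, and both operations preserve `PolySlides`. -/
theorem Bal.step {F : (s.step l).A →ₗ[ℚ] (t.step l).A} (hv : Slides F (s.var l) (t.var l))
    (hi : ∀ j k, Slides F (s.incl l ((s.P j).coeff k)) (t.incl l ((t.P j).coeff k))) : Bal F := by
  have hm : ∀ j, PolySlides F ((s.P j).map (s.incl l).toRingHom)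
      ((t.P j).map (t.incl l).toRingHom) := fun j k => by
    rw [coeff_map, coeff_map]
    exact hi j k
  intro j
  by_cases h1 : j = loses l
  · subst h1
    rw [P_loses_eq, P_loses_eq]
    exact (hm _).div_X_sub_C hv
  by_cases h2 : j = gains l
  · subst h2
    rw [P_gains, P_gains]
    exact (hm _).mul_X_sub_C hv
  rw [P_of_ne _ _ h1 h2, P_of_ne _ _ h1 h2]
  exact hm j

theorem Bal.whisker (hf : Bal f) : Bal (whisker l f) :=
  Bal.step l (whisker_slides_var l hf) fun j k => whisker_slides_incl l hf (hf j k)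

theorem Bal.comp {u : WebState n} {g : t.A →ₗ[ℚ] u.A} (hf : Bal f) (hg : Bal g) :
    Bal (g ∘ₗ f) := fun j k => (hf j k).comp (hg j k)

end

end

end WebState

/-! ### Cancellation of monic factors -/

section Slides

variable {S T : Type} [CommRing S] [CommRing T] [Algebra ℚ S] [Algebra ℚ T]

/-- A monic factor can be divided off over `slideRing F`. This makes it possible to compare
alphabets after clearing all the factors that were divided out. -/
theorem PolySlides.cancel {F : S →ₗ[ℚ] T} {N : S[X]} {N' : T[X]} (D : (slideRing F)[X])
    (hD : D.Monic) (h : PolySlides F (N * D.map ((RingHom.fst S T).comp (slideRing F).subtype))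
      (N' * D.map ((RingHom.snd S T).comp (slideRing F).subtype))) : PolySlides F N N' := by
  obtain ⟨Q, h1, h2⟩ := h.exists_lift
  have e1 := Polynomial.map_divByMonic ((RingHom.fst S T).comp (slideRing F).subtype) (p := Q) hD
  have e2 := Polynomial.map_divByMonic ((RingHom.snd S T).comp (slideRing F).subtype) (p := Q) hD
  rw [h1, mul_comm, mul_divByMonic_cancel_left _ (hD.map _)] at e1
  rw [h2, mul_comm, mul_divByMonic_cancel_left _ (hD.map _)] at e2
  rw [← e1, ← e2]
  exact of_lift _

theorem PolySlides.cancel_X_sub_C {F : S →ₗ[ℚ] T} {N : S[X]} {N' : T[X]} {a : S} {a' : T}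
    (ha : Slides F a a') (h : PolySlides F (N * (X - C a)) (N' * (X - C a'))) :
    PolySlides F N N' := by
  refine PolySlides.cancel (X - C ⟨(a, a'), ha⟩) (monic_X_sub_C _) ?_
  rw [Polynomial.map_sub, Polynomial.map_sub, map_X, map_X, map_C, map_C]
  exact h

theorem PolySlides.one (F : S →ₗ[ℚ] T) : PolySlides F 1 1 := fun k => by
  rw [coeff_one, coeff_one]
  split_ifs
  exacts [.one F, .zero F]

end Slides

namespace WebState

open SLetter
open SC (lo hi)

noncomputable section

variable {n : ℕ} (s : WebState n)

/-- The identity of the alphabets before and after a step, without division. -/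
theorem P_step_mul (l : SLetter n) (j : Fin n) :
    (s.step l).P j * (if j = loses l then X - C (s.var l) else 1) =
      (s.P j).map (s.incl l).toRingHom * (if j = gains l then X - C (s.var l) else 1) := by
  by_cases h1 : j = loses l
  · subst h1
    rw [if_pos rfl, if_neg (loses_ne_gains l), mul_one, P_loses_mul]
  by_cases h2 : j = gains l
  · subst h2
    rw [if_neg h1, if_pos rfl, mul_one, P_gains]
  rw [if_neg h1, if_neg h2, P_of_ne _ _ h1 h2]

/-! ### Cups and caps -/

section

variable {l m : SLetter n} (h1 : loses m = gains l) (h2 : gains m = loses l)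

theorem incl_slides (c : s.A) : Slides (s.incl l).toLinearMap c (s.incl l c) := fun z => by simp

-- Multiplication by `κ` makes the two new variables equal by `hκ`. One of the two alphabets
-- involved loses the first variable and gains the second, the other does the opposite, so after
-- multiplication by `κ` both are the alphabets of `s` again.
include h1 h2 in
theorem bal_cup {κ : ((s.step l).step m).A}
    (hκ : κ * (s.step l).incl m (s.var l) = κ * (s.step l).var m) :
    Bal (LinearMap.mulRight ℚ κ ∘ₗ ((s.step l).incl m).toLinearMap ∘ₗ (s.incl l).toLinearMap) := by
  have G_refl : ∀ c, Slides (LinearMap.mulRight ℚ κ) c c := fun c z => by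
    simp [mul_assoc]
  have G_var : Slides (LinearMap.mulRight ℚ κ) ((s.step l).incl m (s.var l))
      ((s.step l).var m) := fun z => by
    simp only [LinearMap.mulRight_apply]
    linear_combination z * hκ
  suffices h : ∀ j, PolySlides (LinearMap.mulRight ℚ κ)
      (((s.P j).map (s.incl l).toRingHom).map ((s.step l).incl m).toRingHom)
      (((s.step l).step m).P j) by
    intro j k
    have h' := h j k
    rw [coeff_map, coeff_map] at h'
    exact ((s.incl_slides (l := l) _).comp ((s.step l).incl_slides _)).comp h'
  intro j
  by_cases e1 : j = loses l
  · subst e1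
    rw [← P_loses_mul, ← h2, P_gains, Polynomial.map_mul, Polynomial.map_sub, map_X, map_C]
    exact PolySlides.mul_X_sub_C (fun k => G_refl _) G_var
  by_cases e2 : j = gains l
  · subst e2
    refine PolySlides.cancel_X_sub_C G_var ?_
    have e3 := P_gains s l
    have e4 := P_loses_mul (s.step l) m
    rw [h1, e3] at e4
    rw [e4, Polynomial.map_mul, Polynomial.map_sub, map_X, map_C]
    exact fun k => G_refl _
  rw [P_of_ne _ _ (h1 ▸ e2) (h2 ▸ e1), P_of_ne _ _ e1 e2]
  exact fun k => G_refl _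

/-- Substitution of `x` is compatible with reduction modulo the polynomial of the alphabet because
`x` is one of its roots. -/
theorem subst_apply {x : s.A} (hx : (s.P (loses l)).eval x = 0) (c : s.A) (k : ℕ) :
    s.subst l x (s.incl l c * s.var l ^ k) = c * x ^ k := by
  refine s.extend_apply l LinearMap.id x (fun z => ?_) c k
  have h := eval_eq_sum (p := s.P (loses l)) (x := x)
  rw [hx] at h
  simp only [LinearMap.id_apply]
  have : ((s.P (loses l)).sum fun k c => c * z * x ^ k) =
      z * (s.P (loses l)).sum fun k c => c * x ^ k := by
    rw [Polynomial.sum, Polynomial.sum, Finset.mul_sum]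
    exact Finset.sum_congr rfl fun k _ => by ring
  rw [this, ← h, mul_zero]

theorem subst_slides_incl {x : s.A} (hx : (s.P (loses l)).eval x = 0) (c : s.A) :
    Slides (s.subst l x) (s.incl l c) c :=
  slides_incl (φ := LinearMap.id) (s.subst_apply hx) fun _ => rfl

theorem subst_slides_var {x : s.A} (hx : (s.P (loses l)).eval x = 0) :
    Slides (s.subst l x) (s.var l) x :=
  slides_var (φ := LinearMap.id) (s.subst_apply hx)

theorem subst_one {x : s.A} (hx : (s.P (loses l)).eval x = 0) : s.subst l x 1 = 1 := by
  simpa using s.subst_apply hx 1 0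

theorem coeff_slides (k : ℕ) (c : s.A) : Slides (s.coeff l k) (s.incl l c) c := by
  intro z
  obtain ⟨f, rfl⟩ := s.ofPoly_surjective l z
  have : s.incl l c * s.ofPoly l f = s.ofPoly l (c • f) := by
    rw [ofPoly, ofPoly, smul_eq_C_mul, map_mul]
    rfl
  rw [this, coeff_ofPoly, coeff_ofPoly, smul_modByMonic, Polynomial.coeff_smul, smul_eq_mul]

-- A variable is a root of the polynomial of the alphabet that has just gained it; hence a cap may
-- substitute it for the variable of the next strand.
include h1 in
theorem eval_gained : ((s.step l).P (loses m)).eval (s.var l) = 0 := by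
  rw [h1, P_gains]
  simp

include h1 in
theorem cap_slides (c : s.A) : Slides (s.trace l ∘ₗ (s.step l).subst m (s.var l))
    ((s.step l).incl m (s.incl l c)) c :=
  ((s.step l).subst_slides_incl (s.eval_gained h1) _).comp (s.coeff_slides _ c)

-- After the substitution the variable that is moved back is the one that was moved before, so the
-- alphabets are those of `s`. Their coefficients lie in the ring of `s`, over which the trace is
-- linear.
include h1 h2 in
theorem bal_cap : Bal (s.trace l ∘ₗ (s.step l).subst m (s.var l)) := by
  have hv := (s.step l).subst_slides_var (s.eval_gained h1)
  suffices h : ∀ j, PolySlides ((s.step l).subst m (s.var l)) (((s.step l).step m).P j)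
      ((s.P j).map (s.incl l).toRingHom) by
    intro j k
    have h' := h j k
    rw [coeff_map] at h'
    exact h'.comp (s.coeff_slides _ _)
  have hm : ∀ j, PolySlides ((s.step l).subst m (s.var l))
      (((s.step l).P j).map ((s.step l).incl m).toRingHom) ((s.step l).P j) := fun j k => by
    rw [coeff_map]
    exact (s.step l).subst_slides_incl (s.eval_gained h1) _
  intro j
  by_cases e1 : j = loses l
  · subst e1
    have := (hm (loses l)).mul_X_sub_C hv
    rw [P_loses_mul] at this
    rwa [← h2, P_gains, h2]
  by_cases e2 : j = gains l
  · subst e2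
    refine PolySlides.cancel_X_sub_C hv ?_
    have e3 := P_gains s l
    have e4 := P_loses_mul (s.step l) m
    have e5 := hm (gains l)
    rw [h1] at e4
    rw [e4, ← e3]
    exact e5
  have e5 := hm j
  rw [P_of_ne _ _ e1 e2] at e5
  rw [P_of_ne _ _ (h1 ▸ e2) (h2 ▸ e1), P_of_ne _ _ e1 e2]
  exact e5

end

/-- With `u` the variable of `ℰ_{+i}` and `w` that of `ℰ_{-i}`, the multiplier is the remaining
polynomial at `u`. Evaluating (remaining polynomial) `* (X - w)` at the root `u` shows that the
multiplier kills `u - w`. -/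
theorem bal_cupDU (i : Fin (n - 1)) : Bal (s.cupDU i) := by
  refine s.bal_cup (l := up i) (m := dn i) rfl rfl ?_
  have h := congrArg (eval ((s.step (up i)).incl (dn i) (s.var (up i))))
    (P_loses_mul (s.step (up i)) (dn i))
  have h' : ((s.step (up i)).P (loses (dn i))).eval (s.var (up i)) = 0 := s.eval_gained rfl
  have h3 : (((s.step (up i)).P (loses (dn i))).map ((s.step (up i)).incl (dn i)).toRingHom).eval
      ((s.step (up i)).incl (dn i) (s.var (up i))) = 0 :=
    (eval_map_apply ((s.step (up i)).incl (dn i)).toRingHom (s.var (up i))).trans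
      ((congrArg _ h').trans (map_zero _))
  rw [eval_mul, h3, eval_sub, eval_X, eval_C] at h
  have h'' : eval ((s.step (up i)).incl (dn i) (s.var (up i)))
    (((s.step (up i)).step (dn i)).P (lo i)) * ((s.step (up i)).incl (dn i) (s.var (up i)) -
      (s.step (up i)).var (dn i)) = 0 := h
  linear_combination h''

/-- The variable of `ℰ_{+i}` is a root of the old polynomial times `X - x`, with `x` the variable of
`ℰ_{-i}`. So the value of the old polynomial at it, which is the multiplier up to sign, kills the
difference of the two variables. -/
theorem bal_cupUD (i : Fin (n - 1)) : Bal (s.cupUD i) := by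
  refine s.bal_cup (l := dn i) (m := up i) rfl rfl ?_
  have h := (s.step (dn i)).eval_var (up i)
  rw [show loses (up i) = gains (dn i) from rfl, P_gains, Polynomial.map_mul, eval_mul,
    Polynomial.map_sub, map_X, map_C, eval_sub, eval_X, eval_C, Polynomial.map_map] at h
  have h' : ((s.P (hi i)).map (((s.step (dn i)).incl (up i)).comp (s.incl (dn i))).toRingHom).eval
      ((s.step (dn i)).var (up i)) * ((s.step (dn i)).var (up i) -
        (s.step (dn i)).incl (up i) (s.var (dn i))) = 0 := h
  linear_combination (-(-1) ^ (s.P (hi i)).natDegree) * h'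

theorem bal_capUD (i : Fin (n - 1)) : Bal (s.capUD i) :=
  s.bal_cap (l := dn i) (m := up i) rfl rfl

theorem bal_capDU (i : Fin (n - 1)) : Bal (s.capDU i) := by
  intro j k z
  rw [capDU, LinearMap.smul_apply, LinearMap.smul_apply,
    s.bal_cap (l := up i) (m := dn i) rfl rfl j k z, mul_smul_comm]

/-! ### Crossings -/

theorem cross_apply (l m : SLetter n) (g : ℕ → ℕ → ((s.step l).step m).A)
    (z : ((s.step m).step l).A) :
    s.cross l m g z = ∑ k ∈ Finset.range ((s.step m).size l), ∑ k' ∈ Finset.range (s.size m),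
      (s.step l).incl m (s.incl l (s.coeff m k' ((s.step m).coeff l k z))) * g k k' := by
  rw [cross, LinearMap.sum_apply]
  refine Finset.sum_congr rfl fun k _ => ?_
  rw [LinearMap.sum_apply]
  rfl

/-- A crossing is given by a formula on the monomials of the normal form. Any map with the right
values on monomials is therefore equal to it, which permits replacing the formula by a construction
with visible linearity. -/
theorem cross_eq {l m : SLetter n} {g : ℕ → ℕ → ((s.step l).step m).A}
    {G : ((s.step m).step l).A →ₗ[ℚ] ((s.step l).step m).A}
    (h : ∀ c k k', G ((s.step m).incl l (s.incl m c * s.var m ^ k') * (s.step m).var l ^ k) =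
      (s.step l).incl m (s.incl l c) * g k k') : s.cross l m g = G := by
  ext z
  rw [cross_apply]
  conv_rhs => rw [(s.step m).eq_sum_coeff l z, map_sum]
  refine Finset.sum_congr rfl fun k _ => ?_
  conv_rhs => rw [s.eq_sum_coeff m ((s.step m).coeff l k z), map_sum, Finset.sum_mul, map_sum]
  exact Finset.sum_congr rfl fun k' _ => (h _ k k').symm

/-- `F` is a crossing of letters with different colors: it relabels the variables and multiplies by
`e`. -/
structure IsRelabel (l m : SLetter n) (e : ((s.step l).step m).A)
    (F : ((s.step m).step l).A →ₗ[ℚ] ((s.step l).step m).A) : Prop where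
  map_one : F 1 = e
  base (c : s.A) : Slides F ((s.step m).incl l (s.incl m c)) ((s.step l).incl m (s.incl l c))
  left : Slides F ((s.step m).var l) ((s.step l).incl m (s.var l))
  right : Slides F ((s.step m).incl l (s.var m)) ((s.step l).var m)

/-- In the source the variable of `m` is a root of `P (loses m)`. In the target it is adjoined after
`l`, when that alphabet may have gained the variable of `l`, so it need not be a root of the old
polynomial; the factor `e` has to kill the defect. The map is then built by extending twice, once
for each variable. -/
theorem isRelabel_cross {l m : SLetter n} (hlm : loses l ≠ loses m) (e : ((s.step l).step m).A)
    (he : (((s.P (loses m)).map (s.incl l).toRingHom).map ((s.step l).incl m).toRingHom).eval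
      ((s.step l).var m) * e = 0) :
    s.IsRelabel l m e (s.cross l m fun k k' =>
      e * ((s.step l).var m ^ k' * (s.step l).incl m (s.var l) ^ k)) := by
  let ι : s.A →+* ((s.step l).step m).A := ((s.step l).incl m).toRingHom.comp (s.incl l).toRingHom
  let φ₀ : s.A →ₗ[ℚ] ((s.step l).step m).A :=
    LinearMap.mulRight ℚ e ∘ₗ ((s.step l).incl m).toLinearMap ∘ₗ (s.incl l).toLinearMap
  have hφ₀ : ∀ c, Slides φ₀ c (ι c) := fun c z => by
    change (s.step l).incl m (s.incl l (c * z)) * e = (s.step l).incl m (s.incl l c) *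
      ((s.step l).incl m (s.incl l z) * e)
    rw [map_mul, map_mul, mul_assoc]
  have hφ₀' : ∀ c, φ₀ c = ι c * e := fun c => rfl
  let φ₁ := s.extend m φ₀ ((s.step l).var m)
  have h1 : ∀ c k, φ₁ (s.incl m c * s.var m ^ k) = φ₀ c * (s.step l).var m ^ k := by
    refine s.extend_apply m φ₀ _ fun z => ?_
    have := WebState.PolySlides.sum_eq (f := φ₀) (N := s.P (loses m))
      (N' := (s.P (loses m)).map ι) (fun k => by rw [coeff_map]; exact hφ₀ _)
      (RingHom.id _) ((s.step l).var m) z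
    simp only [RingHom.id_apply] at this
    rw [this, eval₂_id, hφ₀', ← Polynomial.map_map]
    linear_combination ι z * he
  have s1 : ∀ c, Slides φ₁ (s.incl m c) (ι c) := fun c => slides_incl h1 (hφ₀ c)
  have s2 : Slides φ₁ (s.var m) ((s.step l).var m) := slides_var h1
  let φ₂ := (s.step m).extend l φ₁ ((s.step l).incl m (s.var l))
  have h2 : ∀ c k, φ₂ ((s.step m).incl l c * (s.step m).var l ^ k) =
      φ₁ c * (s.step l).incl m (s.var l) ^ k := by
    refine (s.step m).extend_apply l φ₁ _ fun z => ?_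
    have hz : ((s.P (loses l)).map ι).eval ((s.step l).incl m (s.var l)) = 0 := by
      rw [← Polynomial.map_map]
      exact (eval_map_apply ((s.step l).incl m).toRingHom (s.var l)).trans
        ((congrArg _ (s.eval_var l)).trans (map_zero _))
    -- In the source the alphabet of the variable of `l` may have gained the variable of `m`. The
    -- extra factor is harmless, since the old polynomial already vanishes at the variable of `l` in
    -- the target.
    have hP : PolySlides φ₁ ((s.step m).P (loses l)) ((s.P (loses l)).map ι *
        if loses l = gains m then X - C ((s.step l).var m) else 1) := by
      have hb : PolySlides φ₁ ((s.P (loses l)).map (s.incl m).toRingHom)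
        ((s.P (loses l)).map ι) := fun k => by rw [coeff_map, coeff_map]; exact s1 _
      have := s.P_step_mul m (loses l)
      rw [if_neg hlm, mul_one] at this
      rw [this]
      split_ifs
      · exact hb.mul_X_sub_C s2
      · exact hb.mul (PolySlides.one _)
    have := WebState.PolySlides.sum_eq hP (RingHom.id _) ((s.step l).incl m (s.var l)) z
    simp only [RingHom.id_apply] at this
    rw [this, eval₂_id, eval_mul, hz, zero_mul, zero_mul]
  have hcross : (s.cross l m fun k k' =>
      e * ((s.step l).var m ^ k' * (s.step l).incl m (s.var l) ^ k)) = φ₂ := by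
    refine s.cross_eq fun c k k' => ?_
    rw [h2, h1, hφ₀']
    change ι c * e * _ * _ = ι c * _
    ring
  rw [hcross]
  refine ⟨?_, fun c => slides_incl h2 (s1 c), slides_var h2, slides_incl h2 s2⟩
  have := h2 1 0
  rw [map_one, one_mul, pow_zero, pow_zero, mul_one] at this
  rw [this]
  have := h1 1 0
  rw [map_one, one_mul, pow_zero, pow_zero, mul_one] at this
  rw [this, hφ₀', map_one, one_mul]

-- By `P_step_mul`, after multiplication by the factors of the lost variables, both sides become the
-- old polynomial times the factors of the gained variables, in either order of the two steps. All
-- these factors correspond under `F`, and the lost ones are monic, hence cancel.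
variable {s} in
theorem IsRelabel.bal {l m : SLetter n} {e : ((s.step l).step m).A}
    {F : ((s.step m).step l).A →ₗ[ℚ] ((s.step l).step m).A} (h : s.IsRelabel l m e F) : Bal F := by
  intro j
  have hX : ∀ (p : Prop) [Decidable p] {a : ((s.step m).step l).A} {a' : ((s.step l).step m).A}
      {N N'}, Slides F a a' →
      PolySlides F (N * if p then X - C a else 1) (N' * if p then X - C a' else 1) →
        PolySlides F N N' := by
    intro p _ a a' N N' ha hN
    split_ifs at hN
    · exact PolySlides.cancel_X_sub_C ha hN
    · rwa [mul_one, mul_one] at hN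
  have hX' : ∀ (p : Prop) [Decidable p] {a : ((s.step m).step l).A} {a' : ((s.step l).step m).A}
      {N N'}, Slides F a a' → PolySlides F N N' →
      PolySlides F (N * if p then X - C a else 1) (N' * if p then X - C a' else 1) := by
    intro p _ a a' N N' ha hN
    split_ifs
    · exact hN.mul_X_sub_C ha
    · rwa [mul_one, mul_one]
  have hb : PolySlides F (((s.P j).map (s.incl m).toRingHom).map ((s.step m).incl l).toRingHom)
      (((s.P j).map (s.incl l).toRingHom).map ((s.step l).incl m).toRingHom) := fun k => by
    rw [coeff_map, coeff_map, coeff_map, coeff_map]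
    exact h.base _
  refine hX (j = loses m) h.right (hX (j = loses l) h.left ?_)
  have key := hX' (j = gains l) h.left (hX' (j = gains m) h.right hb)
  have e1 := (s.step m).P_step_mul l j
  have e2 := congrArg (Polynomial.map ((s.step m).incl l).toRingHom) (s.P_step_mul m j)
  have e3 := (s.step l).P_step_mul m j
  have e4 := congrArg (Polynomial.map ((s.step l).incl m).toRingHom) (s.P_step_mul l j)
  rw [Polynomial.map_mul, Polynomial.map_mul] at e2 e4
  simp only [apply_ite (Polynomial.map _), Polynomial.map_sub, map_X, map_C,
    Polynomial.map_one] at e2 e4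
  convert key using 1
  · rw [mul_right_comm, e1, mul_right_comm]
    exact congrArg (· * _) e2
  · rw [e3, mul_right_comm]
    refine (congrArg (· * if j = gains m then X - C ((s.step l).var m) else 1) e4).trans ?_
    exact mul_right_comm _ _ _

/-- If `i = j + 1`, then `hi j = lo i`: the variable of `ℰ_{+j}` is taken from the alphabet that has
just gained the variable of `ℰ_{+i}`, and the difference of the two variables is exactly the factor
missing for a root of the old polynomial. In all other cases no such coincidence occurs. -/
theorem isRelabel_crossUp {i j : Fin (n - 1)} (hij : i ≠ j) : s.IsRelabel (up i) (up j)
    (if i.1 = j.1 + 1 then (s.step (up i)).incl (up j) (s.var (up i)) - (s.step (up i)).var (up j)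
      else 1) (s.crossUp i j) := by
  have hl : loses (up i) ≠ loses (up j) := by
    simpa [loses, hi, Fin.ext_iff] using hij
  convert s.isRelabel_cross hl (if i.1 = j.1 + 1 then
    (s.step (up i)).incl (up j) (s.var (up i)) - (s.step (up i)).var (up j) else 1) ?_ using 1
  · rw [crossUp]
    congr 1
    funext k k'
    rw [if_neg hij]
    split_ifs
    · rfl
    · rw [one_mul]
  · have h := (s.step (up i)).eval_var (up j)
    split_ifs with h'
    · have e : loses (up j) = gains (up i) := by simp [loses, gains, lo, hi, h']
      rw [e, P_gains, Polynomial.map_mul, eval_mul, Polynomial.map_sub, map_X, map_C, eval_sub,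
        eval_X, eval_C] at h
      rw [e]
      have h'' : (((s.P (gains (up i))).map (s.incl (up i)).toRingHom).map
        ((s.step (up i)).incl (up j)).toRingHom).eval ((s.step (up i)).var (up j)) *
        ((s.step (up i)).var (up j) - (s.step (up i)).incl (up j) (s.var (up i))) = 0 := h
      linear_combination -h''
    · have e : loses (up j) ≠ gains (up i) := by
        simp only [loses, gains, lo, hi, ne_eq, Fin.mk.injEq]; omega
      rw [P_of_ne _ _ hl.symm e] at h
      rw [h, zero_mul]

/-- For downward strands the alphabet that loses the second variable has gained the first one
exactly if `lo j = hi i`, that is `j = i + 1`. -/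
theorem isRelabel_crossDn {i j : Fin (n - 1)} (hij : i ≠ j) : s.IsRelabel (dn i) (dn j)
    (if j.1 = i.1 + 1 then (s.step (dn i)).var (dn j) - (s.step (dn i)).incl (dn j) (s.var (dn i))
      else 1) (s.crossDn i j) := by
  have hl : loses (dn i) ≠ loses (dn j) := by
    simpa [loses, lo, Fin.ext_iff] using hij
  convert s.isRelabel_cross hl (if j.1 = i.1 + 1 then
    (s.step (dn i)).var (dn j) - (s.step (dn i)).incl (dn j) (s.var (dn i)) else 1) ?_ using 1
  · rw [crossDn]
    congr 1
    funext k k'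
    rw [if_neg hij]
    split_ifs
    · rfl
    · rw [one_mul]
  · have h := (s.step (dn i)).eval_var (dn j)
    split_ifs with h'
    · have e : loses (dn j) = gains (dn i) := by simp [loses, gains, lo, hi, h']
      rw [e, P_gains, Polynomial.map_mul, eval_mul, Polynomial.map_sub, map_X, map_C, eval_sub,
        eval_X, eval_C] at h
      rw [e]
      exact h
    · have e : loses (dn j) ≠ gains (dn i) := by
        simp only [loses, gains, lo, hi, ne_eq, Fin.mk.injEq]; omega
      rw [P_of_ne _ _ hl.symm e] at h
      rw [h, zero_mul]

end

end WebState

namespace WebState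

open SLetter
open SC (lo hi)

noncomputable section

variable {n : ℕ} (s : WebState n)

/-! ### Crossings of equal color -/

section DivDiff

variable {B : Type} [CommRing B] (x y : B)

theorem divDiff_succ_left (k k' : ℕ) :
    divDiff x y (k + 1) k' = x ^ k * y ^ k' + y * divDiff x y k k' := by
  have h : ∑ a ∈ Finset.range k, x ^ a * y ^ (k + 1 - 1 - a) =
      y * ∑ a ∈ Finset.range k, x ^ a * y ^ (k - 1 - a) := by
    rw [Finset.mul_sum]
    refine Finset.sum_congr rfl fun a ha => ?_
    have := Finset.mem_range.1 ha
    rw [show k + 1 - 1 - a = (k - 1 - a) + 1 by omega]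
    ring
  rw [divDiff, divDiff, Finset.sum_range_succ, h]
  simp only [Nat.add_sub_cancel, Nat.sub_self]
  ring

theorem divDiff_zero_succ (k' : ℕ) :
    divDiff x y 0 (k' + 1) = x * divDiff x y 0 k' - y ^ k' := by
  have h : ∑ a ∈ Finset.range k', x ^ (a + 1) * y ^ (k' + 1 - 1 - (a + 1)) =
      x * ∑ a ∈ Finset.range k', x ^ a * y ^ (k' - 1 - a) := by
    rw [Finset.mul_sum]
    refine Finset.sum_congr rfl fun a ha => ?_
    rw [show k' + 1 - 1 - (a + 1) = k' - 1 - a by omega]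
    ring
  rw [divDiff, divDiff, Finset.sum_range_succ', h]
  simp only [Nat.add_sub_cancel]
  simp
  ring

/-- In `B[ω]/((ω - x) (ω - y))` the divided difference is the coefficient of `ω`. -/
theorem omega_pow_mul (k k' : ℕ) :
    ((⟨0, 1⟩ : QuadraticAlgebra B (-(x * y)) (x + y)) ^ k * ⟨x + y, -1⟩ ^ k') =
      ⟨x ^ k * y ^ k' - x * divDiff x y k k', divDiff x y k k'⟩ := by
  induction k with
  | zero =>
    induction k' with
    | zero => ext <;> simp [divDiff, QuadraticAlgebra.re_one, QuadraticAlgebra.im_one]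
    | succ k' ih =>
      rw [pow_succ, ← mul_assoc, ih, divDiff_zero_succ]
      ext <;> simp <;> ring
  | succ k ih =>
    rw [pow_succ, mul_right_comm, ih, divDiff_succ_left]
    ext <;> simp <;> ring

theorem omega_add : (⟨0, 1⟩ + ⟨x + y, -1⟩ : QuadraticAlgebra B (-(x * y)) (x + y)) =
    algebraMap B _ (x + y) :=
  QuadraticAlgebra.ext (zero_add _) (add_neg_cancel _)

theorem omega_mul : (⟨0, 1⟩ * ⟨x + y, -1⟩ : QuadraticAlgebra B (-(x * y)) (x + y)) =
    algebraMap B _ (x * y) := by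
  refine QuadraticAlgebra.ext ?_ ?_
  · rw [QuadraticAlgebra.re_mul]
    change _ = x * y
    ring
  · rw [QuadraticAlgebra.im_mul]
    change _ = (0 : B)
    ring

theorem monic_quadratic (p q : B) : (X ^ 2 - C p * X + C q).Monic := by
  rw [sub_eq_add_neg, add_assoc, ← neg_mul, ← C_neg]
  exact monic_X_pow_add degree_linear_lt

end DivDiff

/-- `F` is (up to the sign `ε`) the divided difference in the variables of two equal letters. -/
structure IsDivDiff (l : SLetter n) (ε : ℚ)
    (F : ((s.step l).step l).A →ₗ[ℚ] ((s.step l).step l).A) : Prop where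
  map_one : F 1 = 0
  left : F ((s.step l).var l) = algebraMap ℚ _ ε
  right : F ((s.step l).incl l (s.var l)) = - algebraMap ℚ _ ε
  base (c : s.A) : Slides F ((s.step l).incl l (s.incl l c)) ((s.step l).incl l (s.incl l c))
  add : Slides F ((s.step l).var l + (s.step l).incl l (s.var l))
    ((s.step l).var l + (s.step l).incl l (s.var l))
  mul : Slides F ((s.step l).var l * (s.step l).incl l (s.var l))
    ((s.step l).var l * (s.step l).incl l (s.var l))

/-- Let `B` be the ring after both steps. A ring homomorphism `θ` to `B[ω]/((ω - x)(ω - y))` sends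
`x` to `ω` and `y` to the other root `x + y - ω`, and the crossing is `θ` followed by the
coefficient of `ω` (`omega_pow_mul`). Since `θ` fixes the base and the symmetric functions of `x`
and `y`, linearity over these is immediate. -/
theorem isDivDiff_cross (l : SLetter n) : s.IsDivDiff l 1
    (s.cross l l (divDiff ((s.step l).var l) ((s.step l).incl l (s.var l)))) := by
  set x := (s.step l).var l with hx
  set y := (s.step l).incl l (s.var l) with hy
  let Q := QuadraticAlgebra ((s.step l).step l).A (-(x * y)) (x + y)
  let ω : Q := ⟨0, 1⟩
  let ω' : Q := ⟨x + y, -1⟩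
  let α : ((s.step l).step l).A →+* Q := algebraMap _ _
  let ι : s.A →+* ((s.step l).step l).A := ((s.step l).incl l).toRingHom.comp (s.incl l).toRingHom
  have α_re : ∀ c, (α c).re = c := fun c => rfl
  have α_im : ∀ c, (α c).im = 0 := fun c => rfl
  have e1 : ω + ω' = α (x + y) := omega_add x y
  have e2 : ω * ω' = α (x * y) := omega_mul x y
  have hP2 : (s.P (loses l)).map ι =
      ((s.step l).step l).P (loses l) * (X - C x) * (X - C y) := by
    have h1 := P_loses_mul (s.step l) l
    have h2 := congrArg (Polynomial.map ((s.step l).incl l).toRingHom) (P_loses_mul s l)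
    rw [Polynomial.map_mul, ← h1, Polynomial.map_sub, map_X, map_C, Polynomial.map_map] at h2
    exact h2.symm
  -- Both products have the same sum and product of roots, so a polynomial divisible by the left one
  -- also vanishes at `ω` and `ω'`; this is why `θ` exists.
  have hquad : (X - C (α x)) * (X - C (α y)) = (X - C ω) * (X - C ω') := by
    have f1 : (X - C (α x)) * (X - C (α y)) = X ^ 2 - C (α (x + y)) * X + C (α (x * y)) := by
      simp only [map_add, map_mul]; ring
    have f2 : (X - C ω) * (X - C ω') = X ^ 2 - C (ω + ω') * X + C (ω * ω') := by
      simp only [map_add, map_mul]; ring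
    rw [f1, f2, e1, e2]
  have hPQ : (s.P (loses l)).map (α.comp ι) =
      (((s.step l).step l).P (loses l)).map α * (X - C ω) * (X - C ω') := by
    rw [← Polynomial.map_map, hP2, Polynomial.map_mul, Polynomial.map_mul, Polynomial.map_sub,
      Polynomial.map_sub, map_X, map_C, map_C, mul_assoc, hquad, mul_assoc]
  have h1 : (s.P (loses l)).eval₂ (α.comp ι) ω' = 0 := by
    rw [← Polynomial.eval_map, hPQ]
    simp
  let θ₁ := s.stepLift l (α.comp ι) ω' h1
  -- After `y ↦ ω'` the monic factor `X - ω'` is cancelled, and the remaining polynomial still has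
  -- the factor `X - ω`.
  have h2 : ((s.step l).P (loses l)).eval₂ θ₁ ω = 0 := by
    have h3 := congrArg (Polynomial.map θ₁) (P_loses_mul s l)
    have h4 : θ₁.comp (s.incl l).toRingHom = α.comp ι :=
      RingHom.ext fun c => s.stepLift_incl l _ _ h1 c
    rw [Polynomial.map_mul, Polynomial.map_map, h4, hPQ, Polynomial.map_sub, map_X, map_C,
      show θ₁ (s.var l) = ω' from s.stepLift_var l _ _ h1] at h3
    have h5 := (monic_X_sub_C ω').isRegular.right h3
    rw [← Polynomial.eval_map, h5]
    simp
  let θ := (s.step l).stepLift l θ₁ ω h2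
  have θ_base : ∀ c, θ ((s.step l).incl l (s.incl l c)) = α (ι c) := fun c =>
    ((s.step l).stepLift_incl l _ _ h2 _).trans (s.stepLift_incl l _ _ h1 c)
  have θ_x : θ x = ω := (s.step l).stepLift_var l _ _ h2
  have θ_y : θ y = ω' :=
    ((s.step l).stepLift_incl l _ _ h2 _).trans (s.stepLift_var l _ _ h1)
  let D : ((s.step l).step l).A →ₗ[ℚ] ((s.step l).step l).A := AddMonoidHom.toRatLinearMap
    { toFun := fun z => (θ z).im
      map_zero' := by rw [map_zero]; rfl
      map_add' := fun a b => by rw [map_add]; rfl }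
  have D_apply : ∀ z, D z = (θ z).im := fun z => rfl
  have D_slides : ∀ a, θ a = α a → Slides D a a := by
    intro a ha z
    rw [D_apply, D_apply, map_mul, ha, QuadraticAlgebra.im_mul, α_re, α_im]
    ring
  have hD : s.cross l l (divDiff x y) = D := by
    refine s.cross_eq fun c k k' => ?_
    rw [D_apply, map_mul ((s.step l).incl l), map_mul θ, map_mul θ, θ_base, map_pow,
      map_pow θ, map_pow θ, ← hy, ← hx, θ_x, θ_y, mul_assoc, mul_comm (ω' ^ k'),
      omega_pow_mul, QuadraticAlgebra.im_mul, α_re, α_im]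
    change ι c * _ + _ + _ = ι c * _
    ring
  rw [hD]
  refine ⟨?_, ?_, ?_, fun c => D_slides _ (θ_base c), D_slides _ ?_, D_slides _ ?_⟩
  · rw [D_apply, map_one]
    rfl
  · rw [D_apply, ← hx, θ_x, map_one]
  · rw [D_apply, ← hy, θ_y, map_one]
  · rw [map_add, θ_x, θ_y, e1]
  · rw [map_mul, θ_x, θ_y, e2]

theorem isDivDiff_crossUp (i : Fin (n - 1)) : s.IsDivDiff (up i) 1 (s.crossUp i i) := by
  convert s.isDivDiff_cross (up i) using 1
  simp [crossUp]

theorem isDivDiff_crossDn (i : Fin (n - 1)) : s.IsDivDiff (dn i) (-1) (s.crossDn i i) := by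
  have h := s.isDivDiff_cross (dn i)
  have e : s.crossDn i i = -s.cross (dn i) (dn i)
      (divDiff ((s.step (dn i)).var (dn i)) ((s.step (dn i)).incl (dn i) (s.var (dn i)))) := by
    ext z
    rw [crossDn, cross_apply, LinearMap.neg_apply, cross_apply]
    simp
  have hs : ∀ {a}, Slides (s.cross (dn i) (dn i)
      (divDiff ((s.step (dn i)).var (dn i)) ((s.step (dn i)).incl (dn i) (s.var (dn i))))) a a →
      Slides (s.crossDn i i) a a := fun {a} ha z => by
    rw [e, LinearMap.neg_apply, LinearMap.neg_apply, ha, mul_neg]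
  refine ⟨?_, ?_, ?_, fun c => hs (h.base c), hs h.add, hs h.mul⟩
  · rw [e, LinearMap.neg_apply, h.map_one, neg_zero]
  · rw [e, LinearMap.neg_apply, h.left, map_neg]
  · rw [e, LinearMap.neg_apply, h.right, map_neg]

-- The single variables are not intertwined with themselves, but the product `(X - x) (X - y)` has
-- symmetric coefficients. Two equal letters remove this product from one alphabet and add it to
-- another as a whole.
variable {s} in
theorem IsDivDiff.bal {l : SLetter n} {ε : ℚ}
    {F : ((s.step l).step l).A →ₗ[ℚ] ((s.step l).step l).A} (h : s.IsDivDiff l ε F) : Bal F := by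
  intro j
  set x := (s.step l).var l with hx
  set y := (s.step l).incl l (s.var l) with hy
  have hb : PolySlides F (((s.P j).map (s.incl l).toRingHom).map ((s.step l).incl l).toRingHom)
      (((s.P j).map (s.incl l).toRingHom).map ((s.step l).incl l).toRingHom) := fun k => by
    rw [coeff_map, coeff_map]
    exact h.base _
  let D : (slideRing F)[X] := X ^ 2 - C ⟨(x + y, x + y), h.add⟩ * X + C ⟨(x * y, x * y), h.mul⟩
  have hD : D.Monic := monic_quadratic _ _
  have hD1 : D.map ((RingHom.fst _ _).comp (slideRing F).subtype) = (X - C x) * (X - C y) := by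
    simp only [D, Polynomial.map_sub, Polynomial.map_add, Polynomial.map_mul, Polynomial.map_pow,
      map_X, map_C, RingHom.comp_apply, Subring.subtype_apply, RingHom.coe_fst]
    rw [map_add, map_mul]
    ring
  have hD2 : D.map ((RingHom.snd _ _).comp (slideRing F).subtype) = (X - C x) * (X - C y) := by
    simp only [D, Polynomial.map_sub, Polynomial.map_add, Polynomial.map_mul, Polynomial.map_pow,
      map_X, map_C, RingHom.comp_apply, Subring.subtype_apply, RingHom.coe_snd]
    rw [map_add, map_mul]
    ring
  have e1 := (s.step l).P_step_mul l j
  have e2 := congrArg (Polynomial.map ((s.step l).incl l).toRingHom) (s.P_step_mul l j)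
  rw [Polynomial.map_mul, Polynomial.map_mul] at e2
  by_cases h1 : j = loses l
  · subst h1
    simp only [if_pos, if_neg (loses_ne_gains l), mul_one, Polynomial.map_one,
      Polynomial.map_sub, map_X, map_C] at e1 e2
    refine PolySlides.cancel D hD ?_
    rw [hD1, hD2, ← mul_assoc, e1]
    have e3 := e2.symm
    change _ = _ * (X - C y) at e3
    rw [← e3]
    exact hb
  rw [if_neg h1, mul_one] at e1
  rw [if_neg h1, Polynomial.map_one, mul_one] at e2
  rw [e1, e2]
  by_cases h2 : j = gains l
  · rw [if_pos h2, if_pos h2, Polynomial.map_sub, map_X, map_C]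
    have := hb.mul (PolySlides.of_lift D)
    rw [hD1, hD2, mul_comm (X - C x), ← mul_assoc] at this
    exact this
  · rw [if_neg h2, if_neg h2, Polynomial.map_one, mul_one, mul_one]
    exact hb

theorem bal_crossUp (i j : Fin (n - 1)) : Bal (s.crossUp i j) := by
  by_cases h : i = j
  · subst h
    exact (s.isDivDiff_crossUp i).bal
  · exact (s.isRelabel_crossUp h).bal

theorem bal_crossDn (i j : Fin (n - 1)) : Bal (s.crossDn i j) := by
  by_cases h : i = j
  · subst h
    exact (s.isDivDiff_crossDn i).bal
  · exact (s.isRelabel_crossDn h).bal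

/-! ### All diagrams -/

theorem bal_mul {t : WebState n} (x : t.A) : Bal (LinearMap.mulRight ℚ x) := fun j k z => by
  simp [mul_assoc]

theorem bal_gen (w : List (SLetter n)) : ∀ g : SGen n, Bal (s.gen w g)
  | .dotUp _ => bal_mul _
  | .dotDn _ => bal_mul _
  | .crossUp i j => bal_crossUp _ i j
  | .crossDn i j => bal_crossDn _ i j
  | .cupDU i => bal_cupDU _ i
  | .cupUD i => bal_cupUD _ i
  | .capDU i => bal_capDU _ i
  | .capUD i => bal_capUD _ i

/-- The image of a diagram is linear over the coefficients of the alphabets on the left. -/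
theorem bal_map : ∀ {u v : List (SLetter n)} (D : Diag (SSig n) u v), Bal (s.map D)
  | _, _, .id _ => fun _ _ _ => rfl
  | _, _, .comp f g => (bal_map f).comp (bal_map g)
  | _, _, .zero _ _ => fun _ _ _ => (mul_zero _).symm
  | _, _, .add f g => fun j k z => by
    change s.map f _ + s.map g _ = _ * (s.map f z + s.map g z)
    rw [bal_map f j k z, bal_map g j k z, mul_add]
  | _, _, .smul q f => fun j k z => by
    change q • s.map f _ = _ * q • s.map f z
    rw [bal_map f j k z, mul_smul_comm]
  | _, _, .gen g w => s.bal_gen w g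
  | _, _, .cons l f => (bal_map f).whisker l

theorem capDU_slides (i : Fin (n - 1)) (c : s.A) :
    Slides (s.capDU i) ((s.step (up i)).incl (dn i) (s.incl (up i) c)) c := fun z => by
  rw [capDU, LinearMap.smul_apply, LinearMap.smul_apply, mul_smul_comm,
    s.cap_slides (l := up i) (m := dn i) rfl c z]

theorem base_gen (w : List (SLetter n)) (c : s.A) : ∀ g : SGen n,
    Slides (s.gen w g) (s.inclRun _ c) (s.inclRun _ c)
  | .dotUp _ => fun z => mul_assoc _ _ _
  | .dotDn _ => fun z => mul_assoc _ _ _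
  | .crossUp i j => by
    by_cases h : i = j
    · subst h
      exact ((s.run w).isDivDiff_crossUp i).base _
    · exact ((s.run w).isRelabel_crossUp h).base _
  | .crossDn i j => by
    by_cases h : i = j
    · subst h
      exact ((s.run w).isDivDiff_crossDn i).base _
    · exact ((s.run w).isRelabel_crossDn h).base _
  | .cupDU i => (((s.run w).incl_slides (l := up i) (s.inclRun w c)).comp
      (((s.run w).step (up i)).incl_slides (l := dn i) _)).comp fun z => mul_assoc _ _ _
  | .cupUD i => (((s.run w).incl_slides (l := dn i) (s.inclRun w c)).comp
      (((s.run w).step (dn i)).incl_slides (l := up i) _)).comp fun z => mul_assoc _ _ _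
  | .capDU i => (s.run w).capDU_slides i (s.inclRun w c)
  | .capUD i => (s.run w).cap_slides (l := dn i) (m := up i) rfl (s.inclRun w c)

/-- The image of a diagram is linear over the ring on the right. -/
theorem base_map (c : s.A) : ∀ {u v : List (SLetter n)} (D : Diag (SSig n) u v),
    Slides (s.map D) (s.inclRun u c) (s.inclRun v c)
  | _, _, .id _ => fun _ => rfl
  | _, _, .comp f g => (base_map c f).comp (base_map c g)
  | _, _, .zero _ _ => fun _ => (mul_zero _).symm
  | _, _, .add f g => fun z => by
    change s.map f _ + s.map g _ = _ * (s.map f z + s.map g z)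
    rw [base_map c f z, base_map c g z, mul_add]
  | _, _, .smul q f => fun z => by
    change q • s.map f _ = _ * q • s.map f z
    rw [base_map c f z, mul_smul_comm]
  | _, _, .gen g w => s.base_gen w c g
  | _, _, .cons l f => whisker_slides_incl l (s.bal_map f) (base_map c f)

end

end WebState

namespace WebState

open SLetter
open SC (lo hi)

noncomputable section

variable {n : ℕ} (s : WebState n)

/-! ### Small alphabets -/

section Small

variable {s} {l : SLetter n}

theorem var_of_linear {a : s.A} (h : s.P (loses l) = X - C a) : s.var l = s.incl l a := by
  have := s.eval_var l
  rw [h, Polynomial.map_sub, map_X, map_C, eval_sub, eval_X, eval_C] at this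
  exact sub_eq_zero.1 this

theorem P_of_linear {a : s.A} (h : s.P (loses l) = X - C a) : (s.step l).P (loses l) = 1 := by
  have e := P_loses_mul s l
  rw [h, Polynomial.map_sub, map_X, map_C, var_of_linear h] at e
  refine (monic_X_sub_C (s.incl l a)).isRegular.right ?_
  change _ * _ = 1 * _
  rw [one_mul]
  exact e

/-- The second root is the sum of the roots minus the first. Cancelling the monic factor `X - x`
makes the argument valid in rings with zero divisors. -/
theorem P_of_quadratic {a b : s.A} (h : s.P (loses l) = (X - C a) * (X - C b)) :
    (s.step l).P (loses l) = X - C (s.incl l (a + b) - s.var l) := by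
  have e := P_loses_mul s l
  have e0 := s.eval_var l
  rw [h, Polynomial.map_mul, Polynomial.map_sub, Polynomial.map_sub, map_X, map_C, map_C] at e e0
  rw [eval_mul, eval_sub, eval_sub, eval_X, eval_C, eval_C] at e0
  change (s.var l - s.incl l a) * (s.var l - s.incl l b) = 0 at e0
  change _ = (X - C (s.incl l a)) * (X - C (s.incl l b)) at e
  refine (monic_X_sub_C (s.var l)).isRegular.right ?_
  change _ * _ = _ * _
  rw [e]
  have e1 := congrArg (C : _ →+* (s.step l).A[X]) e0
  simp only [map_add, map_sub, map_mul, map_zero] at e1 ⊢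
  linear_combination e1

theorem var_sq {a b : s.A} (h : s.P (loses l) = (X - C a) * (X - C b)) :
    s.var l * s.var l = s.incl l (a + b) * s.var l - s.incl l (a * b) := by
  have e0 := s.eval_var l
  rw [h, Polynomial.map_mul, Polynomial.map_sub, Polynomial.map_sub, map_X, map_C, map_C] at e0
  rw [eval_mul, eval_sub, eval_sub, eval_X, eval_C, eval_C] at e0
  change (s.var l - s.incl l a) * (s.var l - s.incl l b) = 0 at e0
  simp only [map_add, map_mul]
  linear_combination e0

theorem P_gains_of_one (h : s.P (gains l) = 1) : (s.step l).P (gains l) = X - C (s.var l) := by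
  rw [P_gains, h, Polynomial.map_one, one_mul]

theorem P_gains_of_linear {a : s.A} (h : s.P (gains l) = X - C a) :
    (s.step l).P (gains l) = (X - C (s.incl l a)) * (X - C (s.var l)) := by
  rw [P_gains, h, Polynomial.map_sub, map_X, map_C]
  rfl

theorem P_gains_of_quadratic {a b : s.A} (h : s.P (gains l) = (X - C a) * (X - C b)) :
    (s.step l).P (gains l) =
      (X - C (s.incl l a)) * (X - C (s.incl l b)) * (X - C (s.var l)) := by
  rw [P_gains, h, Polynomial.map_mul, Polynomial.map_sub, Polynomial.map_sub, map_X, map_C, map_C]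
  rfl

theorem P_of_ne_of_one {j : Fin n} (h : s.P j = 1) (h1 : j ≠ loses l) (h2 : j ≠ gains l) :
    (s.step l).P j = 1 := by rw [P_of_ne _ _ h1 h2, h, Polynomial.map_one]

theorem P_of_ne_of_linear {j : Fin n} {a : s.A} (h : s.P j = X - C a) (h1 : j ≠ loses l)
    (h2 : j ≠ gains l) : (s.step l).P j = X - C (s.incl l a) := by
  rw [P_of_ne _ _ h1 h2, h, Polynomial.map_sub, map_X, map_C]
  rfl

theorem P_of_ne_of_quadratic {j : Fin n} {a b : s.A} (h : s.P j = (X - C a) * (X - C b))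
    (h1 : j ≠ loses l) (h2 : j ≠ gains l) :
    (s.step l).P j = (X - C (s.incl l a)) * (X - C (s.incl l b)) := by
  rw [P_of_ne _ _ h1 h2, h, Polynomial.map_mul, Polynomial.map_sub, Polynomial.map_sub, map_X,
    map_C, map_C]
  rfl

theorem trace_of_linear {a : s.A} (h : s.P (loses l) = X - C a) (c : s.A) :
    s.trace l (s.incl l c) = c := by
  rcases subsingleton_or_nontrivial s.A with _ | _
  · exact Subsingleton.elim _ _
  have hs : s.size l = 1 := by rw [size, h, natDegree_X_sub_C]
  have := s.coeff_pow l c (m := 0) (by omega) 0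
  rw [pow_zero, mul_one, if_pos rfl] at this
  rwa [trace, hs]

theorem size_of_quadratic [Nontrivial s.A] {a b : s.A}
    (h : s.P (loses l) = (X - C a) * (X - C b)) : s.size l = 2 := by
  rw [size, h, (monic_X_sub_C a).natDegree_mul (monic_X_sub_C b), natDegree_X_sub_C,
    natDegree_X_sub_C]

theorem trace_incl {a b : s.A} (h : s.P (loses l) = (X - C a) * (X - C b)) (c : s.A) :
    s.trace l (s.incl l c) = 0 := by
  rcases subsingleton_or_nontrivial s.A with _ | _
  · exact Subsingleton.elim _ _
  have hs := size_of_quadratic h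
  have := s.coeff_pow l c (m := 0) (by omega) 1
  rw [pow_zero, mul_one, if_neg one_ne_zero] at this
  rwa [trace, hs]

theorem trace_var {a b : s.A} (h : s.P (loses l) = (X - C a) * (X - C b)) :
    s.trace l (s.var l) = 1 := by
  rcases subsingleton_or_nontrivial s.A with _ | _
  · exact Subsingleton.elim _ _
  have hs := size_of_quadratic h
  have := s.coeff_pow l 1 (m := 1) (by omega) 1
  rw [pow_one, map_one, one_mul, if_pos rfl] at this
  rwa [trace, hs]

theorem trace_one {a b : s.A} (h : s.P (loses l) = (X - C a) * (X - C b)) :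
    s.trace l 1 = 0 := by
  rw [← map_one (s.incl l), trace_incl h]

end Small

theorem whisker_var {s t : WebState n} {f : s.A →ₗ[ℚ] t.A} (l : SLetter n) (hf : Bal f) :
    whisker l f (s.var l) = t.var l * t.incl l (f 1) := by
  simpa [mul_comm] using whisker_apply l hf 1 1

/-! ### Values of cups and caps -/

/-- The cup is multiplication by the product of the differences of the new variable with all
variables of the alphabet. -/
theorem cupDU_one (i : Fin (n - 1)) : s.cupDU i 1 =
    (((s.P (lo i)).map (s.incl (up i)).toRingHom).map ((s.step (up i)).incl (dn i)).toRingHom).eval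
      ((s.step (up i)).var (dn i)) := by
  set T := ((s.step (up i)).step (dn i))
  set u := (s.step (up i)).incl (dn i) (s.var (up i)) with hu
  set w := (s.step (up i)).var (dn i) with hw
  set p := ((s.P (lo i)).map (s.incl (up i)).toRingHom).map
    ((s.step (up i)).incl (dn i)).toRingHom with hp
  have h1 : T.P (lo i) * (X - C w) = p * (X - C u) := by
    have h := P_loses_mul (s.step (up i)) (dn i)
    rw [show loses (dn i) = gains (up i) from rfl, P_gains, Polynomial.map_mul,
      Polynomial.map_sub, map_X, map_C] at h
    exact h
  have h0 : p.eval w * (w - u) = 0 := by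
    have := congrArg (eval w) h1
    rw [eval_mul, eval_mul, eval_sub, eval_sub, eval_X, eval_C, eval_C, sub_self, mul_zero] at this
    exact this.symm
  have h2 : C (p.eval w) + (X - C w) * (p /ₘ (X - C w)) = p := by
    rw [← modByMonic_X_sub_C_eq_C_eval, modByMonic_add_div]
  -- Write `p = p(w) + (X - w) q`. Since `p(w) (w - u) = 0`, the factors `X - u` and `X - w` agree
  -- after multiplication by `p(w)`, so `X - w` can be cancelled in `h1`. Evaluation at `u` then
  -- leaves `p(w)`.
  have h3 : T.P (lo i) = (p /ₘ (X - C w)) * (X - C u) + C (p.eval w) := by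
    refine (monic_X_sub_C w).isRegular.right ?_
    change _ * _ = _ * _
    rw [h1]
    conv_lhs => rw [← h2]
    have h4 := congrArg (C : _ →+* T.A[X]) h0
    simp only [map_sub, map_mul, map_zero] at h4
    linear_combination h4
  have h5 : s.cupDU i 1 = (T.P (lo i)).eval u := by
    rw [cupDU, LinearMap.comp_apply, LinearMap.comp_apply]
    simp [T, hu]
  rw [h5, h3]
  simp

theorem cupDU_one_of_one {i : Fin (n - 1)} (h : s.P (lo i) = 1) : s.cupDU i 1 = 1 := by
  rw [cupDU_one, h]
  simp

theorem cupDU_one_of_linear {i : Fin (n - 1)} {a : s.A} (h : s.P (lo i) = X - C a) :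
    s.cupDU i 1 =
      (s.step (up i)).var (dn i) - (s.step (up i)).incl (dn i) (s.incl (up i) a) := by
  rw [cupDU_one, h]
  simp

theorem cupDU_one_of_quadratic {i : Fin (n - 1)} {a b : s.A}
    (h : s.P (lo i) = (X - C a) * (X - C b)) : s.cupDU i 1 =
      ((s.step (up i)).var (dn i) - (s.step (up i)).incl (dn i) (s.incl (up i) a)) *
      ((s.step (up i)).var (dn i) - (s.step (up i)).incl (dn i) (s.incl (up i) b)) := by
  rw [cupDU_one, h]
  simp

theorem cupUD_one_of_one {i : Fin (n - 1)} (h : s.P (hi i) = 1) : s.cupUD i 1 = 1 := by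
  rw [cupUD, LinearMap.comp_apply, LinearMap.comp_apply, h]
  simp

theorem cupUD_one_of_linear {i : Fin (n - 1)} {a : s.A} (h : s.P (hi i) = X - C a) :
    s.cupUD i 1 =
      (s.step (dn i)).incl (up i) (s.incl (dn i) a) - (s.step (dn i)).var (up i) := by
  rcases subsingleton_or_nontrivial s.A with _ | _
  · have := s.step_subsingleton (dn i)
    have := (s.step (dn i)).step_subsingleton (up i)
    exact Subsingleton.elim _ _
  rw [cupUD, LinearMap.comp_apply, LinearMap.comp_apply, h]
  simp

theorem capUD_incl (i : Fin (n - 1)) (z : (s.step (dn i)).A) :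
    s.capUD i ((s.step (dn i)).incl (up i) z) = s.trace (dn i) z := by
  have := (s.step (dn i)).subst_slides_incl (l := up i) (s.eval_gained (l := dn i) rfl) z 1
  rw [mul_one, (s.step (dn i)).subst_one (s.eval_gained (l := dn i) rfl), mul_one] at this
  rw [capUD, LinearMap.comp_apply, this]

theorem capUD_var (i : Fin (n - 1)) :
    s.capUD i ((s.step (dn i)).var (up i)) = s.trace (dn i) (s.var (dn i)) := by
  have := (s.step (dn i)).subst_slides_var (l := up i) (s.eval_gained (l := dn i) rfl) 1
  rw [mul_one, (s.step (dn i)).subst_one (s.eval_gained (l := dn i) rfl), mul_one] at this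
  rw [capUD, LinearMap.comp_apply, this]

theorem capUD_one (i : Fin (n - 1)) : s.capUD i 1 = s.trace (dn i) 1 := by
  rw [← capUD_incl, map_one ((s.step (dn i)).incl (up i))]

theorem capDU_incl_of_linear {i : Fin (n - 1)} {a : s.A} (h : s.P (hi i) = X - C a)
    (z : (s.step (up i)).A) :
    s.capDU i ((s.step (up i)).incl (dn i) z) = s.trace (up i) z := by
  rcases subsingleton_or_nontrivial s.A with _ | _
  · exact Subsingleton.elim _ _
  have := (s.step (up i)).subst_slides_incl (l := dn i) (s.eval_gained (l := up i) rfl) z 1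
  rw [mul_one, (s.step (up i)).subst_one (s.eval_gained (l := up i) rfl), mul_one] at this
  have hs : s.size (up i) = 1 := by rw [size, loses, h, natDegree_X_sub_C]
  rw [capDU, LinearMap.smul_apply, LinearMap.comp_apply, this, hs]
  simp

theorem capDU_incl_of_quadratic {i : Fin (n - 1)} {a b : s.A}
    (h : s.P (hi i) = (X - C a) * (X - C b)) (z : (s.step (up i)).A) :
    s.capDU i ((s.step (up i)).incl (dn i) z) = -s.trace (up i) z := by
  rcases subsingleton_or_nontrivial s.A with _ | _
  · exact Subsingleton.elim _ _
  have := (s.step (up i)).subst_slides_incl (l := dn i) (s.eval_gained (l := up i) rfl) z 1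
  rw [mul_one, (s.step (up i)).subst_one (s.eval_gained (l := up i) rfl), mul_one] at this
  have hs : s.size (up i) = 2 := size_of_quadratic (l := up i) h
  rw [capDU, LinearMap.smul_apply, LinearMap.comp_apply, this, hs]
  simp

theorem capDU_one_of_linear {i : Fin (n - 1)} {a : s.A} (h : s.P (hi i) = X - C a) :
    s.capDU i 1 = 1 := by
  rw [← map_one ((s.step (up i)).incl (dn i)), capDU_incl_of_linear s h,
    ← map_one (s.incl (up i)), trace_of_linear (l := up i) h]

/-! ### Sideways crossings -/

/-- The image of the sideways crossing `ℰ_{+j} ℰ_{-i} → ℰ_{-i} ℰ_{+j}`. -/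
def sideL (j i : Fin (n - 1)) :
    ((s.step (dn i)).step (up j)).A →ₗ[ℚ] ((s.step (up j)).step (dn i)).A :=
  whisker (dn i) (whisker (up j) (s.capUD i)) ∘ₗ whisker (dn i) ((s.step (dn i)).crossUp i j) ∘ₗ
    ((s.step (dn i)).step (up j)).cupDU i

/-- The image of the sideways crossing `ℰ_{-j} ℰ_{+i} → ℰ_{+i} ℰ_{-j}`. -/
def sideR (j i : Fin (n - 1)) :
    ((s.step (up i)).step (dn j)).A →ₗ[ℚ] ((s.step (dn j)).step (up i)).A :=
  ((s.step (dn j)).step (up i)).capDU j ∘ₗ whisker (dn j) ((s.step (dn j)).crossUp i j) ∘ₗ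
    whisker (dn j) (whisker (up i) (s.cupUD j))

theorem bal_sideL (j i : Fin (n - 1)) : Bal (s.sideL j i) := s.bal_map (Schur.crossL j i [])

theorem bal_sideR (j i : Fin (n - 1)) : Bal (s.sideR j i) := s.bal_map (Schur.crossR j i [])

theorem sideL_base (j i : Fin (n - 1)) (c : s.A) : Slides (s.sideL j i)
    ((s.step (dn i)).incl (up j) (s.incl (dn i) c))
    ((s.step (up j)).incl (dn i) (s.incl (up j) c)) :=
  s.base_map c (Schur.crossL j i [])

/-- The cap is a trace over a two-element alphabet: it sends the variable to `1` and constants to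
`0`. If `i = j + 1`, the cup is `1`, because `ℰ_{+j}` has emptied the alphabet, and the variable
comes from the factor of the crossing. Otherwise the crossing has no factor and the variable comes
from the linear cup. -/
theorem sideL_one {j i : Fin (n - 1)} (hij : i ≠ j) {a b : s.A}
    (h : s.P (lo i) = (X - C a) * (X - C b)) : s.sideL j i 1 = 1 := by
  have hP1 : (s.step (dn i)).P (lo i) = X - C (s.incl (dn i) (a + b) - s.var (dn i)) :=
    P_of_quadratic (l := dn i) h
  have hrel := (s.step (dn i)).isRelabel_crossUp hij
  rw [sideL, LinearMap.comp_apply, LinearMap.comp_apply]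
  by_cases hj : i.1 = j.1 + 1
  · have hlo : lo i = loses (up j) := by simp [lo, loses, hi, hj]
    have hP2 : ((s.step (dn i)).step (up j)).P (lo i) = 1 := by
      rw [hlo] at hP1 ⊢
      exact P_of_linear hP1
    rw [cupDU_one_of_one _ hP2,
      ← map_one (((s.step (dn i)).step (up j)).step (up i) |>.incl (dn i)),
      whisker_incl _ (bal_crossUp _ i j), hrel.map_one, if_pos hj,
      whisker_incl _ ((s.bal_capUD i).whisker _), map_sub (whisker (up j) (s.capUD i)),
      whisker_incl _ (s.bal_capUD i), whisker_var _ (s.bal_capUD i), capUD_var, capUD_one,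
      trace_var (l := dn i) h, trace_one (l := dn i) h]
    simp
  · have h1 : lo i ≠ loses (up j) := by
      simp only [lo, hi, loses, ne_eq, Fin.mk.injEq]; omega
    have h2 : lo i ≠ gains (up j) := by
      simp only [lo, gains, ne_eq, Fin.mk.injEq]; exact fun h => hij (Fin.ext h)
    have hP2 := P_of_ne_of_linear hP1 h1 h2
    rw [cupDU_one_of_linear _ hP2, map_sub, whisker_var _ (bal_crossUp _ i j),
      whisker_incl _ (bal_crossUp _ i j), (hrel.base _).apply, hrel.map_one, if_neg hj, map_one,
      mul_one, mul_one, map_sub, whisker_var _ ((s.bal_capUD i).whisker _),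
      whisker_incl _ ((s.bal_capUD i).whisker _), whisker_incl _ (s.bal_capUD i),
      ← map_one ((s.step (dn i) |>.step (up i)).incl (up j)), whisker_incl _ (s.bal_capUD i),
      capUD_incl, capUD_one, map_sub, trace_var (l := dn i) h, trace_one (l := dn i) h,
      trace_incl (l := dn i) h]
    simp

/-- The empty alphabet makes the cup equal to `1`. The crossing gives `1`, followed by a cap on an
alphabet of size one, or, if `i = j + 1`, a difference of variables followed by a cap on an alphabet
of size two; the sign of that cap cancels the sign of the subtracted variable. -/
theorem sideR_one {j i : Fin (n - 1)} (hij : i ≠ j) (h : s.P (hi j) = 1) :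
    s.sideR j i 1 = 1 := by
  have hP1 : (s.step (dn j)).P (hi j) = X - C (s.var (dn j)) := P_gains_of_one (l := dn j) h
  have hrel := (s.step (dn j)).isRelabel_crossUp hij
  rw [sideR, LinearMap.comp_apply, LinearMap.comp_apply,
    whisker_one _ ((s.bal_cupUD j).whisker _)
      (whisker_one _ (s.bal_cupUD j) (s.cupUD_one_of_one h)),
    ← map_one (((s.step (dn j)).step (up j)).step (up i) |>.incl (dn j)),
    whisker_incl _ (bal_crossUp _ i j), hrel.map_one]
  by_cases hj : i.1 = j.1 + 1
  · have hhi : hi j = gains (up i) := by simp [lo, gains, hi, hj]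
    have hP2 : ((s.step (dn j)).step (up i)).P (hi j) = (X - C ((s.step (dn j)).incl (up i)
        (s.var (dn j)))) * (X - C ((s.step (dn j)).var (up i))) := by
      rw [hhi] at hP1 ⊢
      exact P_gains_of_linear hP1
    rw [if_pos hj, capDU_incl_of_quadratic _ hP2, map_sub, trace_var (l := up j) hP2,
      trace_incl (l := up j) hP2]
    simp
  · have h1 : hi j ≠ loses (up i) := by
      simp only [hi, loses, ne_eq, Fin.mk.injEq]; exact fun h => hij (Fin.ext (by omega))
    have h2 : hi j ≠ gains (up i) := by
      simp only [hi, lo, gains, ne_eq, Fin.mk.injEq]; omega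
    have hP2 := P_of_ne_of_linear hP1 h1 h2
    rw [if_neg hj, map_one, capDU_one_of_linear _ hP2]

/-- The values of a sideways crossing of equal colors, where the alphabet that loses a variable
has two elements. -/
theorem sideL_self {i : Fin (n - 1)} {a b : s.A} (h : s.P (lo i) = (X - C a) * (X - C b)) :
    s.sideL i i 1 = 1 ∧
      s.sideL i i ((s.step (dn i)).incl (up i) (s.var (dn i))) = (s.step (up i)).var (dn i) := by
  have hP1 : (s.step (dn i)).P (lo i) = X - C (s.incl (dn i) (a + b) - s.var (dn i)) :=
    P_of_quadratic (l := dn i) h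
  have hP2 : ((s.step (dn i)).step (up i)).P (lo i) = _ := P_gains_of_linear (l := up i) hP1
  have hdd := (s.step (dn i)).isDivDiff_crossUp i
  set g := s.incl (dn i) (a + b) - s.var (dn i) with hg
  have hκ := cupDU_one_of_quadratic _ hP2
  -- Here `g` is the variable left in the alphabet. The element `y` passes through cup and crossing,
  -- so only the image of the cup element has to be computed before taking traces.
  have key : ∀ y : (s.step (dn i)).A, s.sideL i i ((s.step (dn i)).incl (up i) y) =
      (s.step (up i)).var (dn i) * (s.step (up i)).incl (dn i) (s.incl (up i) (s.trace (dn i) y)) -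
        (s.step (up i)).incl (dn i) (s.incl (up i) (s.trace (dn i) (y * g))) := by
    intro y
    have e1 : ((s.step (dn i)).step (up i)).cupDU i ((s.step (dn i)).incl (up i) y) =
        (((s.step (dn i)).step (up i)).step (up i)).incl (dn i)
          (((s.step (dn i)).step (up i)).incl (up i) ((s.step (dn i)).incl (up i) y)) *
            ((s.step (dn i)).step (up i)).cupDU i 1 :=
      Slides.apply (((s.step (dn i)).step (up i)).base_map _ (Schur.cupDU i []))
    set G := whisker (dn i) ((s.step (dn i)).crossUp i i) with hG
    have e2 : ∀ x, G ((((s.step (dn i)).step (up i)).step (up i)).incl (dn i) x) =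
        (((s.step (dn i)).step (up i)).step (up i)).incl (dn i) ((s.step (dn i)).crossUp i i x) :=
      fun x => whisker_incl _ (bal_crossUp _ i i) x
    have e3 : Slides G ((((s.step (dn i)).step (up i)).step (up i)).var (dn i)) _ :=
      whisker_slides_var _ (bal_crossUp _ i i)
    have e4 : Slides G ((((s.step (dn i)).step (up i)).step (up i)).incl (dn i)
        (((s.step (dn i)).step (up i)).incl (up i) ((s.step (dn i)).incl (up i) y))) _ :=
      whisker_slides_incl _ (bal_crossUp _ i i) (hdd.base y)
    -- The cup is `(w - g) (w - v)`, where `v` is the right variable of the crossing. The divided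
    -- difference kills constants, sends `v` to `-1` and is linear over `w` and `g`, so the result
    -- is `w - g`.
    have e5 : G (((s.step (dn i)).step (up i)).cupDU i 1) =
        (((s.step (dn i)).step (up i)).step (up i)).var (dn i) -
          (((s.step (dn i)).step (up i)).step (up i)).incl (dn i)
            (((s.step (dn i)).step (up i)).incl (up i) ((s.step (dn i)).incl (up i) g)) := by
      rw [hκ]
      set w := (((s.step (dn i)).step (up i)).step (up i)).var (dn i) with hw
      set ι := (((s.step (dn i)).step (up i)).step (up i)).incl (dn i) with hι
      set g' := ((s.step (dn i)).step (up i)).incl (up i) ((s.step (dn i)).incl (up i) g) with hg'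
      set v := ((s.step (dn i)).step (up i)).incl (up i) ((s.step (dn i)).var (up i)) with hv
      have : (w - ι g') * (w - ι v) = w * (w * ι 1) - w * ι (g' + v) + ι (g' * v) := by
        rw [map_add, map_mul, map_one]; ring
      rw [this, map_add, map_sub, e3, e3, e3, e2, e2, e2, map_add ((s.step (dn i)).crossUp i i),
        hdd.map_one, (hdd.base g).apply, hdd.base g, hdd.right, hdd.map_one]
      simp
      ring
    rw [sideL, LinearMap.comp_apply, LinearMap.comp_apply, e1, e4, e5]
    have e6 : (((s.step (dn i)).step (up i)).step (up i)).incl (dn i)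
          (((s.step (dn i)).step (up i)).incl (up i) ((s.step (dn i)).incl (up i) y)) *
        ((((s.step (dn i)).step (up i)).step (up i)).var (dn i) -
          (((s.step (dn i)).step (up i)).step (up i)).incl (dn i)
            (((s.step (dn i)).step (up i)).incl (up i) ((s.step (dn i)).incl (up i) g))) =
        (((s.step (dn i)).step (up i)).step (up i)).var (dn i) *
          (((s.step (dn i)).step (up i)).step (up i)).incl (dn i)
          (((s.step (dn i)).step (up i)).incl (up i) ((s.step (dn i)).incl (up i) y)) -
        (((s.step (dn i)).step (up i)).step (up i)).incl (dn i)
          (((s.step (dn i)).step (up i)).incl (up i) ((s.step (dn i)).incl (up i) (y * g))) := by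
      simp only [map_mul]; ring
    rw [e6, map_sub, whisker_slides_var _ ((s.bal_capUD i).whisker _),
      whisker_incl _ ((s.bal_capUD i).whisker _), whisker_incl _ ((s.bal_capUD i).whisker _),
      whisker_incl _ (s.bal_capUD i), whisker_incl _ (s.bal_capUD i), capUD_incl, capUD_incl]
  constructor
  · have := key 1
    rw [map_one] at this
    rw [this, trace_one (l := dn i) h, one_mul, hg, map_sub, trace_incl (l := dn i) h,
      trace_var (l := dn i) h]
    simp
  -- The product of the variable with the remaining one is `a * b`, a constant, so its trace
  -- vanishes and only the first term survives.
  · rw [key, trace_var (l := dn i) h, hg, mul_sub, var_sq (l := dn i) h, mul_comm (s.var (dn i)),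
      sub_sub_cancel, trace_incl (l := dn i) h]
    simp

/-- The cup is `c - v` with `v` the variable of the right strand; its divided difference is `1`, and
the cap on an alphabet of size one preserves `1`. -/
theorem sideR_self {i : Fin (n - 1)} {c : s.A} (h' : s.P (hi i) = X - C c) :
    s.sideR i i 1 = 1 := by
  have hP1 : (s.step (dn i)).P (hi i) = _ := P_gains_of_linear (l := dn i) h'
  have hP2 : ((s.step (dn i)).step (up i)).P (hi i) = _ := P_of_quadratic (l := up i) hP1
  have hdd := (s.step (dn i)).isDivDiff_crossUp i
  rw [sideR, LinearMap.comp_apply, LinearMap.comp_apply,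
    ← map_one ((s.step (up i)).incl (dn i)), whisker_incl _ ((s.bal_cupUD i).whisker _),
    ← map_one (s.incl (up i)), whisker_incl _ (s.bal_cupUD i), cupUD_one_of_linear _ h',
    whisker_incl _ (bal_crossUp _ i i), map_sub, map_sub, hdd.right, (hdd.base _).apply,
    hdd.map_one, mul_zero, zero_sub, neg_neg, map_one, map_one, capDU_one_of_linear _ hP2]

end

end WebState

namespace WebState

open SLetter
open SC (lo hi)

noncomputable section

variable {n : ℕ} (t : WebState n)

/-! ### The vertices of valence four and six -/

/-- Distant colors produce no difference factor in the vertical crossings. The strand `ℰ_{+j}` gives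
the two-element alphabet needed by `sideL_one`, and `ℰ_{+i}` empties the alphabet needed by
`sideR_one`. -/
theorem four_one {i j : Fin (n - 1)} (h : SC.Dist i j) {a b : t.A} (hj : t.P (lo j) = X - C a)
    (hi' : t.P (hi i) = X - C b) : t.map (SoergelToSchur.four i j []) 1 = 1 := by
  have hij : i ≠ j := by rintro rfl; rcases h with h | h <;> omega
  have e : t.map (SoergelToSchur.four i j []) 1 =
      whisker (dn j) ((t.step (up i)).sideR i j) (whisker (dn j) (whisker (dn i) (t.crossUp i j))
        (((t.step (up j)).step (up i)).crossDn i j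
          (whisker (dn i) ((t.step (up j)).sideL i j) 1))) := rfl
  have h1 : (t.step (up j)).sideL i j 1 = 1 :=
    sideL_one _ hij.symm (P_gains_of_linear (l := up j) hj)
  have h2 : ((t.step (up j)).step (up i)).crossDn i j 1 = 1 := by
    rw [(isRelabel_crossDn _ hij).map_one, if_neg (by rcases h with h | h <;> omega)]
  have h3 : t.crossUp i j 1 = 1 := by
    rw [(isRelabel_crossUp _ hij).map_one, if_neg (by rcases h with h | h <;> omega)]
  have h4 : (t.step (up i)).sideR i j 1 = 1 :=
    sideR_one _ hij.symm (P_of_linear (l := up i) hi')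
  rw [e, whisker_one _ (bal_sideL _ _ _) h1, h2,
    whisker_one _ ((bal_crossUp _ _ _).whisker _) (whisker_one _ (bal_crossUp _ _ _) h3),
    whisker_one _ (bal_sideR _ _ _) h4]
  rfl

/-- The variable of an alphabet of size one is minus the constant coefficient of its polynomial, so
a balanced map intertwines the variables themselves. -/
theorem Bal.root {s t : WebState n} {f : s.A →ₗ[ℚ] t.A} (hf : Bal f) {j : Fin n} {a : s.A}
    {a' : t.A} (h : s.P j = X - C a) (h' : t.P j = X - C a') : Slides f a a' := by
  have := (hf j 0).neg
  rw [h, h'] at this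
  simpa using this

theorem Bal.coeff_zero {s t : WebState n} {f : s.A →ₗ[ℚ] t.A} (hf : Bal f) {j : Fin n} {a : s.A}
    (h : s.P j = X - C a) : Slides f a (-(t.P j).coeff 0) := by
  have := (hf j 0).neg
  rw [h] at this
  simpa using this

/-- The alphabet of size one that is left of a cubic one after two steps. -/
theorem P_of_cubic {s : WebState n} {l : SLetter n} {a b c : s.A}
    (h : s.P (loses l) = (X - C a) * (X - C b) * (X - C c)) :
    ((s.step l).step l).P (loses l) = X - C ((s.step l).incl l (s.incl l (a + b + c)) -
      (s.step l).incl l (s.var l) - (s.step l).var l) := by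
  have e0 := s.eval_var l
  rw [h] at e0
  simp only [Polynomial.map_mul, Polynomial.map_sub, map_X, map_C, eval_mul, eval_sub, eval_X,
    eval_C] at e0
  change (s.var l - s.incl l a) * (s.var l - s.incl l b) * (s.var l - s.incl l c) = 0 at e0
  -- The quadratic cofactor is the quotient of the cubic by `X - x`, with `x` the new variable,
  -- written with elementary symmetric functions of `a, b, c`.
  have e1 : (s.step l).P (loses l) = X ^ 2 - C (s.incl l (a + b + c) - s.var l) * X +
      C (s.var l ^ 2 - s.incl l (a + b + c) * s.var l + s.incl l (a * b + a * c + b * c)) := by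
    refine (monic_X_sub_C (s.var l)).isRegular.right ?_
    change _ * _ = _ * _
    rw [P_loses_mul, h]
    simp only [Polynomial.map_mul, Polynomial.map_sub, map_X, map_C]
    change (X - C (s.incl l a)) * (X - C (s.incl l b)) * (X - C (s.incl l c)) = _
    have e := congrArg (C : _ →+* (s.step l).A[X]) e0
    simp only [map_add, map_sub, map_mul, map_pow, map_zero] at e ⊢
    linear_combination e
  have e2 := (s.step l).eval_var l
  rw [e1] at e2
  simp only [Polynomial.map_add, Polynomial.map_mul, Polynomial.map_sub, Polynomial.map_pow, map_X,
    map_C, eval_mul, eval_sub, eval_add, eval_pow, eval_X, eval_C] at e2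
  refine (monic_X_sub_C ((s.step l).var l)).isRegular.right ?_
  change _ * _ = _ * _
  rw [P_loses_mul, e1]
  simp only [Polynomial.map_add, Polynomial.map_mul, Polynomial.map_sub, Polynomial.map_pow, map_X,
    map_C]
  have e := congrArg (C : _ →+* ((s.step l).step l).A[X]) e2
  simp only [AlgHom.toRingHom_eq_coe, RingHom.coe_coe, map_add, map_sub, map_mul, map_pow,
    map_zero] at e ⊢
  linear_combination e

/-- A cup followed by a downward crossing. -/
theorem crossDn_cupDU (s : WebState n) {l : Fin (n - 1)} {a b : s.A}
    (h : s.P (lo l) = (X - C a) * (X - C b)) (y : s.A) :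
    (s.step (up l)).crossDn l l (((s.step (up l)).step (dn l)).incl (dn l) (s.cupDU l y)) =
      ((s.step (up l)).step (dn l)).incl (dn l) ((s.step (up l)).incl (dn l) (s.incl (up l) y)) *
      (((s.step (up l)).step (dn l)).var (dn l) +
        ((s.step (up l)).step (dn l)).incl (dn l) ((s.step (up l)).var (dn l)) -
        ((s.step (up l)).step (dn l)).incl (dn l)
          ((s.step (up l)).incl (dn l) (s.incl (up l) (a + b)))) := by
  have hd := (s.step (up l)).isDivDiff_crossDn l
  have hy : s.cupDU l y = (s.step (up l)).incl (dn l) (s.incl (up l) y) * s.cupDU l 1 :=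
    Slides.apply (s.base_map y (Schur.cupDU l []))
  rw [hy, cupDU_one_of_quadratic _ h, map_mul, hd.base]
  congr 1
  generalize hw : (s.step (up l)).var (dn l) = w at *
  generalize hx : ((s.step (up l)).step (dn l)).var (dn l) = x at *
  -- The square of `w` is written as `(x + w) w - x w`: the divided difference is linear over `x +
  -- w` and `x w`, so only its values at `1` and `w` are needed.
  have e : ((s.step (up l)).step (dn l)).incl (dn l)
      ((w - (s.step (up l)).incl (dn l) (s.incl (up l) a)) *
        (w - (s.step (up l)).incl (dn l) (s.incl (up l) b))) =
      (x + ((s.step (up l)).step (dn l)).incl (dn l) w) *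
          ((s.step (up l)).step (dn l)).incl (dn l) w -
        x * ((s.step (up l)).step (dn l)).incl (dn l) w -
        ((s.step (up l)).step (dn l)).incl (dn l) ((s.step (up l)).incl (dn l)
          (s.incl (up l) (a + b))) * ((s.step (up l)).step (dn l)).incl (dn l) w +
        ((s.step (up l)).step (dn l)).incl (dn l) ((s.step (up l)).incl (dn l)
          (s.incl (up l) (a * b))) := by
    simp only [map_mul, map_add, map_sub]
    ring
  have hadd := hd.add
  have hmul := hd.mul
  have hright := hd.right
  rw [hw, hx] at hadd hmul
  rw [hw] at hright
  rw [e, map_add, map_sub, map_sub, hadd, hmul.apply, hd.map_one, (hd.base _).apply, hd.map_one,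
    hd.base, hright]
  simp

/-- An upward crossing with two strands on its left. -/
theorem whisker_whisker_crossUp (s : WebState n) {l : Fin (n - 1)} (m m' : SLetter n)
    (y y' : ((s.step (up l)).step (up l)).A) :
    whisker m' (whisker m (s.crossUp l l))
      ((((s.step (up l)).step (up l)).step m).incl m' (((s.step (up l)).step (up l)).incl m y) *
      ((((s.step (up l)).step (up l)).step m).var m' +
        (((s.step (up l)).step (up l)).step m).incl m' (((s.step (up l)).step (up l)).var m) -
        (((s.step (up l)).step (up l)).step m).incl m' (((s.step (up l)).step (up l)).incl m y'))) =
    ((((s.step (up l)).step (up l)).step m).var m' +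
        (((s.step (up l)).step (up l)).step m).incl m' (((s.step (up l)).step (up l)).var m)) *
      (((s.step (up l)).step (up l)).step m).incl m'
        (((s.step (up l)).step (up l)).incl m (s.crossUp l l y)) -
      (((s.step (up l)).step (up l)).step m).incl m'
        (((s.step (up l)).step (up l)).incl m (s.crossUp l l (y * y'))) := by
  have bu := bal_crossUp s l l
  rw [mul_sub, mul_comm, add_mul, map_sub, map_add, whisker_slides_var _ (bu.whisker _),
    whisker_slides_incl _ (bu.whisker _) (whisker_slides_var _ bu), ← map_mul, ← map_mul,
    whisker_incl _ (bu.whisker _), whisker_incl _ bu, whisker_incl _ (bu.whisker _),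
    whisker_incl _ bu]
  ring

section Six

variable {t} {l r : Fin (n - 1)} (hr : r.1 = l.1 + 1) {a b c : t.A}

include hr in
theorem lo_eq_hi : lo r = hi l := by simp [lo, hi, hr]

include hr in
theorem six_indices : l ≠ r ∧ lo l ≠ hi l ∧ lo l ≠ hi r ∧ hi l ≠ hi r := by
  refine ⟨fun h => ?_, ?_, ?_, ?_⟩
  · rw [h] at hr; omega
  all_goals simp only [lo, hi, ne_eq, Fin.mk.injEq]; omega

include hr in
/-- The alphabets on the left of `ℰ_{+r}`. -/
theorem six_alphabets (ha : t.P (lo l) = X - C a) (hb : t.P (hi l) = X - C b)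
    (hc : t.P (hi r) = X - C c) :
    (t.step (up r)).P (lo l) = X - C (t.incl (up r) a) ∧
    (t.step (up r)).P (hi l) = (X - C (t.incl (up r) b)) * (X - C (t.incl (up r) c)) ∧
    (t.step (up r)).P (hi r) = 1 := by
  obtain ⟨-, h1, h2, h3⟩ := six_indices hr
  have hlr := lo_eq_hi hr
  have p1 : (t.step (up r)).P (lo l) = X - C (t.incl (up r) a) :=
    P_of_ne_of_linear (l := up r) ha h2 (by rw [gains, hlr]; exact h1)
  have p2 : (t.step (up r)).P (hi l) = (X - C (t.incl (up r) b)) * (X - C (t.incl (up r) c)) := by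
    rw [← hlr] at hb ⊢
    rw [← var_of_linear (l := up r) hc]
    exact P_gains_of_linear (l := up r) hb
  exact ⟨p1, p2, P_of_linear (l := up r) hc⟩

/-- The middle part of the 6-valent vertex `sixDown`. -/
def sixDownMid (l : Fin (n - 1)) (w : List (SLetter n)) :
    Diag (SSig n) (dn l :: up l :: w) (dn l :: up l :: dn l :: up l :: w) :=
  .cons (dn l) (Schur.cupDU l (up l :: w)) ⋆ Schur.crossDn l l (up l :: up l :: w) ⋆
    .cons (dn l) (.cons (dn l) (Schur.crossUp l l w)) ⋆
    .cons (dn l) (Schur.crossR l l (up l :: w))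

/-- Let `u` and `u' = b + c - u` be the variables of the two upward strands and `w`, `x` those of
the two downward strands. Cup and downward crossing produce `x + w - (a + u)`; the upward divided
difference sends this to `1`, and sends its product with `u'` to `x + w - a`. The alphabet `{a, u,
u'}` has lost `w` and `x`, so one variable `a + b + c - w - x` is left, and `x + w - a` is `b + c`
minus that variable. Written with a constant coefficient, this passes through the last sideways
crossing. -/
theorem sixDownMid_apply (s : WebState n) {a b c : s.A} (ha : s.P (lo l) = X - C a)
    (hbc : s.P (hi l) = (X - C b) * (X - C c)) :
    s.map (sixDownMid l []) 1 = 1 ∧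
    s.map (sixDownMid l []) ((s.step (up l)).incl (dn l) (s.incl (up l) (b + c) - s.var (up l))) =
      s.inclRun [dn l, up l, dn l, up l] (b + c) +
        ((s.run [dn l, up l, dn l, up l]).P (lo l)).coeff 0 := by
  have q1 : (s.step (up l)).P (lo l) = _ := P_gains_of_linear (l := up l) ha
  have q2 : (s.step (up l)).P (hi l) = _ := P_of_quadratic (l := up l) hbc
  have hu := var_of_linear (l := up l) q2
  have hroot := P_of_cubic (s := (s.step (up l)).step (up l)) (l := dn l)
    (P_gains_of_quadratic (l := up l) q1)
  have hd := s.isDivDiff_crossUp l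
  have hbal := bal_map s (.cons (dn l) (Schur.crossR l l [up l]))
  have hbase := s.base_map (b + c) (.cons (dn l) (Schur.crossR l l [up l]))
  have hone : s.map (.cons (dn l) (Schur.crossR l l [up l])) 1 = 1 :=
    whisker_one _ (bal_sideR _ _ _) (sideR_self (s.step (up l)) q2)
  have e : ∀ y, s.map (sixDownMid l []) ((s.step (up l)).incl (dn l) y) =
      s.map (.cons (dn l) (Schur.crossR l l [up l]))
        (whisker (dn l) (whisker (dn l) (s.crossUp l l))
          (((s.step (up l)).step (up l)).crossDn l l
            (whisker (dn l) ((s.step (up l)).cupDU l) ((s.step (up l)).incl (dn l) y)))) :=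
    fun y => rfl
  constructor
  · refine (congrArg (s.map (sixDownMid l []))
      (map_one ((s.step (up l)).incl (dn l))).symm).trans ?_
    rw [e, whisker_incl _ (bal_cupDU _ _),
      crossDn_cupDU _ q1, whisker_whisker_crossUp, map_one, hd.map_one, one_mul,
      map_add, map_add, hd.right, (hd.base _).apply, hd.map_one]
    simp only [map_zero, mul_zero, zero_add, map_one, map_neg, zero_sub, neg_neg]
    exact hone
  · rw [e, whisker_incl _ (bal_cupDU _ _), crossDn_cupDU _ q1, whisker_whisker_crossUp, ← hu,
      hd.left, map_one, map_one, map_one, mul_one, map_add, mul_add, map_add,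
      hd.mul.apply, hd.map_one, mul_zero, add_zero, mul_comm, hd.base, hd.left, map_one, mul_one]
    -- The crossing need not preserve the size of the expression for the remaining variable, but it
    -- intertwines the constant coefficients, and it fixes `1`.
    have e1 := hbal.coeff_zero hroot
    have e2 := (hbase.sub e1).apply
    rw [hone, mul_one, sub_neg_eq_add] at e2
    refine Eq.trans (congrArg _ ?_) e2
    change _ = WebState.incl _ _ (WebState.incl _ _ (WebState.incl _ _ (WebState.incl _ _ _))) - _
    rw [hu]
    simp only [map_add, map_sub]
    ring


end Six

end

end WebState

namespace WebState

open SLetter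
open SC (lo hi)

noncomputable section

variable {n : ℕ} (s : WebState n)

/-! ### Values of composite diagrams -/

section Values

variable {s} {u v w : List (SLetter n)}

theorem map_comp_eq {f : Diag (SSig n) u v} {g : Diag (SSig n) v w} {z : (s.run u).A}
    {z' : (s.run v).A} {z'' : (s.run w).A} (hf : s.map f z = z') (hg : s.map g z' = z'') :
    s.map (f ⋆ g) z = z'' :=
  (congrArg (s.map g) hf).trans hg

/-- The inclusion for the leftmost letter of a word. -/
def inclCons (s : WebState n) (l : SLetter n) (w : List (SLetter n)) :
    (s.run w).A →ₐ[ℚ] (s.run (l :: w)).A :=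
  (s.run w).incl l

theorem map_cons_eq (l : SLetter n) {f : Diag (SSig n) u v} {z : (s.run u).A} {z' : (s.run v).A}
    (hf : s.map f z = z') : s.map (u := l :: u) (v := l :: v) (.cons l f) (s.inclCons l u z) =
      s.inclCons l v z' :=
  (whisker_incl l (s.bal_map f) z).trans (congrArg _ hf)

theorem map_comp_four {u₁ u₂ u₃ u₄ : List (SLetter n)} {f : Diag (SSig n) u u₁}
    {a : Diag (SSig n) u₁ u₂} {b : Diag (SSig n) u₂ u₃} {c : Diag (SSig n) u₃ u₄}
    {e : Diag (SSig n) u₄ w} {z : (s.run u).A} {z' : (s.run u₁).A} (hf : s.map f z = z') :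
    s.map (f ⋆ a ⋆ b ⋆ c ⋆ e) z = s.map (a ⋆ b ⋆ c ⋆ e) z' :=
  congrArg (s.map (a ⋆ b ⋆ c ⋆ e)) hf

theorem map_comp_one {f : Diag (SSig n) u v} {g : Diag (SSig n) v w}
    (hf : s.map f 1 = 1) (hg : s.map g 1 = 1) : s.map (f ⋆ g) 1 = 1 :=
  map_comp_eq hf hg

theorem inclCons_add_coeff {l : SLetter n} {j : Fin n} (h1 : j ≠ loses l) (h2 : j ≠ gains l)
    (c : s.A) (k : ℕ) : s.inclCons l w (s.inclRun w c + ((s.run w).P j).coeff k) =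
      s.inclRun (l :: w) c + ((s.run (l :: w)).P j).coeff k := by
  rw [map_add]
  refine congrArg _ ?_
  change _ = Polynomial.coeff (((s.run w).step l).P j) k
  rw [P_of_ne _ _ h1 h2, coeff_map]
  rfl

/-- A right scalar plus a coefficient of an alphabet keeps its form under every diagram that fixes
`1`. The second value of `sixDown` is therefore expressed in this form. -/
theorem map_inclRun_add_coeff {D : Diag (SSig n) u v} (h : s.map D 1 = 1) (c : s.A) (j : Fin n)
    (k : ℕ) : s.map D (s.inclRun u c + ((s.run u).P j).coeff k) =
      s.inclRun v c + ((s.run v).P j).coeff k := by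
  have h4 := ((s.base_map c D).add (s.bal_map D j k)).apply
  rwa [h, mul_one] at h4

/-- Identity strands on the right enter only through the web state from which the diagram is
evaluated. -/
theorem map_sixDownMid (l : Fin (n - 1)) (w : List (SLetter n))
    (z : (s.run (dn l :: up l :: w)).A) :
    s.map (sixDownMid l w) z = (s.run w).map (sixDownMid l []) z := by
  rfl

theorem map_sixDownMid_one (l : Fin (n - 1)) (w : List (SLetter n))
    (h : (s.run w).map (sixDownMid l []) 1 = 1) : s.map (sixDownMid l w) 1 = 1 :=
  (map_sixDownMid l w 1).trans h

theorem map_sixDownMid_incl {l : Fin (n - 1)} {w : List (SLetter n)} {y : (s.run (up l :: w)).A}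
    {e : s.A}
    (h : (s.run w).map (sixDownMid l []) (((s.run w).step (up l)).incl (dn l) y) =
      (s.run w).inclRun [dn l, up l, dn l, up l] (s.inclRun w e) +
        (((s.run w).run [dn l, up l, dn l, up l]).P (lo l)).coeff 0) :
    s.map (sixDownMid l w) (s.inclCons (dn l) _ y) =
      s.inclRun (dn l :: up l :: dn l :: up l :: w) e +
        ((s.run (dn l :: up l :: dn l :: up l :: w)).P (lo l)).coeff 0 :=
  (map_sixDownMid l w _).trans h

theorem map_cons_one (l : SLetter n) {f : Diag (SSig n) u v} (hf : s.map f 1 = 1) :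
    s.map (u := l :: u) (v := l :: v) (.cons l f) 1 = 1 :=
  whisker_one l (s.bal_map f) hf

theorem map_crossR_one {i j : Fin (n - 1)} (hij : i ≠ j) (w : List (SLetter n))
    (h : (s.run w).P (hi j) = 1) : s.map (Schur.crossR j i w) 1 = 1 :=
  (s.run w).sideR_one hij h

theorem map_crossL_one {i j : Fin (n - 1)} (hij : i ≠ j) (w : List (SLetter n))
    {a b : (s.run w).A} (h : (s.run w).P (lo i) = (X - C a) * (X - C b)) :
    s.map (Schur.crossL j i w) 1 = 1 :=
  (s.run w).sideL_one hij h

theorem map_crossL_incl {i j : Fin (n - 1)} {w : List (SLetter n)}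
    (h : s.map (Schur.crossL j i w) 1 = 1) (c : (s.run w).A) :
    s.map (Schur.crossL j i w) (s.inclCons (up j) _ (s.inclCons (dn i) _ c)) =
      s.inclCons (dn i) _ (s.inclCons (up j) _ c) :=
  ((s.run w).sideL_base j i c).apply.trans ((congrArg _ h).trans (mul_one _))

theorem map_crossUp_one {i j : Fin (n - 1)} (hij : i ≠ j) (h : i.1 ≠ j.1 + 1)
    (w : List (SLetter n)) : s.map (Schur.crossUp i j w) 1 = 1 :=
  (isRelabel_crossUp (s.run w) hij).map_one.trans (if_neg h)

theorem map_crossDn_one {i j : Fin (n - 1)} (hij : i ≠ j) (h : j.1 ≠ i.1 + 1)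
    (w : List (SLetter n)) : s.map (Schur.crossDn i j w) 1 = 1 :=
  (isRelabel_crossDn (s.run w) hij).map_one.trans (if_neg h)

end Values

/-! ### The 6-valent vertex with bottom colors `(r, l, r)` -/

section Six

variable {t : WebState n} {l r : Fin (n - 1)} (hr : r.1 = l.1 + 1) {a b c : t.A}

/-- The last part of the 6-valent vertex `sixDown`. -/
def sixDownTail (l r : Fin (n - 1)) : Diag (SSig n) [dn r, dn l, up l, dn l, up l, up r]
    [dn l, up l, dn r, up r, dn l, up l] :=
  Schur.crossDn r l [up l, dn l, up l, up r] ⋆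
    .cons (dn l) (.cons (dn r) (.cons (up l) (.cons (dn l) (Schur.crossUp l r [])))) ⋆
    .cons (dn l) (Schur.crossR r l [dn l, up r, up l]) ⋆
    .cons (dn l) (.cons (up l) (.cons (dn r) (Schur.crossR l r [up l])))

-- The vertical crossings have their colors in the order that produces no difference factor, and
-- `ℰ_{+r}` respectively `ℰ_{+l}` has emptied the alphabets needed by `sideR_one`.
include hr in
theorem sixDownTail_one (hb : t.P (hi l) = X - C b) (hc : t.P (hi r) = X - C c) :
    t.map (sixDownTail l r) 1 = 1 := by
  obtain ⟨hlr, n1, n2, n3⟩ := six_indices hr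
  have h3 : (t.run [dn l, up r, up l]).P (hi r) = 1 :=
    P_of_ne_of_one (l := dn l) (P_of_linear (l := up r)
      (P_of_ne_of_linear (l := up l) hc n3.symm n2.symm)) n2.symm n3.symm
  have h4 : (t.run [up l]).P (hi l) = 1 := P_of_linear (l := up l) hb
  have e1 := map_crossDn_one (s := t) hlr.symm (by omega) [up l, dn l, up l, up r]
  have e2 := map_cons_one (dn l) (map_cons_one (dn r) (map_cons_one (up l) (map_cons_one (dn l)
      (map_crossUp_one (s := t) hlr (by omega) []))))
  have e3 := map_cons_one (dn l) (map_crossR_one hlr _ h3)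
  have e4 := map_cons_one (dn l) (map_cons_one (up l) (map_cons_one (dn r)
    (map_crossR_one hlr.symm _ h4)))
  unfold sixDownTail
  refine map_comp_one (map_comp_one (map_comp_one ?_ ?_) ?_) ?_
  · with_reducible exact e1
  · with_reducible exact e2
  · with_reducible exact e3
  · with_reducible exact e4

/-- The vertex is cut into three parts: a head that ends in the cap of color `r`, a middle of color
`l` under an identity strand, and a tail. Only the values after each head diagram matter; the middle
and the tail are treated as wholes. -/
theorem sixDown_eq {z : (t.run [up r, dn l, up l, dn r, up r]).A}
    {z1 : (t.run [dn l, up r, up l, dn r, up r]).A} {z2 : (t.run [dn l, up r, dn r, up l, up r]).A}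
    {z3 : (t.run [dn l, up l, up r]).A}
    (h1 : t.map (Schur.crossL r l [up l, dn r, up r]) z = z1)
    (h2 : t.map (.cons (dn l) (.cons (up r) (Schur.crossL l r [up r]))) z1 = z2)
    (h3 : t.map (.cons (dn l) (Schur.capUD r [up l, up r])) z2 = z3) :
    t.map (SoergelToSchur.sixDown r l []) (t.inclCons (dn r) _ z) =
      t.map (sixDownTail l r)
        (t.inclCons (dn r) _ (t.map (sixDownMid l [up r]) z3)) := by
  have e1 := map_cons_eq (dn r) h1
  have e2 := map_cons_eq (dn r) h2
  have e3 := map_cons_eq (dn r) h3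
  obtain ⟨z4, h4⟩ := exists_eq' (a' := t.map (.cons (dn l) (Schur.cupDU l [up l, up r])) z3)
  obtain ⟨z5, h5⟩ := exists_eq' (a' := t.map (Schur.crossDn l l [up l, up l, up r]) z4)
  obtain ⟨z6, h6⟩ := exists_eq'
    (a' := t.map (.cons (dn l) (.cons (dn l) (Schur.crossUp l l [up r]))) z5)
  obtain ⟨z7, h7⟩ := exists_eq' (a' := t.map (.cons (dn l) (Schur.crossR l l [up l, up r])) z6)
  have e4 := map_cons_eq (dn r) h4
  have e5 := map_cons_eq (dn r) h5
  have e6 := map_cons_eq (dn r) h6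
  have e7 := map_cons_eq (dn r) h7
  with_reducible have k := map_comp_eq (map_comp_eq (map_comp_eq (map_comp_eq (map_comp_eq
    (map_comp_eq e1 e2) e3) e4) e5) e6) e7
  have k' : t.map (sixDownMid l [up r]) z3 = z7 := by
    unfold sixDownMid
    with_reducible exact map_comp_eq (map_comp_eq (map_comp_eq h4 h5) h6) h7
  rw [k']
  unfold sixDownTail SoergelToSchur.sixDown
  with_reducible exact map_comp_four k

set_option maxHeartbeats 800000 in
include hr in
/-- The values of `sixDown` on the generators of the bimodule. -/
theorem sixDown_apply (ha : t.P (lo l) = X - C a) (hb : t.P (hi l) = X - C b)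
    (hc : t.P (hi r) = X - C c) : t.map (SoergelToSchur.sixDown r l []) 1 = 1 ∧
    t.map (SoergelToSchur.sixDown r l []) (t.inclCons (dn r) _ (t.inclCons (up r) _
      (t.inclCons (dn l) _ (t.inclCons (up l) [dn r, up r] ((t.step (up r)).var (dn r)))))) =
      t.inclRun [dn l, up l, dn r, up r, dn l, up l] (b + c) +
        ((t.run [dn l, up l, dn r, up r, dn l, up l]).P (lo l)).coeff 0 := by
  obtain ⟨hlr, n1, n2, n3⟩ := six_indices hr
  have hlo := lo_eq_hi hr
  obtain ⟨p1, p2, p3⟩ := six_alphabets hr ha hb hc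
  have q2 : ((t.step (up r)).step (up l)).P (loses (dn r)) =
      X - C ((t.step (up r)).incl (up l) (t.incl (up r) b + t.incl (up r) c) -
        (t.step (up r)).var (up l)) := by
    rw [loses, hlo]; exact P_of_quadratic (l := up l) p2
  have q3 : ((t.step (up r)).step (up l)).P (hi r) = 1 :=
    P_of_ne_of_one (l := up l) p3 n3.symm n2.symm
  have p2' : (t.run [up r]).P (hi l) =
      (X - C (t.inclRun [up r] b)) * (X - C (t.inclRun [up r] c)) := p2
  obtain ⟨m1, m2⟩ := sixDownMid_apply (t.run [up r]) p1 p2'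
  have L1 : t.map (Schur.crossL r l [up l, dn r, up r]) 1 = 1 :=
    map_crossL_one hlr _ (P_gains_of_linear (l := up l)
      (P_of_ne_of_linear (l := dn r) p1 (by rw [loses, hlo]; exact n1) n2))
  have L2 : t.map (Schur.crossL l r [up r]) 1 = 1 := by
    rw [← hlo] at p2
    exact map_crossL_one hlr.symm _ p2
  have L2' : t.map (Schur.crossL l r [up r]) (t.inclCons (up l) [dn r, up r]
      ((t.step (up r)).var (dn r))) = ((t.step (up r)).step (up l)).var (dn r) := by
    -- The variable of `ℰ_{-r}` is the only element of the alphabet of strand `hi r` before and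
    -- after the crossing, so its image follows from balancedness.
    have h := (bal_sideL (t.step (up r)) l r).root (j := hi r)
      (P_of_ne_of_linear (l := up l) (P_gains_of_one (l := dn r) p3) n3.symm n2.symm)
      (P_gains_of_one (l := dn r) q3)
    exact h.apply.trans ((congrArg _ L2).trans (mul_one _))
  -- The alphabet of strand `lo r = hi l` has one element at this place, so the cap simply
  -- substitutes that element, `b + c` minus the variable of `ℰ_{+l}`.
  have L3 : t.map (Schur.capUD r [up l, up r]) 1 = 1 := by
    change ((t.step (up r)).step (up l)).capUD r 1 = 1
    rw [capUD_one, ← map_one (((t.step (up r)).step (up l)).incl (dn r)), trace_of_linear q2]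
  have L3' : t.map (Schur.capUD r [up l, up r]) (t.inclCons (up r) [dn r, up l, up r]
      (((t.step (up r)).step (up l)).var (dn r))) = (t.run [up r]).incl (up l)
        (t.inclRun [up r] (b + c)) - (t.run [up r]).var (up l) := by
    change ((t.step (up r)).step (up l)).capUD r (WebState.incl _ _ _) = _
    rw [capUD_incl, var_of_linear q2, trace_of_linear q2, ← map_add]
    rfl
  have htail := sixDownTail_one hr hb hc
  constructor
  · have e2 := map_cons_one (dn l) (map_cons_one (up r) L2)
    have e3 := map_cons_one (dn l) L3
    with_reducible have e := sixDown_eq L1 e2 e3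
    have m1' : t.map (sixDownMid l [up r]) 1 = 1 :=
      map_sixDownMid_one l [up r] m1
    rw [m1', map_one (t.inclCons (dn r) _), map_one (t.inclCons (dn r) _), htail] at e
    exact e
  · have e1 := map_crossL_incl L1 (t.inclCons (up l) [dn r, up r] ((t.step (up r)).var (dn r)))
    have e2 := map_cons_eq (dn l) (map_cons_eq (up r) L2')
    have e3 := map_cons_eq (dn l) L3'
    have e := sixDown_eq e1 e2 e3
    rw [← map_add] at m2
    have m2' := map_sixDownMid_incl (s := t) (w := [up r]) (e := b + c) m2
    -- The strand `ℰ_{-r}` leaves the alphabet of `lo l` alone and the tail fixes `1`, so the value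
    -- keeps its form to the end.
    rw [m2', inclCons_add_coeff (by rw [loses, hlo]; exact n1) n2,
      map_inclRun_add_coeff htail] at e
    with_reducible exact e

end Six

end

end WebState

namespace WebState

open SLetter
open SC (lo hi)

noncomputable section

variable {n : ℕ}

/-- The variable of the leftmost letter of a word. -/
def varCons (s : WebState n) (l : SLetter n) (w : List (SLetter n)) : (s.run (l :: w)).A :=
  (s.run w).var l

section Values

variable {s : WebState n} {u v w : List (SLetter n)}

theorem map_cons_var (l : SLetter n) {f : Diag (SSig n) u v} (hf : s.map f 1 = 1) :
    s.map (u := l :: u) (v := l :: v) (.cons l f) (s.varCons l u) = s.varCons l v :=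
  (whisker_var l (s.bal_map f)).trans
    ((congrArg _ ((congrArg _ hf).trans (map_one (s.inclCons l v)))).trans (mul_one _))

theorem map_cons_var_mul (l : SLetter n) {f : Diag (SSig n) u v} {z : (s.run u).A}
    {z' : (s.run v).A} (hf : s.map f z = z') :
    s.map (u := l :: u) (v := l :: v) (.cons l f) (s.varCons l u * s.inclCons l u z) =
      s.varCons l v * s.inclCons l v z' :=
  (whisker_slides_var l (s.bal_map f) _).trans (congrArg (s.varCons l v * ·) (map_cons_eq l hf))

theorem map_cons_sub (l : SLetter n) {f : Diag (SSig n) u v} {z y : (s.run u).A}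
    {z' y' : (s.run v).A} (hz : s.map f z = z') (hy : s.map f y = y') :
    s.map (u := l :: u) (v := l :: v) (.cons l f)
      (s.varCons l u * s.inclCons l u z - s.inclCons l u y) =
      s.varCons l v * s.inclCons l v z' - s.inclCons l v y' := by
  rw [map_sub, map_cons_var_mul l hz, map_cons_eq l hy]

theorem map_crossDn_incl {i j : Fin (n - 1)} (hij : j.1 = i.1 + 1) (w : List (SLetter n))
    (y : (s.run w).A) :
    s.map (Schur.crossDn i j w) (s.inclCons (dn i) _ (s.inclCons (dn j) _ y)) =
      s.varCons (dn j) _ * s.inclCons (dn j) _ (s.inclCons (dn i) _ y) -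
        s.inclCons (dn j) _ (s.varCons (dn i) _ * s.inclCons (dn i) _ y) := by
  have hne : i ≠ j := by rintro rfl; omega
  have h := (s.run w).isRelabel_crossDn hne
  refine ((h.base y).apply.trans (congrArg _ (h.map_one.trans (if_pos hij)))).trans ?_
  rw [map_mul]
  change s.inclCons (dn j) _ (s.inclCons (dn i) _ y) * (s.varCons (dn j) _ -
    s.inclCons (dn j) _ (s.varCons (dn i) _)) = _
  ring

/-- The difference of the variables of the letters `ℰ_{+r}` and `ℰ_{+l}`. -/
def upDiff (s : WebState n) (l r : Fin (n - 1)) (w : List (SLetter n)) :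
    (s.run (up l :: up r :: w)).A :=
  s.inclCons (up l) _ (s.varCons (up r) _) - s.varCons (up l) _

theorem map_crossUp_upDiff {l r : Fin (n - 1)} (hr : r.1 = l.1 + 1) (w : List (SLetter n)) :
    s.map (Schur.crossUp r l w) 1 = s.upDiff l r w := by
  have hne : r ≠ l := by rintro rfl; omega
  exact ((s.run w).isRelabel_crossUp hne).map_one.trans (if_pos hr)

/-- The variable of `ℰ_{+r}` is a constant for the divided difference and the subtracted right
variable goes to `-1`. -/
theorem map_crossUp_incl_upDiff (l r : Fin (n - 1)) (w : List (SLetter n)) :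
    s.map (Schur.crossUp l l (up r :: w)) (s.inclCons (up l) _ (s.upDiff l r w)) = 1 := by
  have h := (s.run (up r :: w)).isDivDiff_crossUp l
  have h1 : s.map (Schur.crossUp l l (up r :: w))
      (s.inclCons (up l) _ (s.inclCons (up l) _ (s.varCons (up r) w))) = 0 :=
    (h.base (s.varCons (up r) w)).apply.trans ((congrArg _ h.map_one).trans (mul_zero _))
  have h2 : s.map (Schur.crossUp l l (up r :: w))
      (s.inclCons (up l) _ (s.varCons (up l) (up r :: w))) = -1 :=
    h.right.trans (congrArg _ (map_one _))
  rw [upDiff, map_sub, map_sub, h1, h2, sub_neg_eq_add, zero_add]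

theorem map_crossL_self {i : Fin (n - 1)} (w : List (SLetter n)) {a b : (s.run w).A}
    (h : (s.run w).P (lo i) = (X - C a) * (X - C b)) (c : (s.run w).A) :
    s.map (Schur.crossL i i w) (s.inclCons (up i) _ (s.inclCons (dn i) _ c)) =
      s.inclCons (dn i) _ (s.inclCons (up i) _ c) ∧
    s.map (Schur.crossL i i w)
      (s.inclCons (up i) _ (s.varCons (dn i) _ * s.inclCons (dn i) _ c)) =
      s.varCons (dn i) _ * s.inclCons (dn i) _ (s.inclCons (up i) _ c) := by
  obtain ⟨h1, h2⟩ := (s.run w).sideL_self h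
  constructor
  · exact map_crossL_incl h1 c
  · rw [mul_comm, map_mul, mul_comm (s.varCons _ _)]
    exact ((s.run w).sideL_base i i c _).trans (congrArg _ h2)

theorem map_crossDn_self (i : Fin (n - 1)) (w : List (SLetter n)) (c : (s.run w).A) :
    s.map (Schur.crossDn i i w) (s.inclCons (dn i) _ (s.inclCons (dn i) _ c)) = 0 ∧
    s.map (Schur.crossDn i i w) (s.varCons (dn i) _ *
      s.inclCons (dn i) _ (s.inclCons (dn i) _ c)) =
      -s.inclCons (dn i) _ (s.inclCons (dn i) _ c) ∧
    s.map (Schur.crossDn i i w)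
      (s.inclCons (dn i) _ (s.varCons (dn i) _ * s.inclCons (dn i) _ c)) =
      s.inclCons (dn i) _ (s.inclCons (dn i) _ c) ∧
    s.map (Schur.crossDn i i w) (s.varCons (dn i) _ *
      s.inclCons (dn i) _ (s.varCons (dn i) _ * s.inclCons (dn i) _ c)) = 0 := by
  have h := (s.run w).isDivDiff_crossDn i
  refine ⟨?_, ?_, ?_, ?_⟩
  · exact (h.base c).apply.trans ((congrArg _ h.map_one).trans (mul_zero _))
  · rw [mul_comm]
    refine (h.base c _).trans ((congrArg _ h.left).trans ?_)
    rw [map_neg, map_one, mul_neg_one]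
    rfl
  · rw [mul_comm, map_mul]
    refine (h.base c _).trans ((congrArg _ h.right).trans ?_)
    rw [map_neg, map_one, neg_neg, mul_one]
    rfl
  · rw [map_mul (s.inclCons _ _), ← mul_assoc, mul_comm]
    refine (h.base c _).trans ?_
    refine (congrArg _ (h.mul.apply.trans ((congrArg _ h.map_one).trans (mul_zero _)))).trans ?_
    exact mul_zero _

end Values

/-! ### The 6-valent vertex with bottom colors `(l, r, l)` -/

section Six

variable {t : WebState n} {l r : Fin (n - 1)} (hr : r.1 = l.1 + 1) {a b c : t.A}

/-- The first part of the 6-valent vertex `sixUp`. -/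
def sixUpHead (l r : Fin (n - 1)) : Diag (SSig n) [dn l, up l, dn r, up r, dn l, up l]
    [dn r, dn l, dn l, up l, up l, up r] :=
  .cons (dn l) (Schur.crossL l r [up r, dn l, up l]) ⋆
    .cons (dn l) (.cons (dn r) (.cons (up l) (Schur.crossL r l [up l]))) ⋆
    Schur.crossDn l r [up l, dn l, up r, up l] ⋆
    .cons (dn r) (.cons (dn l) (.cons (up l) (.cons (dn l) (Schur.crossUp r l [])))) ⋆
    .cons (dn r) (.cons (dn l) (Schur.crossL l l [up l, up r])) ⋆
    .cons (dn r) (Schur.crossDn l l [up l, up l, up r])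

/-- The last part of the 6-valent vertex `sixUp`. -/
def sixUpTail (l r : Fin (n - 1)) : Diag (SSig n) [dn r, dn l, dn l, up l, up l, up r]
    [dn r, up r, dn l, up l, dn r, up r] :=
  .cons (dn r) (.cons (dn l) (.cons (dn l) (Schur.crossUp l l [up r]))) ⋆
    .cons (dn r) (.cons (dn l) (Schur.capDU l [up l, up r])) ⋆
    .cons (dn r) (.cons (dn l) (Schur.cupUD r [up l, up r])) ⋆
    .cons (dn r) (.cons (dn l) (.cons (up r) (Schur.crossR r l [up r]))) ⋆
    .cons (dn r) (Schur.crossR l r [up l, dn r, up r])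

theorem map_comp_five {s : WebState n} {u u₀ u₁ u₂ u₃ u₄ w : List (SLetter n)}
    {f : Diag (SSig n) u u₀} {a : Diag (SSig n) u₀ u₁}
    {b : Diag (SSig n) u₁ u₂} {c : Diag (SSig n) u₂ u₃} {e : Diag (SSig n) u₃ u₄}
    {g : Diag (SSig n) u₄ w} {z : (s.run u).A} {z' : (s.run u₀).A} {z'' : (s.run w).A}
    (hf : s.map f z = z') (hg : s.map (a ⋆ b ⋆ c ⋆ e ⋆ g) z' = z'') :
    s.map (f ⋆ a ⋆ b ⋆ c ⋆ e ⋆ g) z = z'' :=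
  (congrArg (s.map (a ⋆ b ⋆ c ⋆ e ⋆ g)) hf).trans hg

theorem sixUp_eq {z : (t.run [dn l, up l, dn r, up r, dn l, up l]).A}
    {z' : (t.run [dn r, dn l, dn l, up l, up l, up r]).A}
    {z'' : (t.run [dn r, up r, dn l, up l, dn r, up r]).A}
    (h : t.map (sixUpHead l r) z = z') (h' : t.map (sixUpTail l r) z' = z'') :
    t.map (SoergelToSchur.sixUp l r []) z = z'' := by
  unfold sixUpHead at h
  unfold sixUpTail at h'
  unfold SoergelToSchur.sixUp
  with_reducible exact map_comp_five h h'

-- Both vertical crossings of different colors now carry a difference: the downward one gives `z_r -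
-- z_l`, the upward one `upDiff`. The sideways crossings act trivially on what they meet. The
-- downward divided difference of color `l` sends `1` to `0`, its left variable `z_l` to `-1`, its
-- right variable `z'` to `1` and `z_l z'` to `0`. So `z_r - z_l` becomes `1` and `(z_r - z_l) z'`
-- becomes `z_r`.
include hr in
theorem sixUpHead_apply (ha : t.P (lo l) = X - C a) (hb : t.P (hi l) = X - C b)
    (hc : t.P (hi r) = X - C c) :
    t.map (sixUpHead l r) 1 = t.inclCons (dn r) _ (t.inclCons (dn l) _ (t.inclCons (dn l) _
      (t.inclCons (up l) _ (t.upDiff l r [])))) ∧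
    t.map (sixUpHead l r) (t.inclCons (dn l) _ (t.inclCons (up l) _ (t.inclCons (dn r) _
      (t.inclCons (up r) _ (t.varCons (dn l) [up l]))))) =
    t.varCons (dn r) _ * t.inclCons (dn r) _ (t.inclCons (dn l) _ (t.inclCons (dn l) _
      (t.inclCons (up l) _ (t.upDiff l r [])))) := by
  obtain ⟨hlr, n1, n2, n3⟩ := six_indices hr
  have hlo := lo_eq_hi hr
  obtain ⟨p1, -, -⟩ := six_alphabets hr ha hb hc
  have q1 : (t.run [up l]).P (lo l) =
      (X - C (t.inclRun [up l] a)) * (X - C (t.varCons (up l) [])) :=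
    P_gains_of_linear (l := up l) ha
  have q2 : (t.run [up l]).P (hi l) = 1 := P_of_linear (l := up l) hb
  have q4 : (t.run [up r, dn l, up l]).P (lo r) = (X - C (t.inclCons (up r) _
      (t.varCons (dn l) [up l]))) * (X - C (t.varCons (up r) _)) := by
    have : (t.run [dn l, up l]).P (lo r) = X - C (t.varCons (dn l) [up l]) := by
      rw [hlo]; exact P_gains_of_one (l := dn l) q2
    exact P_gains_of_linear (l := up r) this
  have q5 : (t.run [up l, up r]).P (lo l) = (X - C (t.inclRun [up l, up r] a)) *
      (X - C (t.varCons (up l) _)) := P_gains_of_linear (l := up l) p1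
  have L1 : t.map (Schur.crossL l r [up r, dn l, up l]) 1 = 1 := map_crossL_one hlr.symm _ q4
  have L2 : t.map (Schur.crossL r l [up l]) 1 = 1 := map_crossL_one hlr _ q1
  have L2' : t.map (Schur.crossL r l [up l]) (t.inclCons (up r) _ (t.varCons (dn l) [up l])) =
      t.varCons (dn l) [up r, up l] := by
    -- After `ℰ_{+r}` the alphabet of `hi l` has two elements and does not isolate the variable of
    -- `ℰ_{-l}`. That variable is recovered from strand `lo l`, as the sum `e` of the former
    -- alphabet minus the variable left there; both are intertwined by the crossing.
    have hne : lo l ≠ gains (up r) := by rw [gains, hlo]; exact n1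
    obtain ⟨e, he⟩ : ∃ e, e = t.inclRun [up l] a + t.varCons (up l) [] := ⟨_, rfl⟩
    have h0 : (t.run [dn l, up l]).P (lo l) = X - C (t.inclCons (dn l) _ e -
        t.varCons (dn l) [up l]) := by
      rw [he]; exact P_of_quadratic (l := dn l) q1
    have h0' : (t.run [dn l, up r, up l]).P (lo l) = X - C (t.inclCons (dn l) _
        (t.inclCons (up r) _ e) - t.varCons (dn l) [up r, up l]) := by
      rw [he, map_add (t.inclCons (up r) _)]
      exact P_of_quadratic (l := dn l) (P_of_ne_of_quadratic (l := up r) q1 n2 hne)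
    have h1 : Slides (t.map (Schur.crossL r l [up l])) (t.inclCons (up r) _
        (t.inclCons (dn l) _ e - t.varCons (dn l) [up l])) (t.inclCons (dn l) _
        (t.inclCons (up r) _ e) - t.varCons (dn l) [up r, up l]) :=
      (bal_map t (Schur.crossL r l [up l])).root (j := lo l)
        (P_of_ne_of_linear (l := up r) h0 n2 hne) h0'
    have h2 : Slides (t.map (Schur.crossL r l [up l])) (t.inclCons (up r) _
        (t.inclCons (dn l) _ e)) (t.inclCons (dn l) _ (t.inclCons (up r) _ e)) :=
      (t.run [up l]).sideL_base r l e
    have h3 := (h2.sub h1).apply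
    rw [L2, mul_one, ← map_sub (t.inclCons (up r) _), sub_sub_cancel, sub_sub_cancel] at h3
    exact h3
  obtain ⟨L5, L5'⟩ := map_crossL_self [up l, up r] q5 (t.upDiff l r [])
  obtain ⟨c1, c2, c3, c4⟩ := map_crossDn_self (s := t) l [up l, up l, up r]
    (t.inclCons (up l) _ (t.upDiff l r []))
  have L4 : t.map (.cons (dn l) (Schur.crossUp r l [])) (t.inclCons (dn l) _ 1) =
      t.inclCons (dn l) _ (t.upDiff l r []) := map_cons_eq (dn l) (map_crossUp_upDiff hr [])
  have L4' : t.map (.cons (dn l) (Schur.crossUp r l [])) (t.varCons (dn l) _ *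
      t.inclCons (dn l) _ 1) = t.varCons (dn l) _ * t.inclCons (dn l) _ (t.upDiff l r []) :=
    map_cons_var_mul (dn l) (map_crossUp_upDiff hr [])
  unfold sixUpHead
  constructor
  · have e1 := map_cons_one (dn l) L1
    have e2 := map_cons_one (dn l) (map_cons_one (dn r) (map_cons_one (up l) L2))
    have e3 := map_crossDn_incl (s := t) hr [up l, dn l, up r, up l] 1
    rw [map_one (t.inclCons (dn r) _), map_one (t.inclCons (dn l) _)] at e3
    have k4 := map_cons_eq (up l) L4
    rw [map_one (t.inclCons (dn l) _), map_one (t.inclCons (up l) _)] at k4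
    have e4 := map_cons_sub (dn r) (map_cons_eq (dn l) k4) (map_cons_var_mul (dn l) k4)
    have e5 := map_cons_sub (dn r) (map_cons_eq (dn l) L5) (map_cons_var_mul (dn l) L5)
    have e6 := map_cons_sub (dn r) c1 c2
    rw [map_zero, mul_zero, map_neg, sub_neg_eq_add, zero_add] at e6
    with_reducible exact map_comp_eq (map_comp_eq (map_comp_eq (map_comp_eq (map_comp_eq
      e1 e2) e3) e4) e5) e6
  · have e1 := map_cons_eq (dn l) (map_crossL_incl L1
      (t.inclCons (up r) _ (t.varCons (dn l) [up l])))
    have e2 := map_cons_eq (dn l) (map_cons_eq (dn r) (map_cons_eq (up l) L2'))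
    have e3 := map_crossDn_incl (s := t) hr [up l, dn l, up r, up l]
      (t.inclCons (up l) _ (t.varCons (dn l) [up r, up l]))
    rw [map_one (t.inclCons (dn l) _), mul_one] at L4'
    have k4 := map_cons_eq (up l) L4'
    have e4 := map_cons_sub (dn r) (map_cons_eq (dn l) k4) (map_cons_var_mul (dn l) k4)
    have e5 := map_cons_sub (dn r) (map_cons_eq (dn l) L5') (map_cons_var_mul (dn l) L5')
    have e6 := map_cons_sub (dn r) c3 c4
    rw [map_zero, sub_zero] at e6
    with_reducible exact map_comp_eq (map_comp_eq (map_comp_eq (map_comp_eq (map_comp_eq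
      e1 e2) e3) e4) e5) e6

-- The upward divided difference turns `upDiff` into `1`, and all later diagrams fix `1`. The
-- variable of the leftmost strand `ℰ_{-r}` is not touched.
include hr in
theorem sixUpTail_apply (hb : t.P (hi l) = X - C b) (hc : t.P (hi r) = X - C c) :
    t.map (sixUpTail l r) (t.inclCons (dn r) _ (t.inclCons (dn l) _ (t.inclCons (dn l) _
      (t.inclCons (up l) _ (t.upDiff l r []))))) = 1 ∧
    t.map (sixUpTail l r) (t.varCons (dn r) _ * t.inclCons (dn r) _ (t.inclCons (dn l) _
      (t.inclCons (dn l) _ (t.inclCons (up l) _ (t.upDiff l r []))))) = t.varCons (dn r) _ := by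
  obtain ⟨hlr, n1, n2, n3⟩ := six_indices hr
  have hlo := lo_eq_hi hr
  have p2 : (t.run [up r]).P (hi l) =
      (X - C (t.inclRun [up r] b)) * (X - C (t.varCons (up r) [])) := by
    rw [← hlo] at hb ⊢
    exact P_gains_of_linear (l := up r) hb
  have p3 : (t.run [up r]).P (hi r) = 1 := P_of_linear (l := up r) hc
  have q2 : (t.run [up l, up r]).P (hi l) = X - C (t.inclCons (up l) _
      (t.inclRun [up r] b + t.varCons (up r) []) - t.varCons (up l) _) :=
    P_of_quadratic (l := up l) p2
  have q3 : (t.run [up l, up r]).P (hi r) = 1 :=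
    P_of_ne_of_one (l := up l) p3 n3.symm n2.symm
  have q4 : (t.run [up l, dn r, up r]).P (hi l) = 1 := by
    have : (t.run [dn r, up r]).P (hi l) = X - C (t.inclCons (dn r) _
      (t.inclRun [up r] b + t.varCons (up r) []) - t.varCons (dn r) _) := by
      rw [← hlo] at p2 ⊢
      exact P_of_quadratic (l := dn r) p2
    exact P_of_linear (l := up l) this
  have L7 := map_crossUp_incl_upDiff (s := t) l r []
  have L8 : t.map (Schur.capDU l [up l, up r]) 1 = 1 :=
    capDU_one_of_linear (t.run [up l, up r]) q2
  have L9 : t.map (Schur.cupUD r [up l, up r]) 1 = 1 := cupUD_one_of_one (t.run [up l, up r]) q3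
  have L10 : t.map (Schur.crossR r l [up r]) 1 = 1 := map_crossR_one hlr _ p3
  have L11 : t.map (Schur.crossR l r [up l, dn r, up r]) 1 = 1 := map_crossR_one hlr.symm _ q4
  have k7 := map_cons_eq (dn l) (map_cons_eq (dn l) L7)
  rw [map_one, map_one] at k7
  have k8 := map_cons_one (dn l) L8
  have k9 := map_cons_one (dn l) L9
  have k10 := map_cons_one (dn l) (map_cons_one (up r) L10)
  unfold sixUpTail
  constructor
  · have e7 := map_cons_eq (dn r) k7
    rw [map_one (t.inclCons (dn r) _)] at e7
    have e8 := map_cons_one (dn r) k8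
    have e9 := map_cons_one (dn r) k9
    have e10 := map_cons_one (dn r) k10
    have e11 := map_cons_one (dn r) L11
    with_reducible exact map_comp_eq (map_comp_eq (map_comp_eq (map_comp_eq e7 e8) e9) e10) e11
  · have e7 := map_cons_var_mul (dn r) k7
    rw [map_one (t.inclCons (dn r) _), mul_one] at e7
    have e8 := map_cons_var (dn r) k8
    have e9 := map_cons_var (dn r) k9
    have e10 := map_cons_var (dn r) k10
    have e11 := map_cons_var (dn r) L11
    with_reducible exact map_comp_eq (map_comp_eq (map_comp_eq (map_comp_eq e7 e8) e9) e10) e11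

include hr in
/-- The values of `sixUp` on the generators of the bimodule. -/
theorem sixUp_apply (ha : t.P (lo l) = X - C a) (hb : t.P (hi l) = X - C b)
    (hc : t.P (hi r) = X - C c) : t.map (SoergelToSchur.sixUp l r []) 1 = 1 ∧
    t.map (SoergelToSchur.sixUp l r []) (t.inclCons (dn l) _ (t.inclCons (up l) _
      (t.inclCons (dn r) _ (t.inclCons (up r) _ (t.varCons (dn l) [up l]))))) =
      t.varCons (dn r) _ := by
  obtain ⟨h1, h2⟩ := sixUpHead_apply hr ha hb hc
  obtain ⟨h3, h4⟩ := sixUpTail_apply hr hb hc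
  constructor
  · with_reducible exact sixUp_eq h1 h3
  · with_reducible exact sixUp_eq h2 h4

end Six

end

end WebState

namespace LeftAlg

open EK

variable {d : ℕ}

/-! ## Rings generated by the left and the right action -/

/-- Polynomials are generated by the variables and the rational constants. The map `f` serves only
to place the constants in `T`, since all ring homomorphisms from `ℚ` to a given ring agree. -/
theorem left_mem {B : Type} [CommRing B] {T : Subring B} (ψ : PolyRing d →+* B)
    {M : LeftAlg d} (f : M.A →+* B) (hf : ∀ c : PolyRing d, f (M.left c) ∈ T)
    (hX : ∀ k, ψ (MvPolynomial.X k) ∈ T) (c : PolyRing d) : ψ c ∈ T := by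
  induction c using MvPolynomial.induction_on with
  | C a =>
    have : ψ.comp MvPolynomial.C = (f.comp M.left).comp MvPolynomial.C := Subsingleton.elim _ _
    exact (RingHom.congr_fun this a) ▸ hf (MvPolynomial.C a)
  | add x y hx hy => rw [map_add]; exact T.add_mem hx hy
  | mul_X x k hx => rw [map_mul]; exact T.mul_mem hx (hX k)

theorem ext_mem {M : LeftAlg d} {S : Subalgebra ℚ (PolyRing d)} {T : Subring (M.ext S).A}
    (hl : ∀ f, (M.ext S).left f ∈ T) (hr : ∀ m, M.inr S m ∈ T) (z : (M.ext S).A) : z ∈ T := by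
  induction z using ext_induction with
  | h f m => exact T.mul_mem (hl f) (hr m)
  | hadd x y hx hy => exact T.add_mem hx hy

end LeftAlg

/-! ## Comparison of webs and tensor products -/

open SLetter
open SC (lo hi)
open SoergelToSchur (color)

noncomputable section

variable {n d : ℕ}

/-- The alphabets of `t` have at most one variable, and `φ` identifies these variables with the
negatives of the variables of the left action. -/
structure Matches (hdn : d ≤ n) (t : WebState n) (M : LeftAlg d) (φ : t.A ≃+* M.A) : Prop where
  linear (j : Fin d) : t.P (Fin.castLE hdn j) = X - C (φ.symm (-M.left (MvPolynomial.X j)))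
  trivial (j : Fin n) (h : d ≤ j.1) : t.P j = 1

namespace Matches

variable {hdn : d ≤ n} {t : WebState n} {M : LeftAlg d} {φ : t.A ≃+* M.A}
  (h : Matches hdn t M φ) (i : Fin (d - 1))

/-- The variables on the far left. -/
def leftVar (hdn : d ≤ n) (φ : t.A ≃+* M.A) (i : Fin (d - 1)) (k : Fin d) :
    ((t.step (up (color hdn i))).step (dn (color hdn i))).A :=
  if k = hi i then -(t.step _).var _
  else if k = lo i then (t.step _).var _ + (t.step _).incl _ (t.incl _ (φ.symm
    (M.left (MvPolynomial.X (lo i) + MvPolynomial.X (hi i)))))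
  else (t.step _).incl _ (t.incl _ (φ.symm (M.left (MvPolynomial.X k))))

/-- The left action. -/
def leftHom (hdn : d ≤ n) (φ : t.A ≃+* M.A) (i : Fin (d - 1)) :
    PolyRing d →+* ((t.step (up (color hdn i))).step (dn (color hdn i))).A :=
  MvPolynomial.eval₂Hom (algebraMap ℚ _) (leftVar hdn φ i)

theorem leftHom_X (k : Fin d) : leftHom hdn φ i (MvPolynomial.X k) = leftVar hdn φ i k :=
  MvPolynomial.eval₂_X _ _ _

include h

theorem linear_lo : t.P (lo (color hdn i)) =
    X - C (φ.symm (-M.left (MvPolynomial.X (lo i)))) := h.linear (lo i)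

theorem linear_hi : t.P (hi (color hdn i)) =
    X - C (φ.symm (-M.left (MvPolynomial.X (hi i)))) := h.linear (hi i)

theorem step_lo : (t.step (up (color hdn i))).P (lo (color hdn i)) =
    (X - C (t.incl _ (φ.symm (-M.left (MvPolynomial.X (lo i)))))) *
      (X - C (t.incl _ (φ.symm (-M.left (MvPolynomial.X (hi i)))))) := by
  rw [← WebState.var_of_linear (l := up (color hdn i)) (h.linear_hi i)]
  exact WebState.P_gains_of_linear (l := up (color hdn i)) (h.linear_lo i)

theorem step_hi : (t.step (up (color hdn i))).P (hi (color hdn i)) = 1 :=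
  WebState.P_of_linear (l := up (color hdn i)) (h.linear_hi i)

theorem eval_up : (t.P (WebState.loses (up (color hdn i)))).eval₂
    ((M.inr (EK.invColor i)).comp φ.toRingHom) (-M.inr _ (M.left (MvPolynomial.X (hi i)))) = 0 := by
  rw [WebState.loses, h.linear_hi i]
  simp

/-- The restriction of the comparison map to `ℰ_{+i}`. -/
def upHom : (t.step (up (color hdn i))).A →+* (M.step i).A :=
  t.stepLift (up (color hdn i)) ((M.inr _).comp φ.toRingHom) _ (h.eval_up i)

theorem upHom_incl (c : t.A) : h.upHom i (t.incl _ c) = M.inr _ (φ c) :=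
  t.stepLift_incl _ _ _ _ c

omit h in
theorem inr_quadratic : ((M.step i).left (MvPolynomial.X (hi i)) -
      M.inr _ (M.left (MvPolynomial.X (lo i)))) *
    ((M.step i).left (MvPolynomial.X (hi i)) - M.inr _ (M.left (MvPolynomial.X (hi i)))) = 0 := by
  have h1 := M.inr_left (S := EK.invColor i) (EK.add_mem_inv (lo i) (hi i))
  have h2 := M.inr_left (S := EK.invColor i) (EK.mul_mem_inv (lo i) (hi i))
  simp only [map_add, map_mul] at h1 h2
  linear_combination (-(M.step i).left (MvPolynomial.X (hi i))) * h1 + h2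

theorem eval_dn : ((t.step (up (color hdn i))).P (WebState.loses (dn (color hdn i)))).eval₂
    (h.upHom i) (-(M.step i).left (MvPolynomial.X (hi i))) = 0 := by
  rw [WebState.loses, h.step_lo i]
  have e := inr_quadratic (M := M) i
  rw [eval₂_mul, eval₂_sub, eval₂_sub, eval₂_X, eval₂_C, eval₂_C, upHom_incl, upHom_incl,
    RingEquiv.apply_symm_apply, RingEquiv.apply_symm_apply, map_neg, map_neg]
  linear_combination e

/-- The comparison map for the color `i`. -/
def stepHom : ((t.step (up (color hdn i))).step (dn (color hdn i))).A →+* (M.step i).A :=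
  (t.step _).stepLift (dn (color hdn i)) (h.upHom i) _ (h.eval_dn i)

theorem stepHom_incl (c : t.A) :
    h.stepHom i ((t.step _).incl _ (t.incl _ c)) = M.inr _ (φ c) :=
  ((t.step _).stepLift_incl _ _ _ _ _).trans (h.upHom_incl i c)

theorem stepHom_var : h.stepHom i ((t.step _).var _) =
    -(M.step i).left (MvPolynomial.X (hi i)) := (t.step _).stepLift_var _ _ _ _

theorem stepHom_leftVar (k : Fin d) :
    h.stepHom i (leftVar hdn φ i k) = (M.step i).left (MvPolynomial.X k) := by
  rw [leftVar]
  split_ifs with h1 h2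
  · rw [map_neg, stepHom_var, neg_neg, h1]
  · rw [map_add, stepHom_var, stepHom_incl, RingEquiv.apply_symm_apply, h2,
      M.inr_left (EK.add_mem_inv (lo i) (hi i)), map_add]
    ring
  · rw [stepHom_incl, RingEquiv.apply_symm_apply, M.inr_left (EK.X_mem_inv h2 h1)]

/-- On the generators of the symmetric polynomials: the sum of the images of `x_i` and `x_{i+1}` is
built into `leftVar`, and their product is the quadratic equation of the new variable. This is what
makes the inverse of `stepHom` well defined on the tensor product. -/
theorem leftHom_inv {c : PolyRing d} (hc : c ∈ EK.invColor i) :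
    leftHom hdn φ i c = (t.step _).incl _ (t.incl _ (φ.symm (M.left c))) := by
  have key := EK.eqOn_inv (leftHom hdn φ i) ((((t.step _).incl _).toRingHom.comp
    (t.incl _).toRingHom).comp (φ.symm.toRingHom.comp M.left)) 1 (EK.lo_ne_hi i) ?_ ?_ ?_ hc
  · simpa using key
  · intro k h1 h2
    rw [leftHom_X, leftVar, if_neg h2, if_neg h1]
    rfl
  · rw [map_add (leftHom hdn φ i), leftHom_X, leftHom_X, leftVar, leftVar, if_neg (EK.lo_ne_hi i),
      if_pos rfl, if_pos rfl]
    rw [add_neg_cancel_comm]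
    rfl
  · rw [map_mul (leftHom hdn φ i), leftHom_X, leftHom_X, leftVar, leftVar, if_neg (EK.lo_ne_hi i),
      if_pos rfl, if_pos rfl]
    have e := WebState.var_sq (s := t.step _) (l := dn (color hdn i)) (h.step_lo i)
    simp only [map_neg, map_add, map_mul] at e ⊢
    change _ = (WebState.incl _ _ (WebState.incl _ _ (φ.symm (M.left _))) *
      WebState.incl _ _ (WebState.incl _ _ (φ.symm (M.left _)))) * 1
    linear_combination -e

/-- The map `f ⊗ m ↦ leftHom f * m` is a left inverse, checked on powers of the variable of
`ℰ_{-i}`; the variable of `ℰ_{+i}` already lies in the old ring. The range contains the left action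
and the image of `M`, which generate the tensor product. -/
theorem stepHom_bijective : Function.Bijective (h.stepHom i) := by
  constructor
  · let g : (M.step i).A →+ ((t.step (up (color hdn i))).step (dn (color hdn i))).A :=
      LeftAlg.lift (LeftAlg.pairing (leftHom hdn φ i).toAddMonoidHom
        (((t.step _).incl _).toRingHom.comp ((t.incl _).toRingHom.comp
          φ.symm.toRingHom)).toAddMonoidHom) fun c hc f m => by
        rw [LeftAlg.pairing_apply, LeftAlg.pairing_apply]
        change leftHom hdn φ i (f * c) * WebState.incl _ _ (WebState.incl _ _ (φ.symm m)) =
          leftHom hdn φ i f * WebState.incl _ _ (WebState.incl _ _ (φ.symm (_ * m)))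
        simp only [map_mul, h.leftHom_inv i hc]
        ring
    refine Function.LeftInverse.injective (g := g) fun z => ?_
    have key : ∀ (y : t.A) (k : ℕ), g (h.stepHom i ((t.step _).incl _ (t.incl _ y) *
        (t.step _).var _ ^ k)) = (t.step _).incl _ (t.incl _ y) * (t.step _).var _ ^ k := by
      intro y k
      rw [map_mul, map_pow, stepHom_incl, stepHom_var, mul_comm, ← map_neg, ← map_pow]
      refine (LeftAlg.lift_apply _ _ _ _).trans ?_
      rw [LeftAlg.pairing_apply]
      change leftHom hdn φ i _ * WebState.incl _ _ (WebState.incl _ _ (φ.symm (φ y))) = _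
      rw [map_pow, map_neg, leftHom_X, leftVar, if_pos rfl, neg_neg, RingEquiv.symm_apply_apply,
        mul_comm]
    induction z using WebState.step_induction with
    | h c k =>
      induction c using WebState.step_induction generalizing k with
      | h c m =>
        rw [WebState.var_of_linear (l := up (color hdn i)) (h.linear_hi i), ← map_pow, ← map_mul]
        exact key _ k
      | hadd x y hx hy => rw [map_add, add_mul, map_add, map_add, hx, hy]
    | hadd x y hx hy => rw [map_add, map_add, hx, hy]
  · have : ∀ z, z ∈ (h.stepHom i).range := LeftAlg.ext_mem
      (LeftAlg.left_mem _ (M.inr _) (fun c => ⟨_, (h.stepHom_incl i _).trans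
        (congrArg _ (φ.apply_symm_apply _))⟩) fun k => ⟨_, h.stepHom_leftVar i k⟩)
      fun m => ⟨_, (h.stepHom_incl i (φ.symm m)).trans (congrArg _ (φ.apply_symm_apply _))⟩
    exact this

/-- The comparison isomorphism for the color `i`. -/
def stepEquiv : ((t.step (up (color hdn i))).step (dn (color hdn i))).A ≃+* (M.step i).A :=
  RingEquiv.ofBijective (h.stepHom i) (h.stepHom_bijective i)

theorem stepEquiv_incl (c : t.A) :
    h.stepEquiv i ((t.step _).incl _ (t.incl _ c)) = M.inr _ (φ c) := h.stepHom_incl i c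

theorem stepEquiv_var : h.stepEquiv i ((t.step _).var _) =
    -(M.step i).left (MvPolynomial.X (hi i)) := h.stepHom_var i

theorem stepEquiv_symm_left (k : Fin d) :
    (h.stepEquiv i).symm ((M.step i).left (MvPolynomial.X k)) = leftVar hdn φ i k :=
  (h.stepEquiv i).symm_apply_eq.2 (h.stepHom_leftVar i k).symm

/-- Strand `i + 1` is emptied by `ℰ_{+i}` and receives the variable `-x_{i+1}` of `ℰ_{-i}`; strand
`i` keeps the other root of the quadratic polynomial; the remaining strands do not change. This
allows the recursion over words. -/
theorem step : Matches hdn ((t.step (up (color hdn i))).step (dn (color hdn i))) (M.step i)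
    (h.stepEquiv i) where
  linear k := by
    rw [map_neg, stepEquiv_symm_left, leftVar]
    split_ifs with h1 h2
    · subst h1
      rw [neg_neg]
      exact WebState.P_gains_of_one (l := dn (color hdn i)) (h.step_hi i)
    · subst h2
      refine (WebState.P_of_quadratic (l := dn (color hdn i)) (h.step_lo i)).trans ?_
      congr 2
      simp only [map_neg, map_add]
      ring
    · have e1 : Fin.castLE hdn k ≠ hi (color hdn i) := fun e =>
        h1 (Fin.ext (by simpa [lo, hi, color] using congrArg Fin.val e))
      have e2 : Fin.castLE hdn k ≠ lo (color hdn i) := fun e =>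
        h2 (Fin.ext (by simpa [lo, hi, color] using congrArg Fin.val e))
      refine (WebState.P_of_ne_of_linear (l := dn (color hdn i))
        (WebState.P_of_ne_of_linear (l := up (color hdn i)) (h.linear k) e1 e2) e2 e1).trans ?_
      simp only [map_neg]
  trivial j hj := by
    have e1 : j ≠ hi (color hdn i) := by
      rintro rfl; simp only [hi, color] at hj; omega
    have e2 : j ≠ lo (color hdn i) := by
      rintro rfl; simp only [lo, color] at hj; omega
    exact WebState.P_of_ne_of_one (l := dn (color hdn i))
        (WebState.P_of_ne_of_one (l := up (color hdn i)) (h.trivial j hj) e1 e2) e2 e1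

end Matches

end

/-! ## Comparison of additive maps -/

section Common

variable {A B : Type} [CommRing A] [CommRing B]

/-- The elements whose multiplications are intertwined with the same multiplication by `F` and
`G`. -/
def commonSlides (F G : A →+ B) : Subring A where
  carrier := {a | ∃ b, (∀ z, F (a * z) = b * F z) ∧ ∀ z, G (a * z) = b * G z}
  zero_mem' := ⟨0, by simp, by simp⟩
  one_mem' := ⟨1, by simp, by simp⟩
  add_mem' := by
    rintro a b ⟨a', h1, h2⟩ ⟨b', h3, h4⟩
    exact ⟨a' + b', fun z => by rw [add_mul, map_add, h1, h3, add_mul],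
      fun z => by rw [add_mul, map_add, h2, h4, add_mul]⟩
  mul_mem' := by
    rintro a b ⟨a', h1, h2⟩ ⟨b', h3, h4⟩
    exact ⟨a' * b', fun z => by rw [mul_assoc, h1, h3, mul_assoc],
      fun z => by rw [mul_assoc, h2, h4, mul_assoc]⟩
  neg_mem' := by
    rintro a ⟨a', h1, h2⟩
    exact ⟨-a', fun z => by rw [neg_mul, map_neg, h1, neg_mul],
      fun z => by rw [neg_mul, map_neg, h2, neg_mul]⟩

/-- The ring `K + K w`, where `w` is quadratic over the ring `K`. -/
def quadraticRing (K : Subring A) (w : A) {p q : A} (hp : p ∈ K) (hq : q ∈ K)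
    (hw : w * w = p + q * w) : Subring A where
  carrier := {z | ∃ a ∈ K, ∃ b ∈ K, z = a + b * w}
  zero_mem' := ⟨0, K.zero_mem, 0, K.zero_mem, by simp⟩
  one_mem' := ⟨1, K.one_mem, 0, K.zero_mem, by simp⟩
  add_mem' := by
    rintro _ _ ⟨a, ha, b, hb, rfl⟩ ⟨a', ha', b', hb', rfl⟩
    exact ⟨a + a', K.add_mem ha ha', b + b', K.add_mem hb hb', by ring⟩
  mul_mem' := by
    rintro _ _ ⟨a, ha, b, hb, rfl⟩ ⟨a', ha', b', hb', rfl⟩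
    exact ⟨a * a' + b * b' * p, K.add_mem (K.mul_mem ha ha') (K.mul_mem (K.mul_mem hb hb') hp),
      a * b' + b * a' + b * b' * q, K.add_mem (K.add_mem (K.mul_mem ha hb') (K.mul_mem hb ha'))
        (K.mul_mem (K.mul_mem hb hb') hq), by linear_combination b * b' * hw⟩
  neg_mem' := by
    rintro _ ⟨a, ha, b, hb, rfl⟩
    exact ⟨-a, K.neg_mem ha, -b, K.neg_mem hb, by ring⟩

/-- Let `K` be the ring of common slides. Since `w` is quadratic over `K`, the set `K + K w` is a
ring, hence everything by `hgen`; on `a + b w` both maps are determined by their values at `1` and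
`w`. -/
theorem eq_of_generated {F G : A →+ B} (w : A) {p q : A} (hp : p ∈ commonSlides F G)
    (hq : q ∈ commonSlides F G) (hw : w * w = p + q * w)
    (hgen : ∀ T : Subring A, commonSlides F G ≤ T → w ∈ T → ∀ z, z ∈ T) (h1 : F 1 = G 1)
    (h2 : F w = G w) (z : A) : F z = G z := by
  obtain ⟨a, ⟨a', ha, ha'⟩, b, ⟨b', hb, hb'⟩, rfl⟩ :=
    hgen (quadraticRing _ w hp hq hw)
      (fun a ha => ⟨a, ha, 0, (commonSlides F G).zero_mem, by simp⟩)
      ⟨0, (commonSlides F G).zero_mem, 1, (commonSlides F G).one_mem, by simp⟩ z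
  have e1 := ha 1
  have e2 := ha' 1
  rw [mul_one] at e1 e2
  rw [map_add, map_add, e1, e2, hb, hb', h1, h2]

end Common

open SLetter
open SC (lo hi)
open SoergelToSchur (color)

noncomputable section

variable {n d : ℕ} {hdn : d ≤ n} {t : WebState n} {u v : List (SLetter n)}

/-- The image of a diagram, transported along comparison isomorphisms. -/
def transported (D : Diag (SSig n) u v) {N N' : LeftAlg d} (φ₁ : (t.run u).A ≃+* N.A)
    (φ₂ : (t.run v).A ≃+* N'.A) : N.A →+ N'.A :=
  φ₂.toAddMonoidHom.comp ((t.map D).toAddMonoidHom.comp φ₁.symm.toAddMonoidHom)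

section

variable {D : Diag (SSig n) u v} {N N' : LeftAlg d} {φ₁ : (t.run u).A ≃+* N.A}
    {φ₂ : (t.run v).A ≃+* N'.A}

theorem transported_apply (z : (t.run u).A) :
    transported D φ₁ φ₂ (φ₁ z) = φ₂ (t.map D z) :=
  congrArg (fun z => φ₂ (t.map D z)) (φ₁.symm_apply_apply z)

theorem transported_slides {a : (t.run u).A} {a' : (t.run v).A} (h : Slides (t.map D) a a')
    (z : N.A) : transported D φ₁ φ₂ (φ₁ a * z) = φ₂ a' * transported D φ₁ φ₂ z := by
  obtain ⟨z, rfl⟩ := φ₁.surjective z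
  rw [← map_mul, transported_apply, transported_apply, h, map_mul]

/-- On the far left each strand carries one variable, identified with `-x_j` on both sides, so
balancedness of the diagram gives linearity for each `x_j`, and rational constants are uniquely
placed. -/
theorem transported_left (h₁ : Matches hdn (t.run u) N φ₁) (h₂ : Matches hdn (t.run v) N' φ₂)
    (f : PolyRing d) (z : N.A) :
    transported D φ₁ φ₂ (N.left f * z) = N'.left f * transported D φ₁ φ₂ z := by
  induction f using MvPolynomial.induction_on generalizing z with
  | C a =>
    have e1 : φ₁ (algebraMap ℚ _ a) = N.left (MvPolynomial.C a) :=
      RingHom.congr_fun (Subsingleton.elim (φ₁.toRingHom.comp (algebraMap ℚ _))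
        (N.left.comp MvPolynomial.C)) a
    have e2 : φ₂ (algebraMap ℚ _ a) = N'.left (MvPolynomial.C a) :=
      RingHom.congr_fun (Subsingleton.elim (φ₂.toRingHom.comp (algebraMap ℚ _))
        (N'.left.comp MvPolynomial.C)) a
    rw [← e1, ← e2]
    refine transported_slides (fun z => ?_) z
    rw [← Algebra.smul_def, ← Algebra.smul_def, map_smul]
  | add f g hf hg => rw [map_add, map_add, add_mul, map_add, hf, hg, add_mul]
  | mul_X f k hf =>
    have e := transported_slides (φ₁ := φ₁) (φ₂ := φ₂)
      ((t.bal_map D).root (h₁.linear k) (h₂.linear k)).neg z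
    simp only [map_neg, RingEquiv.apply_symm_apply, neg_neg] at e
    rw [map_mul N.left, map_mul N'.left, mul_assoc, hf, e, mul_assoc]

variable {M : LeftAlg d} {φ : t.A ≃+* M.A} {ι₁ : M.A →+* N.A} {ι₂ : M.A →+* N'.A}
  {G : N.A →ₗ[PolyRing d] N'.A}

theorem left_mem_commonSlides (h₁ : Matches hdn (t.run u) N φ₁)
    (h₂ : Matches hdn (t.run v) N' φ₂) (f : PolyRing d) :
    N.left f ∈ commonSlides (transported D φ₁ φ₂) G.toAddMonoidHom :=
  ⟨N'.left f, transported_left h₁ h₂ f, LeftAlg.map_left G f⟩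

theorem right_mem_commonSlides (hι₁ : ∀ c, φ₁ (t.inclRun u c) = ι₁ (φ c))
    (hι₂ : ∀ c, φ₂ (t.inclRun v c) = ι₂ (φ c)) (hG : ∀ m z, G (ι₁ m * z) = ι₂ m * G z) (m : M.A) :
    ι₁ m ∈ commonSlides (transported D φ₁ φ₂) G.toAddMonoidHom := by
  refine ⟨ι₂ m, ?_, hG m⟩
  obtain ⟨c, rfl⟩ := φ.surjective m
  rw [← hι₁, ← hι₂]
  exact transported_slides (t.base_map c D)

/-- A bimodule map is determined by its values on generators of its source. -/
theorem map_eq_of_generated (h₁ : Matches hdn (t.run u) N φ₁) (h₂ : Matches hdn (t.run v) N' φ₂)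
    (hι₁ : ∀ c, φ₁ (t.inclRun u c) = ι₁ (φ c)) (hι₂ : ∀ c, φ₂ (t.inclRun v c) = ι₂ (φ c))
    (hG : ∀ m z, G (ι₁ m * z) = ι₂ m * G z) (w : (t.run u).A) {p q : N.A}
    (hpq : ∀ K : Subring N.A, (∀ f, N.left f ∈ K) → (∀ m, ι₁ m ∈ K) → p ∈ K ∧ q ∈ K)
    (hw : φ₁ w * φ₁ w = p + q * φ₁ w)
    (hgen : ∀ T : Subring N.A, (∀ f, N.left f ∈ T) → (∀ m, ι₁ m ∈ T) → φ₁ w ∈ T → ∀ z, z ∈ T)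
    (h1 : φ₂ (t.map D 1) = G 1) (h2 : φ₂ (t.map D w) = G (φ₁ w)) (z : (t.run u).A) :
    φ₂ (t.map D z) = G (φ₁ z) := by
  obtain ⟨hp, hq⟩ := hpq _ (left_mem_commonSlides (D := D) (G := G) h₁ h₂)
    (right_mem_commonSlides hι₁ hι₂ hG)
  rw [← transported_apply (φ₁ := φ₁)]
  refine eq_of_generated (G := G.toAddMonoidHom) (φ₁ w) hp hq hw (fun T hK => hgen T
    (fun f => hK (left_mem_commonSlides h₁ h₂ f))
    fun m => hK (right_mem_commonSlides hι₁ hι₂ hG m)) ?_ ?_ (φ₁ z)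
  · have e := transported_apply (D := D) (φ₁ := φ₁) (φ₂ := φ₂) 1
    rw [map_one φ₁] at e
    exact e.trans h1
  · exact (transported_apply w).trans h2

/-- A bimodule map whose source is generated by `1` is determined by the image of `1`. -/
theorem map_eq_of_one (h₁ : Matches hdn (t.run u) N φ₁) (h₂ : Matches hdn (t.run v) N' φ₂)
    (hι₁ : ∀ c, φ₁ (t.inclRun u c) = ι₁ (φ c)) (hι₂ : ∀ c, φ₂ (t.inclRun v c) = ι₂ (φ c))
    (hG : ∀ m z, G (ι₁ m * z) = ι₂ m * G z)
    (hgen : ∀ T : Subring N.A, (∀ f, N.left f ∈ T) → (∀ m, ι₁ m ∈ T) → ∀ z, z ∈ T)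
    (h1 : φ₂ (t.map D 1) = G 1) (z : (t.run u).A) : φ₂ (t.map D z) = G (φ₁ z) :=
  map_eq_of_generated h₁ h₂ hι₁ hι₂ hG 0 (p := 0) (q := 0)
    (fun K _ _ => ⟨K.zero_mem, K.zero_mem⟩) (by simp) (fun T hl hr _ => hgen T hl hr) h1
    (by simp) z

end

end

/-! ## The Elias–Khovanov maps are linear over the ring on the right -/

namespace LeftAlg

open SC (lo hi)
open EK

noncomputable section

variable {d : ℕ}

theorem lift_inr {M : LeftAlg d} {S : Subalgebra ℚ (PolyRing d)} {N : Type} [CommRing N]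
    {β : PolyRing d →+ M.A →+ N} {hβ : ∀ c ∈ S, ∀ f m, β (f * c) m = β f (M.left c * m)} {a : M.A}
    {b : N} (h : ∀ f m, β f (a * m) = b * β f m) (z : (M.ext S).A) :
    lift β hβ (M.inr S a * z) = b * lift β hβ z := by
  induction z using ext_induction with
  | h f m => rw [mul_left_comm, ← map_mul, lift_apply, lift_apply, h]
  | hadd x y hx hy => rw [mul_add, map_add, map_add, mul_add, hx, hy]

theorem liftLin_inr {M N : LeftAlg d} {S : Subalgebra ℚ (PolyRing d)} {ψ : M.A →+ N.A}
    {hψ : ∀ c ∈ S, ∀ m, ψ (M.left c * m) = N.left c * ψ m} {a : M.A} {b : N.A}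
    (h : ∀ m, ψ (a * m) = b * ψ m) (z : (M.ext S).A) :
    liftLin ψ hψ (M.inr S a * z) = b * liftLin ψ hψ z := by
  induction z using ext_induction with
  | h f m => rw [mul_left_comm, ← map_mul, liftLin_apply, liftLin_apply, h, mul_left_comm]
  | hadd x y hx hy => rw [mul_add, map_add, map_add, mul_add, hx, hy]

theorem liftLin_of_inr {M N : LeftAlg d} {S : Subalgebra ℚ (PolyRing d)} (ψ : M.A →+ N.A)
    (hψ : ∀ c ∈ S, ∀ m, ψ (M.left c * m) = N.left c * ψ m) (m : M.A) :
    liftLin ψ hψ (M.inr S m) = ψ m := by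
  have := liftLin_apply ψ hψ 1 m
  rwa [map_one, map_one, one_mul, one_mul] at this

theorem liftLin_one {M N : LeftAlg d} {S : Subalgebra ℚ (PolyRing d)} (ψ : M.A →+ N.A)
    (hψ : ∀ c ∈ S, ∀ m, ψ (M.left c * m) = N.left c * ψ m) :
    liftLin (S := S) ψ hψ 1 = ψ 1 := by
  rw [← map_one (M.inr S), liftLin_of_inr]

variable (M : LeftAlg d) (i : Fin (d - 1))

theorem endDot_inr (m : M.A) (z : (M.step i).A) :
    M.endDot i (M.inr _ m * z) = m * M.endDot i z :=
  liftLin_inr (fun _ => rfl) z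

theorem endDot_one : M.endDot i 1 = 1 := liftLin_one _ _

theorem startDot_mul (m z : M.A) : M.startDot i (m * z) = M.inr _ m * M.startDot i z := by
  change _ * M.inr _ (m * z) - M.inr _ (_ * (m * z)) =
    M.inr _ m * (_ * M.inr _ z - M.inr _ (_ * z))
  simp only [map_mul]
  ring

theorem startDot_one : M.startDot i 1 = (M.step i).left (MvPolynomial.X (lo i)) -
    M.inr _ (M.left (MvPolynomial.X (hi i))) := by
  change _ * M.inr _ 1 - M.inr _ (_ * 1) = _
  rw [map_one, mul_one, mul_one]

theorem demazure_inr (p q : Fin d) (hpq : p ≠ q) (h : inv p q = invColor i) (m : M.A)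
    (z : (M.step i).A) : M.demazure i p q hpq h (M.inr _ m * z) = m * M.demazure i p q hpq h z :=
  lift_inr (fun _ y => mul_left_comm _ m y) z

theorem demazure_of_left (p q : Fin d) (hpq : p ≠ q) (h : inv p q = invColor i) (f : PolyRing d) :
    M.demazure i p q hpq h ((M.step i).left f) = M.left (dd p q f) := by
  have := M.demazure_apply i p q hpq h f 1
  rwa [map_one, mul_one, mul_one] at this

theorem dd_one {p q : Fin d} (hpq : p ≠ q) : dd p q 1 = 0 := by
  have := dd_spec p q 1
  rw [map_one, sub_self, zero_eq_mul] at this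
  exact this.resolve_left (X_sub_X_ne hpq)

theorem dd_X_left {p q : Fin d} (hpq : p ≠ q) : dd p q (MvPolynomial.X p) = 1 := by
  have := dd_spec p q (MvPolynomial.X p)
  rw [MvPolynomial.rename_X, Equiv.swap_apply_left] at this
  exact (mul_left_cancel₀ (X_sub_X_ne hpq) ((mul_one _).trans this)).symm

theorem dd_X_right {p q : Fin d} (hpq : p ≠ q) : dd p q (MvPolynomial.X q) = -1 := by
  have := dd_spec p q (MvPolynomial.X q)
  rw [MvPolynomial.rename_X, Equiv.swap_apply_right] at this
  refine (mul_left_cancel₀ (X_sub_X_ne hpq) ?_).symm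
  rw [← this]
  ring

theorem demazure_one (p q : Fin d) (hpq : p ≠ q) (h : inv p q = invColor i) :
    M.demazure i p q hpq h 1 = 0 := by
  rw [← map_one (M.step i).left, demazure_of_left, dd_one hpq, map_zero]

theorem merge_inr (m : M.A) (z : ((M.step i).step i).A) :
    M.merge i ((M.step i).inr _ (M.inr _ m) * z) = M.inr _ m * M.merge i z := by
  refine liftLin_inr (fun y => ?_) z
  change M.inr _ (M.demazure i _ _ _ _ (M.inr _ m * y)) = _ * M.inr _ (M.demazure i _ _ _ _ y)
  rw [demazure_inr, map_mul]

theorem merge_one : M.merge i 1 = 0 := by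
  refine (liftLin_one _ _).trans ?_
  change M.inr _ (M.demazure i _ _ _ _ 1) = 0
  rw [demazure_one, map_zero]

theorem merge_X : M.merge i ((M.step i).inr _ ((M.step i).left (MvPolynomial.X (hi i)))) = -1 := by
  refine (liftLin_of_inr _ _ _).trans ?_
  change M.inr _ (M.demazure i _ _ _ _ _) = _
  rw [demazure_of_left, dd_X_right (lo_ne_hi i), map_neg, map_neg, map_one, map_one]

theorem split_inr (m : M.A) (z : (M.step i).A) :
    M.split i (M.inr _ m * z) = (M.step i).inr _ (M.inr _ m) * M.split i z := by
  refine liftLin_inr (fun y => ?_) z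
  change (M.step i).inr _ (M.inr _ (m * y)) = _ * (M.step i).inr _ (M.inr _ y)
  rw [map_mul, map_mul]

theorem split_one : M.split i 1 = 1 := by
  refine (liftLin_one _ _).trans ?_
  change (M.step i).inr _ (M.inr _ 1) = 1
  rw [map_one, map_one]

variable {i} {j : Fin (d - 1)}

theorem four_inr (h : SC.Dist i j) (m : M.A) (z : ((M.step j).step i).A) :
    M.four h ((M.step j).inr _ (M.inr _ m) * z) = (M.step i).inr _ (M.inr _ m) * M.four h z := by
  refine liftLin_inr (fun y => lift_inr (fun f x => ?_) y) z
  rw [pairing_apply, pairing_apply]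
  change _ * (M.step i).inr _ (M.inr _ (m * x)) = _ * (_ * (M.step i).inr _ (M.inr _ x))
  rw [map_mul, map_mul]
  ring

theorem four_map_one (h : SC.Dist i j) : M.four h 1 = 1 := by
  refine (liftLin_one _ _).trans ?_
  have := lift_apply (M := M) (S := invColor j) (pairing (M.fourEval i j).toAddMonoidHom
    (((M.step i).inr (invColor j)).comp (M.inr (invColor i))).toAddMonoidHom) (fun c hc f m => by
    simp [pairing_apply, M.fourEval_j h hc, mul_assoc]) 1 1
  rw [map_one, map_one, one_mul] at this
  refine this.trans ?_
  rw [pairing_apply]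
  change M.fourEval i j 1 * (M.step i).inr _ (M.inr _ 1) = 1
  rw [map_one, map_one, map_one, one_mul]

/-- `m ↦ 1 ⊗ 1 ⊗ 1 ⊗ m`. -/
def inr₃ (i j : Fin (d - 1)) : M.A →+* (((M.step i).step j).step i).A :=
  (((M.step i).step j).inr _).comp (((M.step i).inr _).comp (M.inr _))

theorem sixOut_inr (t : Triple i j) (m : M.A) (z : (M.sixMid i j).A) :
    M.sixOut t ((M.step i).inr _ (M.inr _ m) * z) = M.inr₃ j i m * M.sixOut t z := by
  refine liftLin_inr (fun y => ?_) z
  change M.inr₃ j i (M.demazure i _ _ _ _ (M.inr _ m * y)) =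
    _ * M.inr₃ j i (M.demazure i _ _ _ _ y)
  rw [demazure_inr, map_mul]

theorem sixIn_inr (t : Triple i j) (m : (M.step i).A) (z : ((M.step i).step j).A) :
    M.sixIn t ((M.step i).inr _ m * z) = (M.step i).inr _ m * M.sixIn t z := by
  refine lift_inr (fun f x => ?_) z
  rw [pairing_apply, pairing_apply]
  change _ * (M.step i).inr _ (m * x) = _ * (_ * (M.step i).inr _ x)
  rw [map_mul]
  ring

theorem sixIn_left (t : Triple i j) (f : PolyRing d) :
    M.sixIn t (((M.step i).step j).left f) = M.sixEval t f * M.sixDelta t := by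
  have := lift_apply (M := M.step i) (S := invColor j)
    (pairing ((AddMonoidHom.mulRight (M.sixDelta t)).comp (M.sixEval t).toAddMonoidHom)
    ((M.step i).inr (inv₂ i j)).toAddMonoidHom) (fun c hc f m => by
    have := M.sixEval_j t hc
    change M.sixEval t (f * c) * M.sixDelta t * (M.step i).inr _ m =
      M.sixEval t f * M.sixDelta t * (M.step i).inr _ ((M.step i).left c * m)
    rw [map_mul, map_mul]
    change _ = M.sixEval t f * M.sixDelta t * (M.inner i j c * _)
    linear_combination M.sixEval t f * (M.step i).inr _ m * this) f 1
  rw [map_one, mul_one] at this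
  refine this.trans ?_
  rw [pairing_apply]
  change M.sixEval t f * M.sixDelta t * (M.step i).inr _ 1 = _
  rw [map_one, mul_one]

theorem sixOut_apply (t : Triple i j) (f : PolyRing d) (z : (M.step i).A) :
    M.sixOut t ((M.sixMid i j).left f * (M.step i).inr _ z) =
      (((M.step j).step i).step j).left f *
        M.inr₃ j i (M.demazure i t.p t.q t.hpq t.inv_i z) :=
  liftLin_apply _ _ f z

theorem sixOut_inner (t : Triple i j) (f : PolyRing d) :
    M.sixOut t (M.inner i j f) = M.inr₃ j i (M.left (dd t.p t.q f)) := by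
  have := M.sixOut_apply t 1 ((M.step i).left f)
  rwa [map_one, map_one, one_mul, one_mul, demazure_of_left] at this

theorem sixOut_left (t : Triple i j) (f : PolyRing d) :
    M.sixOut t ((M.sixMid i j).left f) = 0 := by
  have := M.sixOut_apply t f 1
  rwa [map_one, mul_one, demazure_one, map_zero, mul_zero] at this

theorem six_apply (h : SC.Adj i j) (f : PolyRing d) (z : ((M.step i).step j).A) :
    M.six h ((((M.step i).step j).step i).left f * ((M.step i).step j).inr _ z) =
      (((M.step j).step i).step j).left f *
        M.sixOut (Triple.ofAdj h) (M.sixIn (Triple.ofAdj h) z) := by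
  unfold six
  exact liftLin_apply _ _ f z

theorem six_of_inr (h : SC.Adj i j) (z : ((M.step i).step j).A) :
    M.six h (((M.step i).step j).inr _ z) =
      M.sixOut (Triple.ofAdj h) (M.sixIn (Triple.ofAdj h) z) := by
  have := M.six_apply h 1 z
  rwa [map_one, map_one, one_mul, one_mul] at this

theorem six_inr (h : SC.Adj i j) (m : M.A) (z : (((M.step i).step j).step i).A) :
    M.six h (M.inr₃ i j m * z) = M.inr₃ j i m * M.six h z := by
  induction z using ext_induction with
  | h f y =>
    have e : M.inr₃ i j m * ((((M.step i).step j).step i).left f * ((M.step i).step j).inr _ y) =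
        (((M.step i).step j).step i).left f *
          ((M.step i).step j).inr _ ((M.step i).inr _ (M.inr _ m) * y) := by
      rw [map_mul]
      exact mul_left_comm _ _ _
    rw [e, six_apply, six_apply, sixIn_inr, sixOut_inr, mul_left_comm]
  | hadd x y hx hy => rw [mul_add, map_add, map_add, mul_add, hx, hy]

/-- The inner map sends `1` to `1 ⊗ x_p ⊗ 1 - x_r ⊗ 1 ⊗ 1`; the divided difference takes `x_p` to
`1` and kills the second term. -/
theorem six_map_one (h : SC.Adj i j) : M.six h 1 = 1 := by
  rw [← map_one (((M.step i).step j).inr _), six_of_inr, ← map_one ((M.step i).step j).left,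
    sixIn_left, map_one, one_mul, sixDelta, map_sub, sixOut_inner, sixOut_left,
    dd_X_left (Triple.hpq _), map_one, map_one, sub_zero]

/-- The element to be mapped by the divided difference is `x_p ^ 2 - x_r x_p`, with `x_r` acting
from the left, and `∂(x_p ^ 2) = x_p + x_q`, `∂(x_p) = 1`. -/
theorem six_X (h : SC.Adj i j) : M.six h (((M.step i).step j).inr _
      (((M.step i).step j).left (MvPolynomial.X (Triple.ofAdj h).p))) =
    M.inr₃ j i (M.left (MvPolynomial.X (Triple.ofAdj h).p + MvPolynomial.X (Triple.ofAdj h).q)) -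
      (((M.step j).step i).step j).left (MvPolynomial.X (Triple.ofAdj h).r) := by
  rw [six_of_inr]
  generalize Triple.ofAdj h = t
  have e : dd t.p t.q (MvPolynomial.X t.p * MvPolynomial.X t.p) =
      MvPolynomial.X t.p + MvPolynomial.X t.q := by
    have := dd_spec t.p t.q (MvPolynomial.X t.p * MvPolynomial.X t.p)
    rw [map_mul, MvPolynomial.rename_X, Equiv.swap_apply_left] at this
    refine mul_left_cancel₀ (X_sub_X_ne t.hpq) ?_
    rw [← this]
    ring
  rw [sixIn_left, sixEval, evalAt_X, if_pos rfl, sixDelta, mul_sub, ← map_mul, map_sub,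
    sixOut_inner, e, mul_comm, map_left, sixOut_inner, dd_X_left t.hpq, map_one, map_one, mul_one]

end

end LeftAlg

open SLetter
open SC (lo hi)
open SoergelToSchur (color)

noncomputable section

namespace Matches

variable {n d : ℕ} {hdn : d ≤ n} {t : WebState n} {M : LeftAlg d} {φ : t.A ≃+* M.A}
  (h : Matches hdn t M φ) (i : Fin (d - 1))

/-! ## Comparison on generating diagrams -/

theorem endDot (z : (t.run [dn (color hdn i), up (color hdn i)]).A) :
    φ (t.map (Schur.capDU (color hdn i) []) z) = M.endDot i (h.stepEquiv i z) := by
  refine map_eq_of_one (u := [dn (color hdn i), up (color hdn i)]) (v := []) (h.step i) h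
    (ι₁ := M.inr _) (ι₂ := RingHom.id _) (h.stepEquiv_incl i) (fun _ => rfl) (M.endDot_inr i)
    (fun T hl hr => LeftAlg.ext_mem hl hr) ?_ z
  rw [M.endDot_one, ← map_one φ]
  exact congrArg φ (t.capDU_one_of_linear (h.linear_hi i))

/-- The cup is the variable of `ℰ_{-i}` minus the variable of strand `i`, that is `-x_{i+1} ⊗ 1 + 1
⊗ x_i`. This is the Elias–Khovanov element because `x_i + x_{i+1}` passes through the tensor
product. -/
theorem startDot (z : t.A) : h.stepEquiv i (t.map (Schur.cupDU (color hdn i) []) z) =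
    M.startDot i (φ z) := by
  refine map_eq_of_one (u := []) (v := [dn (color hdn i), up (color hdn i)]) h (h.step i)
    (ι₁ := RingHom.id _) (ι₂ := M.inr _) (fun _ => rfl) (h.stepEquiv_incl i) (M.startDot_mul i)
    (fun T hl hr => hr) ?_ z
  rw [M.startDot_one]
  refine (congrArg (h.stepEquiv i) (t.cupDU_one_of_linear (h.linear_lo i))).trans ?_
  have e := M.inr_left (S := EK.invColor i) (EK.add_mem_inv (lo i) (hi i))
  rw [map_add, map_add, map_add] at e
  rw [map_sub, stepEquiv_var, stepEquiv_incl, RingEquiv.apply_symm_apply, map_neg]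
  linear_combination e

/-- The cup inside is inserted where `ℰ_{+i}` has emptied strand `i + 1`, so it sends `1` to `1`. -/
theorem split (z : (t.run [dn (color hdn i), up (color hdn i)]).A) :
    (h.step i).stepEquiv i (t.map (SoergelToSchur.split (color hdn i) []) z) =
      M.split i (h.stepEquiv i z) := by
  refine map_eq_of_one (u := [dn (color hdn i), up (color hdn i)])
    (v := [dn (color hdn i), up (color hdn i), dn (color hdn i), up (color hdn i)])
    (h.step i) ((h.step i).step i) (ι₁ := M.inr _) (ι₂ := ((M.step i).inr _).comp (M.inr _))
    (h.stepEquiv_incl i) (fun c => ?_) (M.split_inr i) (fun T hl hr => LeftAlg.ext_mem hl hr) ?_ z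
  · exact ((h.step i).stepEquiv_incl i _).trans (congrArg _ (h.stepEquiv_incl i c))
  · rw [M.split_one, ← map_one ((h.step i).stepEquiv i)]
    exact congrArg _ (WebState.map_cons_one (dn (color hdn i))
      ((t.step _).cupUD_one_of_one (h.step_hi i)))

/-- The source is generated by `1` and `w = -1 ⊗ x_{i+1} ⊗ 1`, which satisfies `w ^ 2 = -x_i x_{i+1}
- (x_i + x_{i+1}) w` with coefficients acting from the left. The cap is the trace with values `0`
and `1` on `1` and `w`, matching `∂_i(1) = 0` and `∂_i(-x_{i+1}) = 1`. -/
theorem merge (z : (t.run [dn (color hdn i), up (color hdn i), dn (color hdn i),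
      up (color hdn i)]).A) :
    h.stepEquiv i (t.map (SoergelToSchur.merge (color hdn i) []) z) =
      M.merge i ((h.step i).stepEquiv i z) := by
  have e1 := (M.step i).inr_left (S := EK.invColor i) (EK.add_mem_inv (lo i) (hi i))
  have e2 := (M.step i).inr_left (S := EK.invColor i) (EK.mul_mem_inv (lo i) (hi i))
  have hv : (h.step i).stepEquiv i (WebState.incl _ _ (WebState.incl _ _
      ((t.step (up (color hdn i))).var (dn (color hdn i))))) =
      -(M.step i).inr _ ((M.step i).left (MvPolynomial.X (hi i))) := by
    rw [(h.step i).stepEquiv_incl i, stepEquiv_var, map_neg]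
  refine map_eq_of_generated
    (u := [dn (color hdn i), up (color hdn i), dn (color hdn i), up (color hdn i)])
    (v := [dn (color hdn i), up (color hdn i)])
    ((h.step i).step i) (h.step i) (ι₁ := ((M.step i).inr _).comp (M.inr _)) (ι₂ := M.inr _)
    (fun c => ?_) (h.stepEquiv_incl i) (M.merge_inr i)
    (WebState.incl _ _ (WebState.incl _ _ ((t.step (up (color hdn i))).var (dn (color hdn i)))))
    (p := -((M.step i).step i).left (MvPolynomial.X (lo i) * MvPolynomial.X (hi i)))
    (q := -((M.step i).step i).left (MvPolynomial.X (lo i) + MvPolynomial.X (hi i)))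
    (fun K hl _ => ⟨K.neg_mem (hl _), K.neg_mem (hl _)⟩) ?_ (fun T hl hr hw => ?_) ?_ ?_ z
  · exact ((h.step i).stepEquiv_incl i _).trans (congrArg _ (h.stepEquiv_incl i c))
  · refine (congrArg₂ (· * ·) hv hv).trans (Eq.trans ?_
      (congrArg (fun x => -_ + -_ * x) hv.symm))
    rw [← e1, ← e2]
    simp only [map_add, map_mul]
    ring
  · replace hw : (M.step i).inr _ ((M.step i).left (MvPolynomial.X (hi i))) ∈ T :=
      neg_neg ((M.step i).inr _ ((M.step i).left (MvPolynomial.X (hi i)))) ▸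
        T.neg_mem ((congrArg (· ∈ T) hv).mp hw)
    refine LeftAlg.ext_mem hl fun m => ?_
    refine LeftAlg.ext_mem (T := T.comap ((M.step i).inr _)) (fun f => ?_) hr m
    refine LeftAlg.left_mem (((M.step i).inr _).comp (M.step i).left)
      (RingHom.id ((M.step i).step i).A) hl (fun k => ?_) f
    by_cases h1 : k = hi i
    · rw [h1]; exact hw
    by_cases h2 : k = lo i
    · have e : ((M.step i).inr _).comp (M.step i).left (MvPolynomial.X k) =
          ((M.step i).step i).left (MvPolynomial.X (lo i) + MvPolynomial.X (hi i)) -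
            (M.step i).inr _ ((M.step i).left (MvPolynomial.X (hi i))) := by
        rw [← e1, h2, map_add, map_add, add_sub_cancel_right]
        rfl
      rw [e]
      exact T.sub_mem (hl _) hw
    · rw [RingHom.comp_apply, LeftAlg.inr_left _ (EK.X_mem_inv h2 h1)]
      exact hl _
  · rw [M.merge_one, ← map_zero (h.stepEquiv i)]
    refine congrArg _ ?_
    have e : t.map (Schur.capUD (color hdn i) [up (color hdn i)]) 1 = 0 :=
      ((t.step _).capUD_one _).trans (WebState.trace_one (l := dn (color hdn i)) (h.step_lo i))
    have k := WebState.map_cons_eq (dn (color hdn i)) e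
    rw [map_one, map_zero] at k
    exact k
  · have e : t.map (Schur.capUD (color hdn i) [up (color hdn i)])
        (((t.step (up (color hdn i))).step (dn (color hdn i))).incl (up (color hdn i))
          ((t.step (up (color hdn i))).var (dn (color hdn i)))) = 1 :=
      ((t.step _).capUD_incl _ _).trans (WebState.trace_var (l := dn (color hdn i)) (h.step_lo i))
    have k := WebState.map_cons_eq (dn (color hdn i)) e
    rw [map_one] at k
    refine (congrArg (h.stepEquiv i) k).trans ((map_one _).trans ?_)
    refine Eq.trans ?_ (congrArg (M.merge i) hv).symm
    rw [map_neg, M.merge_X, neg_neg]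

end Matches

end

/-! ### Comparison of the 4- and 6-valent vertices -/

open SLetter
open SC (lo hi)
open SoergelToSchur (color)

noncomputable section

namespace LeftAlg

variable {d : ℕ} {M : LeftAlg d} {i j : Fin (d - 1)}

/-- A middle variable not belonging to color `i` passes to the left. A variable of color `i` does
not belong to the distant color `j`, hence passes to the right. So the two actions already generate
the ring. -/
theorem four_mem (h : SC.Dist i j) {T : Subring ((M.step j).step i).A}
    (hl : ∀ f, ((M.step j).step i).left f ∈ T) (hr : ∀ m, (M.step j).inr _ (M.inr _ m) ∈ T)
    (z : ((M.step j).step i).A) : z ∈ T := by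
  refine LeftAlg.ext_mem hl (fun m => LeftAlg.ext_mem (T := T.comap ((M.step j).inr _))
    (fun f => ?_) hr m) z
  refine left_mem (((M.step j).inr _).comp (M.step j).left)
    (RingHom.id ((M.step j).step i).A) hl (fun k => ?_) f
  rw [RingHom.comp_apply]
  by_cases h1 : k = lo i ∨ k = hi i
  · have h2 : k ≠ lo j ∧ k ≠ hi j := by
      rcases h with h | h <;> rcases h1 with rfl | rfl <;>
        constructor <;> simp only [ne_eq, lo, hi, Fin.ext_iff] <;> omega
    rw [← M.inr_left (EK.X_mem_inv h2.1 h2.2)]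
    exact hr _
  · rw [not_or] at h1
    rw [inr_left _ (EK.X_mem_inv h1.1 h1.2)]
    exact hl _

/-- The ring homomorphism `f ↦ 1 ⊗ 1 ⊗ f ⊗ 1`. -/
def mid (M : LeftAlg d) (i j : Fin (d - 1)) : PolyRing d →+* (((M.step i).step j).step i).A :=
  ((((M.step i).step j).inr (EK.invColor i)).comp ((M.step i).inr (EK.invColor j))).comp
    (M.step i).left

theorem mid_of_mem {c : PolyRing d} (hc : c ∈ EK.invColor i) :
    M.mid i j c = M.inr₃ i j (M.left c) :=
  congrArg (fun m => ((M.step i).step j).inr _ ((M.step i).inr _ m)) (M.inr_left hc).symm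

theorem mid_sq : M.mid i j (MvPolynomial.X (hi i)) * M.mid i j (MvPolynomial.X (hi i)) =
    M.inr₃ i j (M.left (MvPolynomial.X (lo i) + MvPolynomial.X (hi i))) *
      M.mid i j (MvPolynomial.X (hi i)) -
    M.inr₃ i j (M.left (MvPolynomial.X (lo i) * MvPolynomial.X (hi i))) := by
  rw [← mid_of_mem (EK.add_mem_inv (lo i) (hi i)), ← mid_of_mem (EK.mul_mem_inv (lo i) (hi i)),
    map_add, map_mul]
  ring

/-- The variable `x_p` belongs to `i` but not to `j`, so it passes through the middle tensor sign.
-/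
theorem inr_left_p (t : Triple i j) : ((M.step i).step j).inr (EK.invColor i)
    (((M.step i).step j).left (MvPolynomial.X t.p)) = M.mid i j (MvPolynomial.X t.p) :=
  congrArg (((M.step i).step j).inr (EK.invColor i))
    ((M.step i).inr_left (t.inv_j ▸ EK.X_mem_inv t.hpq t.hpr)).symm

theorem mid_mem {T : Subring (((M.step i).step j).step i).A}
    (hl : ∀ f, (((M.step i).step j).step i).left f ∈ T) (hr : ∀ m, M.inr₃ i j m ∈ T)
    (hw : M.mid i j (MvPolynomial.X (hi i)) ∈ T) (f : PolyRing d) : M.mid i j f ∈ T := by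
  refine left_mem (M.mid i j) (RingHom.id (((M.step i).step j).step i).A) hl (fun k => ?_) f
  by_cases h1 : k = hi i
  · rwa [h1]
  by_cases h2 : k = lo i
  · have e := mid_of_mem (M := M) (j := j) (EK.add_mem_inv (lo i) (hi i))
    rw [map_add, ← h2] at e
    rw [eq_sub_of_add_eq e]
    exact T.sub_mem (hr _) hw
  · rw [mid_of_mem (EK.X_mem_inv h2 h1)]
    exact hr _

/-- All variables other than `x_p` and `x_q` pass to the left, and so does `x_p + x_q`; only `x_p`
is needed in addition. -/
theorem inr_left_mem (N : LeftAlg d) {p q : Fin d} (h : EK.inv p q = EK.invColor i)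
    {T : Subring (N.step i).A} (hl : ∀ f, (N.step i).left f ∈ T)
    (hp : N.inr (EK.invColor i) (N.left (MvPolynomial.X p)) ∈ T) (f : PolyRing d) :
    N.inr (EK.invColor i) (N.left f) ∈ T := by
  refine left_mem ((N.inr (EK.invColor i)).comp N.left) (RingHom.id (N.step i).A) hl
    (fun k => ?_) f
  rw [RingHom.comp_apply]
  by_cases h1 : k = p
  · rwa [h1]
  by_cases h2 : k = q
  · have e := N.inr_left (h.le (EK.add_mem_inv p q))
    rw [map_add, map_add, add_comm] at e
    rw [h2, eq_sub_of_add_eq e]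
    exact T.sub_mem (hl _) hp
  · rw [inr_left _ (h.le (EK.X_mem_inv h1 h2))]
    exact hl _

theorem mid_apply (f : PolyRing d) : M.mid i j f =
    ((M.step i).step j).inr (EK.invColor i) ((M.step i).inr (EK.invColor j) ((M.step i).left f)) :=
  rfl

theorem inr₃_apply (m : M.A) : M.inr₃ i j m =
    ((M.step i).step j).inr (EK.invColor i) ((M.step i).inr (EK.invColor j)
      (M.inr (EK.invColor i) m)) :=
  rfl

theorem apply_mem {N : LeftAlg d} {S : Subalgebra ℚ (PolyRing d)} {B : Type} [CommRing B]
    {T : Subring B} (f : (N.ext S).A →+* B) (hl : ∀ c, f ((N.ext S).left c) ∈ T)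
    (hr : ∀ m, f (N.inr S m) ∈ T) (z : (N.ext S).A) : f z ∈ T :=
  ext_mem (T := T.comap f) hl hr z

/-- The third tensor factor reduces to `x_{i+1}` through the rightmost tensor sign. The second
reduces to `x_p` through the leftmost one, and `x_p` moves on to the third factor. So one inner
variable suffices besides the two actions. -/
theorem six_mem (t : Triple i j) {T : Subring (((M.step i).step j).step i).A}
    (hl : ∀ f, (((M.step i).step j).step i).left f ∈ T) (hr : ∀ m, M.inr₃ i j m ∈ T)
    (hw : M.mid i j (MvPolynomial.X (hi i)) ∈ T) (z : (((M.step i).step j).step i).A) : z ∈ T := by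
  have hm := mid_mem hl hr hw
  simp only [mid_apply] at hm
  simp only [inr₃_apply] at hr
  have hp : ((M.step i).step j).inr (EK.invColor i)
      (((M.step i).step j).left (MvPolynomial.X t.p)) ∈ T := by
    rw [inr_left_p, mid_apply]
    exact hm _
  refine ext_mem hl (apply_mem _ (inr_left_mem _ t.inv_i hl hp) fun m => ?_) z
  refine apply_mem ((((M.step i).step j).inr (EK.invColor i)).comp
    ((M.step i).inr (EK.invColor j))) (fun f => ?_) (fun m => ?_) m
  · rw [RingHom.comp_apply]
    exact hm f
  · rw [RingHom.comp_apply]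
    exact hr m

end LeftAlg

namespace Matches

variable {n d : ℕ} {hdn : d ≤ n} {t : WebState n} {M : LeftAlg d} {φ : t.A ≃+* M.A}
  (h : Matches hdn t M φ) {i j : Fin (d - 1)}

theorem stepEquiv_incl₂ (c : t.A) : (h.step j).stepEquiv i (t.inclRun [dn (color hdn i),
      up (color hdn i), dn (color hdn j), up (color hdn j)] c) =
    (M.step j).inr _ (M.inr _ (φ c)) :=
  ((h.step j).stepEquiv_incl i _).trans (congrArg _ (h.stepEquiv_incl j c))

theorem four (hij : SC.Dist i j) (z : (t.run [dn (color hdn i), up (color hdn i),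
      dn (color hdn j), up (color hdn j)]).A) :
    (h.step i).stepEquiv j (t.map (SoergelToSchur.four (color hdn i) (color hdn j) []) z) =
      M.four hij ((h.step j).stepEquiv i z) := by
  refine map_eq_of_one
    (u := [dn (color hdn i), up (color hdn i), dn (color hdn j), up (color hdn j)])
    (v := [dn (color hdn j), up (color hdn j), dn (color hdn i), up (color hdn i)])
    ((h.step j).step i) ((h.step i).step j) (ι₁ := ((M.step j).inr _).comp (M.inr _))
    (ι₂ := ((M.step i).inr _).comp (M.inr _)) (h.stepEquiv_incl₂) (h.stepEquiv_incl₂)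
    (M.four_inr hij) (fun T hl hr => LeftAlg.four_mem hij hl hr) ?_ z
  rw [M.four_map_one, ← map_one ((h.step i).stepEquiv j)]
  exact congrArg _ (t.four_one (i := color hdn i) (j := color hdn j) hij (h.linear_lo j)
    (h.linear_hi i))

/-- The comparison isomorphism for the colors `i, j, i`. -/
def stepEquiv₃ (i j : Fin (d - 1)) : (t.run [dn (color hdn i), up (color hdn i),
      dn (color hdn j), up (color hdn j), dn (color hdn i), up (color hdn i)]).A ≃+*
    (((M.step i).step j).step i).A :=
  ((h.step i).step j).stepEquiv i

theorem step₃ (i j : Fin (d - 1)) : Matches hdn (t.run [dn (color hdn i), up (color hdn i),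
      dn (color hdn j), up (color hdn j), dn (color hdn i), up (color hdn i)])
    (((M.step i).step j).step i) (h.stepEquiv₃ i j) :=
  ((h.step i).step j).step i

theorem stepEquiv₃_incl (c : t.A) : h.stepEquiv₃ i j (t.inclRun [dn (color hdn i),
      up (color hdn i), dn (color hdn j), up (color hdn j), dn (color hdn i),
      up (color hdn i)] c) = M.inr₃ i j (φ c) :=
  (((h.step i).step j).stepEquiv_incl i _).trans (congrArg _ (h.stepEquiv_incl₂ c))

theorem stepEquiv₃_varCons : h.stepEquiv₃ i j (t.varCons (dn (color hdn i)) _) =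
    -(((M.step i).step j).step i).left (MvPolynomial.X (hi i)) :=
  ((h.step i).step j).stepEquiv_var i

theorem stepEquiv₃_var : h.stepEquiv₃ i j (t.inclCons (dn (color hdn i)) _
      (t.inclCons (up (color hdn i)) _ (t.inclCons (dn (color hdn j)) _
      (t.inclCons (up (color hdn j)) _ (t.varCons (dn (color hdn i)) [up (color hdn i)]))))) =
    -M.mid i j (MvPolynomial.X (hi i)) := by
  refine (((h.step i).step j).stepEquiv_incl i _).trans ?_
  refine (congrArg _ ((h.step i).stepEquiv_incl j _)).trans ?_
  refine (congrArg (fun m => ((M.step i).step j).inr _ ((M.step i).inr _ m))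
    (h.stepEquiv_var i)).trans ?_
  rw [map_neg, map_neg]
  rfl

-- The source is generated by `1` and the inner variable `-x_{i+1}`, whose square is expressed
-- through the right action by `mid_sq`. Hence the vertex is determined by the two values `h1` and
-- `h2`.
set_option maxHeartbeats 800000 in
theorem six_of_values (hij : SC.Adj i j)
    {D : Diag (SSig n) [dn (color hdn i), up (color hdn i), dn (color hdn j), up (color hdn j),
        dn (color hdn i), up (color hdn i)]
      [dn (color hdn j), up (color hdn j), dn (color hdn i), up (color hdn i),
        dn (color hdn j), up (color hdn j)]} {y : (t.run [dn (color hdn j), up (color hdn j),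
        dn (color hdn i), up (color hdn i), dn (color hdn j), up (color hdn j)]).A}
    (h1 : t.map D 1 = 1) (h2 : t.map D (t.inclCons (dn (color hdn i)) _
      (t.inclCons (up (color hdn i)) _ (t.inclCons (dn (color hdn j)) _
      (t.inclCons (up (color hdn j)) _ (t.varCons (dn (color hdn i)) [up (color hdn i)]))))) = y)
    (h3 : h.stepEquiv₃ j i y = -M.six hij (M.mid i j (MvPolynomial.X (hi i))))
    (z : (t.run [dn (color hdn i), up (color hdn i), dn (color hdn j), up (color hdn j),
      dn (color hdn i), up (color hdn i)]).A) :
    h.stepEquiv₃ j i (t.map D z) = M.six hij (h.stepEquiv₃ i j z) := by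
  refine map_eq_of_generated (h.step₃ i j) (h.step₃ j i)
    h.stepEquiv₃_incl h.stepEquiv₃_incl (M.six_inr hij) _
    (p := -M.inr₃ i j (M.left (MvPolynomial.X (lo i) * MvPolynomial.X (hi i))))
    (q := -M.inr₃ i j (M.left (MvPolynomial.X (lo i) + MvPolynomial.X (hi i))))
    (fun K _ hr => ⟨K.neg_mem (hr _), K.neg_mem (hr _)⟩) ?_ (fun T hl hr hw => ?_) ?_
    ((congrArg _ h2).trans ?_) z
  · rw [h.stepEquiv₃_var]
    linear_combination LeftAlg.mid_sq (M := M) (i := i) (j := j)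
  · rw [h.stepEquiv₃_var] at hw
    refine LeftAlg.six_mem (LeftAlg.Triple.ofAdj hij) hl hr ?_
    rw [← neg_neg (M.mid i j _)]
    exact T.neg_mem hw
  · exact (congrArg (h.stepEquiv₃ j i) h1).trans ((map_one _).trans (M.six_map_one hij).symm)
  · rw [h3, h.stepEquiv₃_var, map_neg]

theorem six_down (hij : SC.Adj i j) (hlt : j.1 < i.1) (z : (t.run [dn (color hdn i),
      up (color hdn i), dn (color hdn j), up (color hdn j), dn (color hdn i),
      up (color hdn i)]).A) :
    h.stepEquiv₃ j i (t.map (SoergelToSchur.sixDown (color hdn i) (color hdn j) []) z) =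
      M.six hij (h.stepEquiv₃ i j z) := by
  have hr : j.1 + 1 = i.1 := hij.resolve_left (by omega)
  obtain ⟨h1, h2⟩ := WebState.sixDown_apply (t := t) (r := color hdn i) (l := color hdn j) hr.symm
    (h.linear_lo j) (h.linear_hi j) (h.linear_hi i)
  have hv : (t.step (up (color hdn i))).var (dn (color hdn i)) =
    t.varCons (dn (color hdn i)) [up (color hdn i)] := rfl
  rw [hv] at h2
  with_reducible refine h.six_of_values hij h1 h2 ?_ z
  -- For `j = i - 1` the variable `x_p` of the Elias–Khovanov formula is `x_{i+1}`, the chosen inner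
  -- generator. The web value becomes `-(x_p + x_q)` on the right plus the constant coefficient
  -- `x_r` on the left, the negative of `six_X`.
  have ht : (LeftAlg.Triple.ofAdj hij).p = hi i ∧ (LeftAlg.Triple.ofAdj hij).q = hi j ∧
      (LeftAlg.Triple.ofAdj hij).r = lo j := by
    rw [LeftAlg.Triple.ofAdj, dif_neg (by omega)]
    exact ⟨rfl, Fin.ext hr.symm, rfl⟩
  have e := M.six_X hij
  rw [LeftAlg.inr_left_p, ht.1, ht.2.1, ht.2.2] at e
  rw [e, map_add (h.stepEquiv₃ j i), h.stepEquiv₃_incl, (h.step₃ j i).linear_lo j]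
  simp only [coeff_sub, coeff_X_zero, coeff_neg, coeff_C_zero, map_sub, map_neg, map_add, map_zero,
    RingEquiv.apply_symm_apply]
  ring

theorem six_up (hij : SC.Adj i j) (hlt : ¬ j.1 < i.1) (z : (t.run [dn (color hdn i),
      up (color hdn i), dn (color hdn j), up (color hdn j), dn (color hdn i),
      up (color hdn i)]).A) :
    h.stepEquiv₃ j i (t.map (SoergelToSchur.sixUp (color hdn i) (color hdn j) []) z) =
      M.six hij (h.stepEquiv₃ i j z) := by
  have hr : i.1 + 1 = j.1 := hij.resolve_right (by omega)
  obtain ⟨h1, h2⟩ := WebState.sixUp_apply (t := t) (r := color hdn j) (l := color hdn i) hr.symm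
    (h.linear_lo i) (h.linear_hi i) (h.linear_hi j)
  with_reducible refine h.six_of_values hij h1 h2 ?_ z
  have ht : (LeftAlg.Triple.ofAdj hij).p = lo i ∧ (LeftAlg.Triple.ofAdj hij).q = hi i ∧
      (LeftAlg.Triple.ofAdj hij).r = hi j := by
    rw [LeftAlg.Triple.ofAdj, dif_pos hr]
    exact ⟨rfl, rfl, rfl⟩
  have e := M.six_X hij
  rw [LeftAlg.inr_left_p, ht.1, ht.2.1, ht.2.2] at e
  -- For `j = i + 1` the inner generator is `x_q`, not `x_p`. It is replaced by `x_p + x_q`, which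
  -- passes to the right, minus `x_p`; the right terms cancel and `x_r = x_{j+1}` on the left
  -- remains.
  have e' := LeftAlg.mid_of_mem (M := M) (j := j) (EK.add_mem_inv (lo i) (hi i))
  rw [map_add, add_comm] at e'
  have e'' := M.six_inr hij (M.left (MvPolynomial.X (lo i) + MvPolynomial.X (hi i))) 1
  rw [M.six_map_one, mul_one, mul_one] at e''
  rw [eq_sub_of_add_eq e', map_sub, e, e'', h.stepEquiv₃_varCons]
  ring

end Matches

end

/-! ### Bubbles and boxes -/

open SLetter
open SC (lo hi)
open SoergelToSchur (color word)

noncomputable section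

namespace LeftAlg

variable {d : ℕ} (M : LeftAlg d) (i : Fin (d - 1))

theorem endDot_startDot (m : M.A) : M.endDot i (M.startDot i m) =
    (M.left (MvPolynomial.X (lo i)) - M.left (MvPolynomial.X (hi i))) * m := by
  rw [← mul_one m, M.startDot_mul, M.endDot_inr, M.startDot_one, map_sub,
    ← mul_one ((M.step i).left _), map_left, ← mul_one (M.inr _ _), M.endDot_inr, M.endDot_one]
  ring

end LeftAlg

namespace WebState

variable {n : ℕ} {s t : WebState n}

theorem whisker_id (l : SLetter n) (z : (s.step l).A) :
    whisker l (LinearMap.id : s.A →ₗ[ℚ] s.A) z = z := by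
  induction z using step_induction with
  | h c k => exact whisker_apply l (fun _ _ _ => rfl) c k
  | hadd x y hx hy => rw [map_add, hx, hy]

theorem map_sum (b : List (SLetter n)) (m : ℕ) (f : Fin m → Diag (SSig n) b b) (z : (s.run b).A) :
    s.map (Diag.sum m f) z = ∑ k, s.map (f k) z := by
  induction m with
  | zero => rfl
  | succ m ih =>
    rw [Fin.sum_univ_castSucc, ← ih]
    rfl

theorem map_ccwReal (c : Fin (n - 1)) (b : List (SLetter n)) (z : (s.run b).A) :
    s.map (Schur.ccwReal c b 0) z = (s.run b).capDU c ((s.run b).cupDU c z) :=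
  congrArg ((s.run b).capDU c) (whisker_id (dn c) _)

/-- The clockwise bubble with one dot in a region where the lower alphabet has one variable and the
higher alphabet is empty. -/
theorem map_cwReal {c : Fin (n - 1)} {b : List (SLetter n)} {a : (s.run b).A}
    (ha : (s.run b).P (lo c) = X - C a) (h1 : (s.run b).P (hi c) = 1) (z : (s.run b).A) :
    s.map (Schur.cwReal c b 1) z = a * z := by
  have e : (s.run b).map (Schur.cwReal c [] 1) 1 = a := by
    have e1 := (s.run b).cupUD_one_of_one h1
    have e2 := (s.run b).capUD_var c
    rw [var_of_linear (l := dn c) ha, trace_of_linear (l := dn c) ha] at e2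
    refine (congrArg (fun y => (s.run b).capUD c (y * ((s.run b).step (dn c)).var (up c)))
      e1).trans (Eq.trans (congrArg _ ?_) e2)
    exact one_mul _
  have k := (s.run b).base_map z (Schur.cwReal c [] 1) 1
  exact (congrArg (s.map (Schur.cwReal c b 1)) (mul_one z).symm).trans
    (k.trans ((congrArg (z * ·) e).trans (mul_comm _ _)))

end WebState

namespace Matches

variable {n d : ℕ}

/-- The sum telescopes, since `hi j` and `lo (j + 1)` are the same variable. The extension `g` of
the variables by zero to all natural numbers permits an induction over the upper bound. -/
theorem sum_sub (M : LeftAlg d) (k : Fin d) (hd : d - 1 < d) :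
    ∑ j : Fin (d - 1), (if k.1 ≤ j.1 then
      M.left (MvPolynomial.X (lo j)) - M.left (MvPolynomial.X (hi j)) else 0) =
    M.left (MvPolynomial.X k) - M.left (MvPolynomial.X ⟨d - 1, hd⟩) := by
  let g : ℕ → M.A := fun m => if h : m < d then M.left (MvPolynomial.X ⟨m, h⟩) else 0
  have h1 : ∀ j : Fin (d - 1), M.left (MvPolynomial.X (lo j)) = g j.1 := fun j => by
    rw [show g j.1 = _ from dif_pos (show j.1 < d by omega)]
    rfl
  have h2 : ∀ j : Fin (d - 1), M.left (MvPolynomial.X (hi j)) = g (j.1 + 1) := fun j => by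
    rw [show g (j.1 + 1) = _ from dif_pos (show j.1 + 1 < d by omega)]
    rfl
  have h3 : M.left (MvPolynomial.X k) = g k.1 := by
    rw [show g k.1 = _ from dif_pos k.2]
  have h4 : M.left (MvPolynomial.X ⟨d - 1, hd⟩) = g (d - 1) := by
    rw [show g (d - 1) = _ from dif_pos hd]
  simp only [h1, h2, h3, h4]
  rw [Fin.sum_univ_eq_sum_range (fun m => if k.1 ≤ m then g m - g (m + 1) else 0)]
  have key : ∀ m, k.1 ≤ m →
      ∑ x ∈ Finset.range m, (if k.1 ≤ x then g x - g (x + 1) else 0) = g k.1 - g m := by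
    intro m hm
    induction m, hm using Nat.le_induction with
    | base =>
      rw [sub_self]
      exact Finset.sum_eq_zero fun x hx => if_neg (by simpa using hx)
    | succ m hm ih => rw [Finset.sum_range_succ, ih, if_pos hm]; ring
  exact key _ (by omega)

theorem wbar_word (hdn : d < n) (w : List (Fin (d - 1))) (hc : d - 1 < n - 1) (hd : 0 < d) :
    Schur.wbar d (word hdn.le w) ⟨d - 1, hc⟩ = 1 ∧
      Schur.wt d (word hdn.le w) (hi ⟨d - 1, hc⟩) = 0 := by
  rw [Schur.wbar, SoergelToSchur.wt_word]
  have e1 : Schur.wt d [] (lo (⟨d - 1, hc⟩ : Fin (n - 1))) = 1 :=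
    if_pos (by simp only [lo]; omega)
  have e2 : Schur.wt d [] (hi (⟨d - 1, hc⟩ : Fin (n - 1))) = 0 :=
    if_neg (by simp only [hi]; omega)
  rw [e1, e2]
  exact ⟨rfl, rfl⟩

/-- The labels of strands `d` and `d + 1` in the region are `1` and `0`, so the bubble of degree `2`
has label `-1` and is fake. Its recursion has a single term, with two signs `-1` that cancel and a
clockwise bubble with one dot. -/
theorem ccw_eq (hdn : d < n) (w : List (Fin (d - 1))) (hc : d - 1 < n - 1) (hd : 0 < d)
    (s : WebState n) (z : (s.run (word hdn.le w)).A) :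
    s.map (Schur.ccw d ⟨d - 1, hc⟩ (word hdn.le w) 1) z =
      s.map (Schur.cwReal ⟨d - 1, hc⟩ (word hdn.le w) 1) z := by
  obtain ⟨h1, h2⟩ := wbar_word hdn w hc hd
  have e0 : Schur.ccwFake d ⟨d - 1, hc⟩ (word hdn.le w) 0 = .smul (-1) (.id _) := by
    rw [Schur.ccwFake, h2]
    norm_num
  have e1 : Schur.ccwFake d ⟨d - 1, hc⟩ (word hdn.le w) 1 = .smul (-1) (.sum 1 fun _ =>
      .smul (-1) (.id _) ⋆ Schur.cwReal ⟨d - 1, hc⟩ (word hdn.le w) 1) := by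
    rw [Schur.ccwFake, h1, h2]
    have hs : ∀ x : Fin (0 + 1), x.1 = 0 := fun x => by omega
    simp only [hs, e0]
    norm_num
  rw [Schur.ccw, h1, if_neg (by norm_num), e1]
  change (-1 : ℚ) • s.map (Diag.sum 1 _) z = _
  rw [WebState.map_sum, Fin.sum_univ_one]
  change (-1 : ℚ) • s.map (Schur.cwReal ⟨d - 1, hc⟩ (word hdn.le w) 1) ((-1 : ℚ) • z) = _
  rw [map_smul, smul_smul]
  norm_num

/-- A counterclockwise bubble of color `j` is a double dot and acts by `x_j - x_{j+1}`; the sum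
telescopes to `x_k - x_d`. The fake bubble acts by the variable of the last strand, `-x_d`, and
subtracting it leaves `x_k`. -/
theorem box {hdn : d < n} {s : WebState n} {w : List (Fin (d - 1))} {M : LeftAlg d}
    {φ : (s.run (word hdn.le w)).A ≃+* M.A} (h : Matches hdn.le (s.run (word hdn.le w)) M φ)
    (k : Fin d) (z : (s.run (word hdn.le w)).A) :
    φ (s.map (SoergelToSchur.box hdn k w) z) = M.left (MvPolynomial.X k) * φ z := by
  have hc : d - 1 < n - 1 := by have := k.2; omega
  have hd : 0 < d := by have := k.2; omega
  have e1 : ∀ j : Fin (d - 1), φ (s.map (if k.1 ≤ j.1 then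
      Schur.ccwReal (color hdn.le j) (word hdn.le w) 0 else .zero _ _) z) =
      (if k.1 ≤ j.1 then
        M.left (MvPolynomial.X (lo j)) - M.left (MvPolynomial.X (hi j)) else 0) * φ z := by
    intro j
    split_ifs
    · rw [WebState.map_ccwReal, ← M.endDot_startDot, ← h.startDot j z]
      exact h.endDot j _
    · exact (map_zero φ).trans (zero_mul _).symm
  have e2 : φ (s.map (Schur.ccw d ⟨d - 1, hc⟩ (word hdn.le w) 1) z) =
      -M.left (MvPolynomial.X ⟨d - 1, by omega⟩) * φ z := by
    rw [ccw_eq hdn w hc hd, WebState.map_cwReal (h.linear ⟨d - 1, by omega⟩)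
      (h.trivial _ (by simp only [hi]; omega)), map_mul, RingEquiv.apply_symm_apply]
  have e3 : s.map (SoergelToSchur.box hdn k w) z = s.map (Diag.sum (d - 1) fun j =>
      if k.1 ≤ j.1 then Schur.ccwReal (color hdn.le j) (word hdn.le w) 0 else .zero _ _) z +
      (-1 : ℚ) • s.map (Schur.ccw d ⟨d - 1, hc⟩ (word hdn.le w) 1) z := rfl
  rw [e3, WebState.map_sum, neg_one_smul, map_add, map_neg, e2, _root_.map_sum]
  simp only [e1]
  rw [← Finset.sum_mul, sum_sub M k (by omega)]
  ring

end Matches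

end

/-! ### Strands on the right, and the comparison on all diagrams -/

open SLetter
open SC (lo hi)
open SoergelToSchur (color word)

noncomputable section

namespace LeftAlg

variable {d : ℕ}

theorem whisker_inr {M N : LeftAlg d} (i : Fin (d - 1)) (F : M.A →ₗ[PolyRing d] N.A) (m : M.A) :
    whisker i F (M.inr _ m) = N.inr _ (F m) := liftLin_of_inr _ _ m

end LeftAlg

namespace WebState

variable {n : ℕ} {s t : WebState n} {u v w u' v' w' b c : List (SLetter n)}

/-- The images of the diagrams `D` and `D'` are the same map. -/
def SameMap (s t : WebState n) (D : Diag (SSig n) u v) (D' : Diag (SSig n) u' v') : Prop :=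
  s.run u = t.run u' ∧ s.run v = t.run v' ∧ HEq (s.map D) (t.map D')

namespace SameMap

theorem heq_comp : ∀ {A A' B B' E E' : WebState n} {f : A.A →ₗ[ℚ] B.A} {f' : A'.A →ₗ[ℚ] B'.A}
    {g : B.A →ₗ[ℚ] E.A} {g' : B'.A →ₗ[ℚ] E'.A}, A = A' → B = B' → E = E' → HEq f f' → HEq g g' →
    HEq (g ∘ₗ f) (g' ∘ₗ f') := by
  rintro _ _ _ _ _ _ _ _ _ _ rfl rfl rfl h h'
  cases h
  cases h'
  rfl

theorem heq_whisker (l : SLetter n) : ∀ {A A' B B' : WebState n} {f : A.A →ₗ[ℚ] B.A}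
    {f' : A'.A →ₗ[ℚ] B'.A}, A = A' → B = B' → HEq f f' → HEq (whisker l f) (whisker l f') := by
  rintro _ _ _ _ _ _ rfl rfl h
  cases h
  rfl

theorem comp {f : Diag (SSig n) u v} {g : Diag (SSig n) v w} {f' : Diag (SSig n) u' v'}
    {g' : Diag (SSig n) v' w'} (h : SameMap s t f f') (h' : SameMap s t g g') :
    SameMap s t (f ⋆ g) (f' ⋆ g') :=
  ⟨h.1, h'.2.1, heq_comp h.1 h.2.1 h'.2.1 h.2.2 h'.2.2⟩

theorem cons {f : Diag (SSig n) u v} {f' : Diag (SSig n) u' v'} (h : SameMap s t f f')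
    (l : SLetter n) : SameMap s t (.cons l f) (.cons l f') :=
  ⟨congrArg (step · l) h.1, congrArg (step · l) h.2.1, heq_whisker l h.1 h.2.1 h.2.2⟩

theorem gen (g : SGen n) (h : s.run b = t.run c) : SameMap s t (.gen (S := SSig n) g b)
    (.gen (S := SSig n) g c) := by
  have key : ∀ A A' : WebState n, A = A' →
      (A.run ((SSig n).src g) = A'.run ((SSig n).src g) ∧
        A.run ((SSig n).tgt g) = A'.run ((SSig n).tgt g)) ∧
      ∀ i j, HEq (A.crossUp i j) (A'.crossUp i j) ∧ HEq (A.crossDn i j) (A'.crossDn i j) ∧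
        HEq (A.cupDU i) (A'.cupDU i) ∧ HEq (A.cupUD i) (A'.cupUD i) ∧
        HEq (A.capDU i) (A'.capDU i) ∧ HEq (A.capUD i) (A'.capUD i) ∧
        HEq (LinearMap.mulRight ℚ (A.var (up i))) (LinearMap.mulRight ℚ (A'.var (up i))) ∧
        HEq (LinearMap.mulRight ℚ (A.var (dn i))) (LinearMap.mulRight ℚ (A'.var (dn i))) := by
    rintro A _ rfl
    simp
  obtain ⟨⟨h1, h2⟩, h3⟩ := key _ _ h
  cases g with
  | dotUp i => exact ⟨h1, h2, (h3 i i).2.2.2.2.2.2.1⟩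
  | dotDn i => exact ⟨h1, h2, (h3 i i).2.2.2.2.2.2.2⟩
  | crossUp i j => exact ⟨h1, h2, (h3 i j).1⟩
  | crossDn i j => exact ⟨h1, h2, (h3 i j).2.1⟩
  | cupDU i => exact ⟨h1, h2, (h3 i i).2.2.1⟩
  | cupUD i => exact ⟨h1, h2, (h3 i i).2.2.2.1⟩
  | capDU i => exact ⟨h1, h2, (h3 i i).2.2.2.2.1⟩
  | capUD i => exact ⟨h1, h2, (h3 i i).2.2.2.2.2.1⟩

theorem cons_run (h : s.run b = t.run c) (l : SLetter n) : s.run (l :: b) = t.run (l :: c) :=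
  congrArg (step · l) h

variable (h : s.run b = t.run c) (i j : Fin (n - 1))
include h

theorem crossL : SameMap s t (Schur.crossL j i b) (Schur.crossL j i c) := by
  have h1 := cons_run h (dn i)
  exact .comp (.comp (.gen (.cupDU i) (cons_run h1 (up j))) ((gen (.crossUp i j) h1).cons (dn i)))
    (((gen (.capUD i) h).cons (up j)).cons (dn i))

theorem crossR : SameMap s t (Schur.crossR j i b) (Schur.crossR j i c) := by
  have h1 := cons_run h (dn j)
  exact .comp (.comp (((gen (.cupUD j) h).cons (up i)).cons (dn j))
    ((gen (.crossUp i j) h1).cons (dn j))) (.gen (.capDU j) (cons_run h1 (up i)))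

theorem four : SameMap s t (SoergelToSchur.four i j b) (SoergelToSchur.four i j c) :=
  have hi := cons_run h (up i)
  have hj := cons_run h (up j)
  .comp (.comp (.comp ((crossL hj j i).cons (dn i)) (gen (.crossDn i j) (cons_run hj (up i))))
    (((gen (.crossUp i j) h).cons (dn i)).cons (dn j))) ((crossR hi j i).cons (dn j))

theorem sixDown (r l : Fin (n - 1)) :
    SameMap s t (SoergelToSchur.sixDown r l b) (SoergelToSchur.sixDown r l c) := by
  have h1 := cons_run h (up r)
  have h2 := cons_run h1 (up l)
  have h3 := cons_run h2 (up l)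
  have h4 := cons_run h (up l)
  exact .comp (.comp (.comp (.comp (.comp (.comp (.comp (.comp (.comp (.comp
    ((crossL (cons_run (cons_run h1 (dn r)) (up l)) l r).cons (dn r))
    ((((crossL h1 r l).cons (up r)).cons (dn l)).cons (dn r)))
    (((gen (.capUD r) h2).cons (dn l)).cons (dn r)))
    (((gen (.cupDU l) h2).cons (dn l)).cons (dn r)))
    ((gen (.crossDn l l) h3).cons (dn r)))
    ((((gen (.crossUp l l) h1).cons (dn l)).cons (dn l)).cons (dn r)))
    (((crossR h2 l l).cons (dn l)).cons (dn r)))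
    (.gen (.crossDn r l) (cons_run (cons_run h2 (dn l)) (up l))))
    (((((gen (.crossUp l r) h).cons (dn l)).cons (up l)).cons (dn r)).cons (dn l)))
    ((crossR (cons_run (cons_run h4 (up r)) (dn l)) l r).cons (dn l)))
    ((((crossR h4 r l).cons (dn r)).cons (up l)).cons (dn l))

theorem sixUp (l r : Fin (n - 1)) :
    SameMap s t (SoergelToSchur.sixUp l r b) (SoergelToSchur.sixUp l r c) := by
  have h1 := cons_run h (up r)
  have h2 := cons_run h1 (up l)
  have h3 := cons_run h2 (up l)
  have h4 := cons_run h (up l)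
  have h5 := cons_run (cons_run h4 (up r)) (dn l)
  exact .comp (.comp (.comp (.comp (.comp (.comp (.comp (.comp (.comp (.comp
    ((crossL (cons_run (cons_run h4 (dn l)) (up r)) r l).cons (dn l))
    ((((crossL h4 l r).cons (up l)).cons (dn r)).cons (dn l)))
    (.gen (.crossDn l r) (cons_run h5 (up l))))
    (((((gen (.crossUp r l) h).cons (dn l)).cons (up l)).cons (dn l)).cons (dn r)))
    (((crossL h2 l l).cons (dn l)).cons (dn r)))
    ((gen (.crossDn l l) h3).cons (dn r)))
    ((((gen (.crossUp l l) h1).cons (dn l)).cons (dn l)).cons (dn r)))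
    (((gen (.capDU l) h2).cons (dn l)).cons (dn r)))
    (((gen (.cupUD r) h2).cons (dn l)).cons (dn r)))
    ((((crossR h1 l r).cons (up r)).cons (dn l)).cons (dn r)))
    ((crossR (cons_run (cons_run h1 (dn r)) (up l)) r l).cons (dn r))

omit h in
-- The vertices were compared with no strands on their right, starting from an arbitrary matching
-- state. A word on the right is absorbed into that state, and equal pairs of state and isomorphism
-- carry the comparison over.
theorem transport {D : Diag (SSig n) u v} {D' : Diag (SSig n) u' v'} (hS : SameMap s t D D')
    {B B' : Type} [CommRing B] [CommRing B'] {G : B → B'} {φ₁ : (s.run u).A ≃+* B}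
    {φ₂ : (s.run v).A ≃+* B'} {φ₁' : (t.run u').A ≃+* B} {φ₂' : (t.run v').A ≃+* B'}
    (e₁ : (⟨s.run u, φ₁⟩ : Σ A : WebState n, A.A ≃+* B) = ⟨t.run u', φ₁'⟩)
    (e₂ : (⟨s.run v, φ₂⟩ : Σ A : WebState n, A.A ≃+* B') = ⟨t.run v', φ₂'⟩)
    (H : ∀ z, φ₂' (t.map D' z) = G (φ₁' z)) (z : (s.run u).A) : φ₂ (s.map D z) = G (φ₁ z) := by
  obtain ⟨-, -, hD⟩ := hS
  revert hD H
  generalize s.map D = f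
  generalize t.map D' = f'
  revert f f' z φ₁ φ₂ φ₁' φ₂'
  generalize s.run u = A
  generalize s.run v = A'
  generalize t.run u' = E
  generalize t.run v' = E'
  intro φ₁ φ₂ φ₁' φ₂' e₁ e₂ z f f' H hD
  cases e₁
  cases e₂
  cases hD
  exact H z

end SameMap

end WebState

namespace Matches

variable {n d : ℕ} {hdn : d ≤ n}

/-- An identity strand on the left. -/
theorem strand {t : WebState n} {u v : List (SLetter n)} {N N' : LeftAlg d}
    {φ₁ : (t.run u).A ≃+* N.A} {φ₂ : (t.run v).A ≃+* N'.A} (h₁ : Matches hdn (t.run u) N φ₁)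
    (h₂ : Matches hdn (t.run v) N' φ₂) {D : Diag (SSig n) u v} {G : N.A →ₗ[PolyRing d] N'.A}
    (hG : ∀ z, φ₂ (t.map D z) = G (φ₁ z)) (i : Fin (d - 1))
    (z : (t.run (dn (color hdn i) :: up (color hdn i) :: u)).A) :
    h₂.stepEquiv i (t.map (SoergelToSchur.strand (color hdn i) D) z) =
      LeftAlg.whisker i G (h₁.stepEquiv i z) := by
  let F := transported (t := t) (u := dn (color hdn i) :: up (color hdn i) :: u)
    (v := dn (color hdn i) :: up (color hdn i) :: v) (SoergelToSchur.strand (color hdn i) D)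
    (h₁.stepEquiv i) (h₂.stepEquiv i)
  have hF : ∀ z, F (h₁.stepEquiv i z) =
      h₂.stepEquiv i (t.map (SoergelToSchur.strand (color hdn i) D) z) := fun z =>
    transported_apply (t := t) (u := dn (color hdn i) :: up (color hdn i) :: u)
      (v := dn (color hdn i) :: up (color hdn i) :: v) z
  have hl : ∀ f z, F ((N.step i).left f * z) = (N'.step i).left f * F z :=
    transported_left (t := t) (u := dn (color hdn i) :: up (color hdn i) :: u)
      (v := dn (color hdn i) :: up (color hdn i) :: v) (h₁.step i) (h₂.step i)
  -- Both maps are linear for the left action, so it suffices to consider `1 ⊗ m`, on which both are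
  -- induced by the diagram without the strand.
  have key : ∀ y : (N.step i).A, F y = LeftAlg.whisker i G y := by
    intro y
    induction y using LeftAlg.ext_induction with
    | h f m =>
      obtain ⟨c, rfl⟩ := φ₁.surjective m
      rw [hl, LeftAlg.map_left, LeftAlg.whisker_inr, ← hG,
        ← h₁.stepEquiv_incl i, ← h₂.stepEquiv_incl i]
      refine congrArg _ ((hF _).trans (congrArg _ ?_))
      exact WebState.map_cons_eq (dn (color hdn i)) (WebState.map_cons_eq (up (color hdn i)) rfl)
    | hadd x y hx hy => rw [map_add, map_add, hx, hy]
  rw [← key]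
  exact (hF z).symm

/-! ## The comparison isomorphism -/

/-- The automorphism `x_j ↦ -x_j`. -/
def signEquiv (d : ℕ) : PolyRing d ≃+* PolyRing d :=
  (AlgEquiv.ofAlgHom (signTwist d) (signTwist d) (by ext j; simp [signTwist])
    (by ext j; simp [signTwist])).toRingEquiv

theorem signEquiv_symm_apply (f : PolyRing d) : (signEquiv d).symm f = signTwist d f := rfl

/-- For the empty word strand `j` carries `x_j`, which has to correspond to `-x_j`; the comparison
therefore starts with the sign automorphism. -/
theorem base : Matches hdn (baseState n d) (LeftAlg.base d) (signEquiv d) where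
  linear j := by
    have e : (signEquiv d).symm (-MvPolynomial.X j) = MvPolynomial.X j := by
      rw [signEquiv_symm_apply, map_neg, signTwist, MvPolynomial.aeval_X, neg_neg]
    exact (dif_pos j.2).trans (congrArg (fun x => X - C x) e.symm)
  trivial j h := dif_neg (not_lt.2 h)

variable (hdn) in
/-- The isomorphism `ℱ_Bim(Σ(w)) → ℱ_EK(w)`, for all `w` by recursion. -/
def comparison : (w : List (Fin (d - 1))) →
    {φ : WebRing n d (word hdn w) ≃+* EKRing d w //
      Matches hdn ((baseState n d).run (word hdn w)) ((LeftAlg.base d).run w) φ}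
  | [] => ⟨signEquiv d, base⟩
  | i :: w => ⟨(comparison w).2.stepEquiv i, (comparison w).2.step i⟩

variable {boxed : Bool} {hb : boxed = true → d < n}

theorem comparison_two (i j : Fin (d - 1)) (w : List (Fin (d - 1))) :
    (⟨(baseState n d).run (word hdn (i :: j :: w)), (comparison hdn (i :: j :: w)).1⟩ :
      Σ A : WebState n, A.A ≃+* EKRing d (i :: j :: w)) =
    ⟨((baseState n d).run (word hdn w)).run [dn (color hdn i), up (color hdn i),
        dn (color hdn j), up (color hdn j)], ((comparison hdn w).2.step j).stepEquiv i⟩ := by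
  exact rfl

theorem comparison_three (i j : Fin (d - 1)) (w : List (Fin (d - 1))) :
    (⟨(baseState n d).run (word hdn (i :: j :: i :: w)), (comparison hdn (i :: j :: i :: w)).1⟩ :
      Σ A : WebState n, A.A ≃+* EKRing d (i :: j :: i :: w)) =
    ⟨((baseState n d).run (word hdn w)).run [dn (color hdn i), up (color hdn i),
        dn (color hdn j), up (color hdn j), dn (color hdn i), up (color hdn i)],
      (comparison hdn w).2.stepEquiv₃ i j⟩ := by
  exact rfl

theorem comparison_four {i j : Fin (d - 1)} (h : SC.Dist i j) (w : List (Fin (d - 1)))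
    (z : WebRing n d (word hdn (i :: j :: w))) :
    (comparison hdn (j :: i :: w)).1
      ((baseState n d).map (SoergelToSchur.four (color hdn i) (color hdn j) (word hdn w)) z) =
    ((LeftAlg.base d).run w).four h ((comparison hdn (i :: j :: w)).1 z) :=
  (WebState.SameMap.four (s := baseState n d) (t := (baseState n d).run (word hdn w)) (c := [])
    rfl (color hdn i) (color hdn j)).transport (G := ((LeftAlg.base d).run w).four h)
    (comparison_two i j w) (comparison_two j i w) ((comparison hdn w).2.four h) z

theorem comparison_six {i j : Fin (d - 1)} (h : SC.Adj i j) (w : List (Fin (d - 1)))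
    (z : WebRing n d (word hdn (i :: j :: i :: w))) :
    (comparison hdn (j :: i :: j :: w)).1 ((baseState n d).map (if j.1 < i.1 then
      SoergelToSchur.sixDown (color hdn i) (color hdn j) (word hdn w)
      else SoergelToSchur.sixUp (color hdn i) (color hdn j) (word hdn w)) z) =
    ((LeftAlg.base d).run w).six h ((comparison hdn (i :: j :: i :: w)).1 z) := by
  split_ifs with hlt
  · exact (WebState.SameMap.sixDown (s := baseState n d) (t := (baseState n d).run (word hdn w))
      (c := []) rfl (color hdn i) (color hdn j)).transport
      (G := ((LeftAlg.base d).run w).six h) (comparison_three i j w)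
      (comparison_three j i w) ((comparison hdn w).2.six_down h hlt) z
  · exact (WebState.SameMap.sixUp (s := baseState n d) (t := (baseState n d).run (word hdn w))
      (c := []) rfl (color hdn i) (color hdn j)).transport
      (G := ((LeftAlg.base d).run w).six h) (comparison_three i j w)
      (comparison_three j i w) ((comparison hdn w).2.six_up h hlt) z

theorem comparison_gen (w : List (Fin (d - 1))) (g : SCGen d boxed)
    (z : WebRing n d (word hdn ((SCSig d boxed).src g ++ w))) :
    (comparison hdn ((SCSig d boxed).tgt g ++ w)).1
        ((baseState n d).map (SoergelToSchur.gen hdn hb w g) z) =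
      (LeftAlg.base d).gen w g ((comparison hdn ((SCSig d boxed).src g ++ w)).1 z) := by
  cases g with
  | endDot i => exact (comparison hdn w).2.endDot i z
  | startDot i => exact (comparison hdn w).2.startDot i z
  | merge i => exact (comparison hdn w).2.merge i z
  | split i => exact (comparison hdn w).2.split i z
  | four i j h => exact comparison_four h w z
  | six i j h => exact comparison_six h w z
  | box k h => exact box (hdn := hb h) (comparison hdn w).2 k z

theorem comparison_map : ∀ {u v : List (Fin (d - 1))} (D : Diag (SCSig d boxed) u v)
    (z : WebRing n d (word hdn u)),
    (comparison hdn v).1 ((baseState n d).map (SoergelToSchur.map hdn hb D) z) =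
      (LeftAlg.base d).map D ((comparison hdn u).1 z)
  | _, _, .id _, _ => rfl
  | _, _, .comp f g, z => (comparison_map g _).trans
      (congrArg ((LeftAlg.base d).map g) (comparison_map f z))
  | _, v, .zero _ _, _ => map_zero (comparison hdn v).1
  | _, v, .add f g, z => (map_add (comparison hdn v).1 _ _).trans
      (congrArg₂ (· + ·) (comparison_map f z) (comparison_map g z))
  | _, v, .smul q f, z => by
    -- Scalars act through `ℚ` on one side and through constant polynomials on the other; a ring
    -- homomorphism from `ℚ` is unique.
    have e : (comparison hdn v).1 (algebraMap ℚ _ q) =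
        ((LeftAlg.base d).run v).left (MvPolynomial.C q) :=
      RingHom.congr_fun (Subsingleton.elim ((comparison hdn v).1.toRingHom.comp (algebraMap ℚ _))
        (((LeftAlg.base d).run v).left.comp MvPolynomial.C)) q
    change (comparison hdn v).1 (q • (baseState n d).map (SoergelToSchur.map hdn hb f) z) =
      (MvPolynomial.C q : PolyRing d) • (LeftAlg.base d).map f _
    rw [Algebra.smul_def, Algebra.smul_def, map_mul, e, comparison_map f]
  | _, _, .gen g w, z => comparison_gen w g z
  | _, _, .cons i f, z => strand _ _ (comparison_map f) i z

end Matches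

end

/-! ### The isomorphism of bimodules and the triangles -/

open SLetter
open SC (lo hi)
open SoergelToSchur (color word)

noncomputable section

namespace Matches

variable {n d : ℕ} {hdn : d ≤ n} (w : List (Fin (d - 1)))

/-- Both sides are ring homomorphisms of the polynomial, so variables suffice. There the left action
on webs is minus the constant coefficient of `X - φ⁻¹(-x_j)`. -/
theorem comparison_webLeft (r : PolyRing d) :
    (comparison hdn w).1 (webLeft hdn _ r) = ekLeft w (signTwist d r) := by
  refine RingHom.congr_fun (f := (comparison hdn w).1.toRingHom.comp
    (webLeft hdn (word hdn w)).toRingHom) (g := ((LeftAlg.base d).run w).left.comp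
      (signTwist d).toRingHom) (MvPolynomial.ringHom_ext' (Subsingleton.elim _ _) fun j => ?_) r
  have e : webLeft hdn (word hdn w) (MvPolynomial.X j) = (comparison hdn w).1.symm
      (-((LeftAlg.base d).run w).left (MvPolynomial.X j)) := by
    rw [webLeft, MvPolynomial.aeval_X, (comparison hdn w).2.linear j, coeff_sub, coeff_X_zero,
      coeff_C_zero, zero_sub, neg_neg]
  refine (congrArg (comparison hdn w).1 e).trans
    (((comparison hdn w).1.apply_symm_apply _).trans ?_)
  refine (map_neg ((LeftAlg.base d).run w).left _).symm.trans (congrArg _ ?_)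
  exact (show signTwist d (MvPolynomial.X j) = _ from MvPolynomial.aeval_X _ _).symm

theorem comparison_webIncl (i : Fin (d - 1)) (z : WebRing n d (word hdn w)) :
    (comparison hdn (i :: w)).1 (webIncl hdn i w z) = ekIncl i w ((comparison hdn w).1 z) :=
  (comparison hdn w).2.stepEquiv_incl i z

theorem comparison_webRight (r : PolyRing d) :
    (comparison hdn w).1 (webRight n d _ r) = ekRight w (signTwist d r) := by
  induction w with
  | nil => rfl
  | cons i w ih =>
    have e1 : webRight n d (word hdn (i :: w)) r = webIncl hdn i w (webRight n d _ r) := rfl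
    have e2 : ekRight (i :: w) (signTwist d r) = ekIncl i w (ekRight w (signTwist d r)) := rfl
    rw [e1, e2, comparison_webIncl, ih]

theorem comparison_productMap (x : PolyRing d ⊗[ℚ] PolyRing d) :
    (comparison hdn w).1 (Algebra.TensorProduct.productMap (webLeft hdn _) (webRight n d _) x) =
      Algebra.TensorProduct.productMap (ekLeft w) (ekRight w)
        (Algebra.TensorProduct.map (signTwist d) (signTwist d) x) := by
  induction x with
  | zero => simp only [map_zero]
  | add x y hx hy => simp only [map_add, hx, hy]
  | tmul a b =>
    rw [Algebra.TensorProduct.productMap_apply_tmul, Algebra.TensorProduct.map_tmul,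
      Algebra.TensorProduct.productMap_apply_tmul, map_mul, comparison_webLeft,
      comparison_webRight]

variable (hdn) in
/-- The comparison isomorphism as an isomorphism of bimodules. -/
def bimoduleEquiv : webBimodule hdn (word hdn w) ≃ₗ[PolyRing d ⊗[ℚ] PolyRing d]
    (twist d).obj (ekBimodule w) :=
  { (comparison hdn w).1.toAddEquiv with
    map_smul' := fun x z => (map_mul (comparison hdn w).1 _ _).trans
      (congrArg (· * (comparison hdn w).1 z) (comparison_productMap w x)) }

variable (hdn) in
def bimoduleIso : webBimodule hdn (word hdn w) ≅ (twist d).obj (ekBimodule w) where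
  hom := ModuleCat.ofHom (X := webBimodule hdn (word hdn w)) (Y := (twist d).obj (ekBimodule w))
    (bimoduleEquiv hdn w).toLinearMap
  inv := ModuleCat.ofHom (X := (twist d).obj (ekBimodule w)) (Y := webBimodule hdn (word hdn w))
    (bimoduleEquiv hdn w).symm.toLinearMap
  hom_inv_id := by
    ext z
    exact (bimoduleEquiv hdn w).symm_apply_apply z
  inv_hom_id := by
    ext z
    exact (bimoduleEquiv hdn w).apply_symm_apply z

end Matches

end

open Matches in
theorem mainTheorem9 (n d : ℕ) (boxed : Bool) (hd : 0 < d) (hdn : d ≤ n)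
    (hb : boxed = true → d < n) :
    ∃ Φ : ∀ w : List (Fin (d - 1)), WebRing n d (SoergelToSchur.word hdn w) ≃+* EKRing d w,
      -- `Φ` is an isomorphism of bimodules, up to the normalization `x_j ↦ -x_j`
      (∀ w r, Φ w (webLeft hdn _ r) = ekLeft w (signTwist d r)) ∧
      (∀ w r, Φ w (webRight n d _ r) = ekRight w (signTwist d r)) ∧
      -- `Φ` is compatible with tensor products
      (∀ i w z, Φ (i :: w) (webIncl hdn i w z) = ekIncl i w (Φ w z)) ∧
      -- the triangle commutes on every diagram
      (∀ (u v : List (Fin (d - 1))) (D : Diag (SCSig d boxed) u v)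
          (z : WebRing n d (SoergelToSchur.word hdn u)),
        Φ v (fBim (SoergelToSchur.map hdn hb D) z) = fEK D (Φ u z)) ∧
      -- the triangle of functors commutes, by the isomorphism with components `Φ`
      (∀ (Sg : SigmaFunctor (boxed := boxed) hdn hb) (B : BimFunctor (n := n) (d := d) hdn)
          (E : EKFunctor d boxed),
        ∃ α : Sg.toFunctor ⋙ B.toFunctor ≅ E.toFunctor ⋙ twist d,
          ∀ (X : SoergelCat d boxed) (z : WebRing n d (SoergelToSchur.word hdn X.word)),
            (α.hom.app X).hom (toBimodule _ _ z) = Φ X.word z) := by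
  refine ⟨fun w => (comparison hdn w).1, comparison_webLeft, comparison_webRight,
    fun i w z => comparison_webIncl w i z, fun u v D z => comparison_map D z,
    fun Sg B E => ⟨NatIso.ofComponents (fun X => bimoduleIso hdn X.word) ?_, fun X z => rfl⟩⟩
  -- The three functors are known through their values on diagrams, so naturality on the class of
  -- `D` is the comparison for the representative `D`.
  rintro X Y ⟨D⟩
  ext z
  have h1 := B.map_ofDiag (X := ⟨word hdn X.word, SoergelToSchur.wt_word hdn X.word⟩)
    (Y := ⟨word hdn Y.word, SoergelToSchur.wt_word hdn Y.word⟩) (SoergelToSchur.map hdn hb D) z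
  rw [← Sg.map_ofDiag D] at h1
  exact (congrArg (comparison hdn Y.word).1 h1).trans ((comparison_map D z).trans
    (E.map_ofDiag D ((comparison hdn X.word).1 z)).symm)
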